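/- Let $n\ge 0$, $T=\mathbb R/2\pi\mathbb Z$, $X=(\mathbb R/\mathbb Z)^n\times T^n$ with $\omega={}^t\!dx\wedge d\theta$ and projection $\mu\colon X\to(\mathbb R/\mathbb Z)^n$. Let $(L,\nabla)$ be the quotient of the trivial line bundle $(\underline{\mathbb C},\,d-\sqrt{-1}\,{}^t\!x\,d\theta)$ on $\mathbb R^n\times T^n$ by the $\mathbb Z^n$-action $(x,\theta,v)\mapsto(x+m,\theta,e^{\sqrt{-1}\langle m,\theta\rangle}v)$; for an integer $k\ge1$, sections of $L^k$ are identified with functions $s$ on $\mathbb R^n\times T^n$ such that $s(x+m,\theta)=e^{\sqrt{-1}\langle km,\theta\rangle}s(x,\theta)$ for $m\in\mathbb Z^n$. Let $\Omega=P+\sqrt{-1}Q$ be a complex symmetric $n\times n$ matrix with $P,Q$ real and $Q$ positive definite, and give $X$ the complex structure $J_\Omega$ with $T^{0,1}X=\mathrm{Span}_{\mathbb C}\{\partial_{x_i}+\sum_j\Omega_{ij}\partial_{\theta_j}\}_i$. *Kähler side.* $H^0(X_{J_\Omega};L^k)\subset L^2(X;L^k)$ is the space of smooth sections $s$ with $\nabla_{\bar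 Z}s=0$ for $\bar Z\in T^{0,1}X$; the inner product is taken with respect to $dx\,d\theta$. For $f\in C^\infty(X)$ the Berezin–Toeplitz operator is $T^k(f)=\Pi_kM_f\Pi_k^*$ on $H^0(X_{J_\Omega};L^k)$, where $M_f$ is multiplication by $f$ and $\Pi_k$ is the orthogonal projection of $L^2(X;L^k)$ onto $H^0(X_{J_\Omega};L^k)$. The theta functions are, for $b\in(\tfrac1k\mathbb Z/\mathbb Z)^n$, $$\Theta^k_b(x,\theta)=\sum_{l\in\mathbb Z^n,\,[l/k]=b}(2\pi)^{-n/2}a_k\,e^{\frac{\sqrt{-1}k}{2}{}^t(x-l/k)\Omega(x-l/k)}e^{\sqrt{-1}\langle l,\theta\rangle},\qquad a_k^{-2}=\int_{\mathbb R^n}e^{-k\,{}^t\!xQx}dx .$$ *Real side.* Let $B_k=(\tfrac1k\mathbb Z/\mathbb Z)^n$ be the set of $b\in(\mathbb R/\mathbb Z)^n$ such that $L^k$ has a nonzero parallel section over the fibre $X_b=\mu^{-1}(b)$, and let $\mathcal H_k=\bigoplus_{b\in B_k}H^0(X_b;L^k\otimes|\Lambda|^{1/2}X_b)$ be the orthogonal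 direct sum of the spaces of parallel sections over the fibres. It has the orthonormal basis $\vartheta^k_b=e^{\sqrt{-1}k\langle x,\theta\rangle}\sqrt{d'\theta}$ ($b\in B_k$, $x\in\mathbb R^n$ a lift of $b$), where $d'\theta$ is the normalized Haar measure of $T^n$. Let $H_P=\mathrm{Span}\{\partial_{x_i}+\sum_jP_{ij}\partial_{\theta_j}\}_i$, a horizontal distribution for $\mu$, and let $\mathcal U$ be an open covering of $(\mathbb R/\mathbb Z)^n$ that is locally finite, whose members have compact closures, and such that each member and each intersection of two members admits an open affine embedding into $\mathbb R^n$ with convex image. Points $b,c$ are called close if they lie in a common $U\in\mathcal U$; they are then joined by a unique affine segment in $U$, with midpoint $\frac{b+c}2$, along which $H_P$ (on the fibres), $\nabla$ (on $L^k$) and the flat connection (on half-densities) define parallel transport, and hence a pairing $\langle\cdot,\cdot\rangle_{\mathcal U}$ of sections over $X_b$ and $X_c$ and an identification of $X_{(b+c)/2}$ with $X_c$. The bounded operator $\phi^k_{H_P,\mathcal U}(f)$ on $\mathcal H_k$ is defined, for $c\in B_k$ and $\psi_c\in H^0(X_c;L^k\otimes|\Lambda|^{1/2}X_c)$, by $$\phi^k_{H_P,\mathcal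 U}(f)\psi_c=\sum_{b\in B_k,\ b\text{ close to }c}\langle\vartheta^k_b,\,f|_{X_{(b+c)/2}}\psi_c\rangle_{\mathcal U}\;\vartheta^k_b .$$ **Theorem.** For every $k\ge1$ the subspace $H^0(X_{J_\Omega};L^k)\subset L^2(X;L^k)$ is closed and there is a unitary isomorphism $\Phi_k\colon\mathcal H_k\to H^0(X_{J_\Omega};L^k)$ with $\Phi_k(\vartheta^k_b)=\Theta^k_b$ for all $b\in B_k$; and for every $f\in C^\infty(X)$, $$\lim_{k\to\infty}\bigl\|\phi^k_{H_P,\mathcal U}(f)-\Phi_k^{-1}\,T^k(f)\,\Phi_k\bigr\|=0 .$$ -/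

import Mathlib

open scoped ContDiff Matrix

noncomputable section

namespace TorusQuant

/-! ## The symplectic torus `X = (ℝ/ℤ)ⁿ × Tⁿ`, with `T = ℝ/2πℤ` and `ω = ᵗdx ∧ dθ` -/

instance factTwoPi : Fact (0 < 2 * Real.pi) := ⟨Real.two_pi_pos⟩

/-- The base `(ℝ/ℤ)ⁿ` of the Lagrangian fibration. -/
abbrev Base (n : ℕ) : Type := Fin n → UnitAddCircle

/-- The fibre `Tⁿ = (ℝ/2πℤ)ⁿ`. -/
abbrev Torus (n : ℕ) : Type := Fin n → AddCircle (2 * Real.pi)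

/-- `X = (ℝ/ℤ)ⁿ × Tⁿ`. -/
abbrev Total (n : ℕ) : Type := Base n × Torus n

/-- The covering space `ℝⁿ × Tⁿ` of `X`. -/
abbrev Cover (n : ℕ) : Type := (Fin n → ℝ) × Torus n

/-- The projection `ℝⁿ → (ℝ/ℤ)ⁿ`. -/
def proj {n : ℕ} (x : Fin n → ℝ) : Base n := fun j => (x j : UnitAddCircle)

/-- The projection `ℝⁿ → Tⁿ`. -/
def tor {n : ℕ} (t : Fin n → ℝ) : Torus n := fun j => (t j : AddCircle (2 * Real.pi))

/-- The character `θ ↦ exp(i⟨m, θ⟩)` of `Tⁿ`, for `m ∈ ℤⁿ`. -/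
def char {n : ℕ} (m : Fin n → ℤ) (θ : Torus n) : ℂ := ∏ j, fourier (m j) (θ j)

/-- Smoothness of a function on `X`: its lift to the universal cover `ℝⁿ × ℝⁿ` is smooth. -/
def IsSmooth {n : ℕ} (f : Total n → ℂ) : Prop :=
  ContDiff ℝ ∞ (fun p : (Fin n → ℝ) × (Fin n → ℝ) => f (proj p.1, tor p.2))

theorem proj_continuous {n : ℕ} : Continuous (proj (n := n)) :=
  continuous_pi fun j => (AddCircle.continuous_mk' 1).comp (continuous_apply j)

theorem tor_isOpenQuotientMap {n : ℕ} : IsOpenQuotientMap (tor (n := n)) :=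
  IsOpenQuotientMap.piMap fun _ => QuotientAddGroup.isOpenQuotientMap_mk

theorem proj_eq_iff {n : ℕ} {x y : Fin n → ℝ} :
    proj x = proj y ↔ ∃ m : Fin n → ℤ, y = x + fun j => (m j : ℝ) := by
  constructor
  · intro h
    have h1 : ∀ j, ∃ m : ℤ, y j = x j + m := by
      intro j
      have h2 : ((y j - x j : ℝ) : UnitAddCircle) = 0 := by
        rw [AddCircle.coe_sub, sub_eq_zero]
        exact (congrFun h j).symm
      obtain ⟨m, hm⟩ := (AddCircle.coe_eq_zero_iff (1 : ℝ)).1 h2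
      exact ⟨m, by simp at hm; linarith⟩
    choose m hm using h1
    exact ⟨m, funext hm⟩
  · rintro ⟨m, rfl⟩
    funext j
    simp [proj]

theorem char_tor {n : ℕ} (m : Fin n → ℤ) (t : Fin n → ℝ) :
    char m (tor t) = Complex.exp (Complex.I * ∑ j, (m j : ℂ) * (t j : ℂ)) := by
  rw [Finset.mul_sum, Complex.exp_sum]
  refine Finset.prod_congr rfl fun j _ => ?_
  rw [tor, fourier_coe_apply]
  congr 1
  have : (Real.pi : ℂ) ≠ 0 := by exact_mod_cast Real.pi_ne_zero
  push_cast
  field_simp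

theorem char_continuous {n : ℕ} (m : Fin n → ℤ) : Continuous (char (n := n) m) :=
  continuous_finsetProd _ fun j _ => (fourier (m j)).continuous.comp (continuous_apply j)

/-! ## Kähler quantization

The prequantum line bundle `L` is the quotient of the trivial bundle `(ℂ, d - i ᵗx dθ)` over
`ℝⁿ × Tⁿ` by the `ℤⁿ`-action `(x, θ, v) ↦ (x + m, θ, exp(i⟨m, θ⟩) v)`. A section of `L^k` is
identified with its lift, an equivariant function on `ℝⁿ × Tⁿ`. -/

/-- The Siegel upper half space. -/
def siegelUpperHalfSpace (n : ℕ) : Set (Matrix (Fin n) (Fin n) ℂ) :=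
  {Ω | Ωᵀ = Ω ∧ (Ω.map Complex.im).PosDef}

/-- A function on `ℝⁿ × Tⁿ`, viewed on the universal cover `ℝⁿ × ℝⁿ`. -/
def upstairs {n : ℕ} (s : Cover n → ℂ) : (Fin n → ℝ) × (Fin n → ℝ) → ℂ :=
  fun p => s (p.1, tor p.2)

/-- The covariant derivative of a section of `L^k` at `p = (x, θ)` in the real direction
`w = (u, η)`, for the connection `∇ = d - i k ᵗx dθ`. -/
def covDeriv {n : ℕ} (k : ℕ+) (s : Cover n → ℂ) (p w : (Fin n → ℝ) × (Fin n → ℝ)) : ℂ :=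
  fderiv ℝ (upstairs s) p w - Complex.I * (k : ℂ) * ((p.1 ⬝ᵥ w.2 : ℝ) : ℂ) * upstairs s p

/-- Smooth holomorphic sections of `L^k`, for the complex structure with
`T^{0,1} = Span {∂/∂x_i + ∑_j Ω_ij ∂/∂θ_j}`. -/
structure IsHolomorphicSection {n : ℕ} (Ω : Matrix (Fin n) (Fin n) ℂ) (k : ℕ+)
    (s : Cover n → ℂ) : Prop where
  equivariant : ∀ (m : Fin n → ℤ) (x : Fin n → ℝ) (θ : Torus n),
    s (x + fun j => (m j : ℝ), θ) = char (fun j => (k : ℤ) * m j) θ * s (x, θ)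
  smooth : ContDiff ℝ ∞ (upstairs s)
  holomorphic : ∀ (p : (Fin n → ℝ) × (Fin n → ℝ)) (i : Fin n),
    covDeriv k s p (Pi.single i 1, 0) + ∑ j, Ω i j * covDeriv k s p (0, Pi.single j 1) = 0

/-- The Liouville measure `dx dθ` on the fundamental domain `[0,1)ⁿ × Tⁿ` of the
`ℤⁿ`-action. -/
def fundMeasure (n : ℕ) : MeasureTheory.Measure (Cover n) :=
  MeasureTheory.volume.restrict ((Set.univ.pi fun _ => Set.Ico (0 : ℝ) 1) ×ˢ Set.univ)

/-- `L²(X; L^k)`: an equivariant function on `ℝⁿ × Tⁿ` is determined by its restriction to the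
fundamental domain, which may be any square integrable function. -/
abbrev L2 (n : ℕ) : Type := MeasureTheory.Lp ℂ 2 (fundMeasure n)

/-- `H⁰(X; L^k)`, the space of holomorphic sections, as a subspace of `L²(X; L^k)`. -/
def holSpace {n : ℕ} (Ω : Matrix (Fin n) (Fin n) ℂ) (k : ℕ+) : Submodule ℂ (L2 n) where
  carrier := {u | ∃ s : Cover n → ℂ, IsHolomorphicSection Ω k s ∧ u =ᵐ[fundMeasure n] s}
  add_mem' := by
    rintro u v ⟨s, hs, hu⟩ ⟨t, ht, hv⟩
    have hS : Differentiable ℝ (upstairs s) := hs.smooth.differentiable (by simp)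
    have hT : Differentiable ℝ (upstairs t) := ht.smooth.differentiable (by simp)
    have hadd : upstairs (s + t) = upstairs s + upstairs t := rfl
    have hcov : ∀ p w, covDeriv k (s + t) p w = covDeriv k s p w + covDeriv k t p w := by
      intro p w
      simp only [covDeriv, hadd, fderiv_add (hS p) (hT p), Pi.add_apply,
        add_apply]
      ring
    refine ⟨s + t, ⟨fun m x θ => ?_, hs.smooth.add ht.smooth, fun p i => ?_⟩, ?_⟩
    · simp only [Pi.add_apply, hs.equivariant, ht.equivariant]
      ring
    · have h1 := hs.holomorphic p i
      have h2 := ht.holomorphic p i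
      simp only [hcov, mul_add, Finset.sum_add_distrib]
      linear_combination h1 + h2
    · filter_upwards [MeasureTheory.Lp.coeFn_add u v, hu, hv] with p h h1 h2
      rw [h, Pi.add_apply, h1, h2, Pi.add_apply]
  zero_mem' := by
    have h0 : upstairs (0 : Cover n → ℂ) = 0 := rfl
    refine ⟨0, ⟨fun m x θ => by simp, ?_, fun p i => ?_⟩, MeasureTheory.Lp.coeFn_zero _ _ _⟩
    · rw [h0]
      exact contDiff_const
    · simp [covDeriv, h0]
  smul_mem' := by
    rintro c u ⟨s, hs, hu⟩
    have hS : Differentiable ℝ (upstairs s) := hs.smooth.differentiable (by simp)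
    have hsmul : upstairs (c • s) = c • upstairs s := rfl
    have hcov : ∀ p w, covDeriv k (c • s) p w = c * covDeriv k s p w := by
      intro p w
      simp only [covDeriv, hsmul, fderiv_const_smul (hS p), Pi.smul_apply,
        smul_apply, smul_eq_mul]
      ring
    refine ⟨c • s, ⟨fun m x θ => ?_, hs.smooth.const_smul c, fun p i => ?_⟩, ?_⟩
    · simp only [Pi.smul_apply, hs.equivariant, smul_eq_mul]
      ring
    · have h1 := hs.holomorphic p i
      simp only [hcov]
      have h2 : ∀ j, Ω i j * (c * covDeriv k s p (0, Pi.single j 1)) =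
          c * (Ω i j * covDeriv k s p (0, Pi.single j 1)) := fun j => by ring
      simp only [h2, ← Finset.mul_sum]
      linear_combination c * h1
    · filter_upwards [MeasureTheory.Lp.coeFn_smul c u, hu] with p h h1
      simp [h, h1]

theorem mul_memLp {n : ℕ} (f : C(Total n, ℂ)) (u : L2 n) :
    MeasureTheory.MemLp (fun p : Cover n => f (proj p.1, p.2) * u p) 2 (fundMeasure n) := by
  have hc : Continuous fun p : Cover n => f (proj p.1, p.2) :=
    f.continuous.comp ((proj_continuous.comp continuous_fst).prodMk continuous_snd)
  refine MeasureTheory.MemLp.of_le_mul (c := ‖f‖) (MeasureTheory.Lp.memLp u)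
    (hc.aestronglyMeasurable.mul (MeasureTheory.Lp.aestronglyMeasurable u)) ?_
  filter_upwards with p
  rw [norm_mul]
  gcongr
  exact f.norm_coe_le_norm _

/-- The multiplication operator `M_f` on `L²(X; L^k)`. -/
def mulOp {n : ℕ} (f : C(Total n, ℂ)) : L2 n →L[ℂ] L2 n :=
  LinearMap.mkContinuous
    { toFun := fun u => (mul_memLp f u).toLp _
      map_add' := fun u v => by
        rw [← MeasureTheory.MemLp.toLp_add (mul_memLp f u) (mul_memLp f v)]
        refine MeasureTheory.MemLp.toLp_congr _ _ ?_
        filter_upwards [MeasureTheory.Lp.coeFn_add u v] with p h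
        rw [h, Pi.add_apply, mul_add]
        rfl
      map_smul' := fun c u => by
        rw [RingHom.id_apply, ← MeasureTheory.MemLp.toLp_const_smul c (mul_memLp f u)]
        refine MeasureTheory.MemLp.toLp_congr _ _ ?_
        filter_upwards [MeasureTheory.Lp.coeFn_smul c u] with p h
        simp [h, mul_left_comm] }
    ‖f‖ (fun u => by
      refine MeasureTheory.Lp.norm_le_mul_norm_of_ae_le_mul ?_
      filter_upwards [(mul_memLp f u).coeFn_toLp] with p h
      simp only [LinearMap.coe_mk, AddHom.coe_mk, h, norm_mul]
      gcongr
      exact f.norm_coe_le_norm _)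

/-- Berezin–Toeplitz quantization `T^k(f) = Π_k M_f Π_k^*` on `H⁰(X; L^k)`; the adjoint of the
orthogonal projection `Π_k : L² → H⁰` is the inclusion. -/
def toeplitz {n : ℕ} (Ω : Matrix (Fin n) (Fin n) ℂ) (k : ℕ+)
    [(holSpace Ω k).HasOrthogonalProjection] (f : C(Total n, ℂ)) :
    holSpace Ω k →L[ℂ] holSpace Ω k :=
  (holSpace Ω k).orthogonalProjectionOnto ∘L mulOp f ∘L (holSpace Ω k).subtypeL

/-- The normalization constant `a` with `a^{-2} = ∫ exp(-k ᵗx (Im Ω) x) dx`. -/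
def gaussConst {n : ℕ} (Ω : Matrix (Fin n) (Fin n) ℂ) (k : ℕ+) : ℝ :=
  (Real.sqrt (∫ x : Fin n → ℝ, Real.exp (-(k : ℝ) * (x ⬝ᵥ (Ω.map Complex.im) *ᵥ x))))⁻¹

/-- `Ψ(x, θ) = (2π)^{-n/2} a exp((ik/2) ᵗ(x - l/k) Ω (x - l/k)) exp(i⟨l, θ⟩)`. -/
def gaussSection {n : ℕ} (Ω : Matrix (Fin n) (Fin n) ℂ) (k : ℕ+) (l : Fin n → ℤ) :
    Cover n → ℂ := fun p =>
  let y : Fin n → ℂ := fun j => ((p.1 j - (l j : ℝ) / (k : ℝ) : ℝ) : ℂ)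
  (((2 * Real.pi) ^ (-(n : ℝ) / 2) * gaussConst Ω k : ℝ) : ℂ) *
    Complex.exp (Complex.I * (k : ℂ) / 2 * (y ⬝ᵥ Ω *ᵥ y)) * char l p.2

/-- The classical theta function `Θ_b = ∑_{[l/k] = b} Ψ_{l/k}`, as an equivariant function on
`ℝⁿ × Tⁿ`. -/
def theta {n : ℕ} (Ω : Matrix (Fin n) (Fin n) ℂ) (k : ℕ+) (b : Base n) : Cover n → ℂ := fun p =>
  ∑' l : {l : Fin n → ℤ // proj (fun j => (l j : ℝ) / (k : ℝ)) = b}, gaussSection Ω k l p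

/-! ## Quantization by the real polarization of `μ : X → (ℝ/ℤ)ⁿ` -/

/-- The lifts to `ℝⁿ` of a point of the base. -/
abbrev Lift {n : ℕ} (b : Base n) : Type := {x : Fin n → ℝ // proj x = b}

/-- Parallel sections of `L^k ⊗ |Λ|^{1/2} X_b` over the fibre `X_b`. A section is written in the
flat frame `√(d'θ)` of the half-density bundle, where `d'θ` is the normalized Haar measure of
`Tⁿ`; it is given by its lift, an equivariant function on `{x | proj x = b} × Tⁿ`. Parallel
means `∂s/∂θ_j = i k x_j s`. -/
def parallelSections (n : ℕ) (k : ℕ+) (b : Base n) : Submodule ℂ (Lift b → Torus n → ℂ) where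
  carrier := {s |
    (∀ x, ContDiff ℝ ∞ fun t => s x (tor t)) ∧
    (∀ (x : Lift b) (t : Fin n → ℝ) (j : Fin n),
      fderiv ℝ (fun t => s x (tor t)) t (Pi.single j 1) =
        Complex.I * (k : ℂ) * (x.1 j : ℂ) * s x (tor t)) ∧
    (∀ (x y : Lift b) (m : Fin n → ℤ), (y.1 = x.1 + fun j => (m j : ℝ)) →
      ∀ θ, s y θ = char (fun j => (k : ℤ) * m j) θ * s x θ)}
  add_mem' := by
    rintro s t ⟨hs1, hs2, hs3⟩ ⟨ht1, ht2, ht3⟩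
    refine ⟨fun x => (hs1 x).add (ht1 x), fun x τ j => ?_, fun x y m hm θ => ?_⟩
    · have h := fderiv_fun_add (((hs1 x).differentiable (by simp)) τ)
        (((ht1 x).differentiable (by simp)) τ)
      simp only [Pi.add_apply, h, add_apply, hs2, ht2]
      ring
    · simp only [Pi.add_apply, hs3 x y m hm, ht3 x y m hm]
      ring
  zero_mem' := ⟨fun x => contDiff_const, fun x t j => by simp, fun x y m hm θ => by simp⟩
  smul_mem' := by
    rintro c s ⟨hs1, hs2, hs3⟩
    refine ⟨fun x => (hs1 x).const_smul c, fun x τ j => ?_, fun x y m hm θ => ?_⟩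
    · have h := fderiv_fun_const_smul (((hs1 x).differentiable (by simp)) τ) c
      simp only [Pi.smul_apply, h, smul_apply, hs2]
      simp only [smul_eq_mul]
      ring
    · simp only [Pi.smul_apply, hs3 x y m hm, smul_eq_mul]
      ring

/-- The Hilbert space `H⁰(X_b; L^k ⊗ |Λ|^{1/2} X_b)`. -/
def FiberSpace (n : ℕ) (k : ℕ+) (b : Base n) : Type := parallelSections n k b

instance (n : ℕ) (k : ℕ+) (b : Base n) : AddCommGroup (FiberSpace n k b) :=
  inferInstanceAs (AddCommGroup (parallelSections n k b))

instance (n : ℕ) (k : ℕ+) (b : Base n) : Module ℂ (FiberSpace n k b) :=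
  inferInstanceAs (Module ℂ (parallelSections n k b))

/-- The value of a fibrewise section at a point of the covering space. -/
def FiberSpace.val {n : ℕ} {k : ℕ+} {b : Base n} (s : FiberSpace n k b) (x : Lift b)
    (θ : Torus n) : ℂ := Subtype.val (p := fun s => s ∈ parallelSections n k b) s x θ

theorem FiberSpace.ext_val {n : ℕ} {k : ℕ+} {b : Base n} {s t : FiberSpace n k b}
    (h : ∀ x θ, s.val x θ = t.val x θ) : s = t :=
  Subtype.ext (funext fun x => funext fun θ => h x θ)

theorem FiberSpace.val_add {n : ℕ} {k : ℕ+} {b : Base n} (s t : FiberSpace n k b) (x : Lift b)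
    (θ : Torus n) : (s + t).val x θ = s.val x θ + t.val x θ := rfl

theorem FiberSpace.val_smul {n : ℕ} {k : ℕ+} {b : Base n} (c : ℂ) (s : FiberSpace n k b)
    (x : Lift b) (θ : Torus n) : (c • s).val x θ = c * s.val x θ := rfl

theorem FiberSpace.val_zero {n : ℕ} {k : ℕ+} {b : Base n} (x : Lift b) (θ : Torus n) :
    (0 : FiberSpace n k b).val x θ = 0 := rfl

theorem tor_zero {n : ℕ} : tor (0 : Fin n → ℝ) = 0 := by
  funext j
  simp [tor]

theorem hasFDerivAt_phase {n : ℕ} (c : ℂ) (x t : Fin n → ℝ) :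
    HasFDerivAt (fun t : Fin n → ℝ => Complex.exp (c * ∑ j, (x j : ℂ) * (t j : ℂ)))
      (Complex.exp (c * ∑ j, (x j : ℂ) * (t j : ℂ)) • (c • ∑ j, (x j : ℂ) •
        (Complex.ofRealCLM.comp (ContinuousLinearMap.proj j : (Fin n → ℝ) →L[ℝ] ℝ)))) t := by
  have h1 : ∀ j, HasFDerivAt (fun t : Fin n → ℝ => (x j : ℂ) * (t j : ℂ)) ((x j : ℂ) •
      (Complex.ofRealCLM.comp (ContinuousLinearMap.proj j : (Fin n → ℝ) →L[ℝ] ℝ))) t := fun j =>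
    HasFDerivAt.const_mul (𝔸 := ℂ)
      (Complex.ofRealCLM.comp (ContinuousLinearMap.proj j : (Fin n → ℝ) →L[ℝ] ℝ)).hasFDerivAt _
  have h2 := HasFDerivAt.fun_sum (u := Finset.univ) fun j _ => h1 j
  exact (h2.const_mul c).cexp

/-- A parallel section is determined on each lift of the fibre by its value at one point. -/
theorem FiberSpace.val_tor {n : ℕ} {k : ℕ+} {b : Base n} (s : FiberSpace n k b) (x : Lift b)
    (t : Fin n → ℝ) : s.val x (tor t) =
      s.val x 0 * Complex.exp (Complex.I * (k : ℂ) * ∑ j, (x.1 j : ℂ) * (t j : ℂ)) := by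
  obtain ⟨h1, h2, -⟩ := s.2
  set g : (Fin n → ℝ) → ℂ := fun t => s.val x (tor t) with hg
  have hd : Differentiable ℝ g := (h1 x).differentiable (by simp)
  have hprod : ∀ t, HasFDerivAt (fun t : Fin n → ℝ => g t *
      Complex.exp (-(Complex.I * (k : ℂ)) * ∑ j, (x.1 j : ℂ) * (t j : ℂ)))
      (0 : (Fin n → ℝ) →L[ℝ] ℂ) t := by
    intro t
    have h := (hd t).hasFDerivAt.mul (hasFDerivAt_phase (-(Complex.I * (k : ℂ))) x.1 t)
    refine HasFDerivAt.congr_fderiv (𝕜 := ℝ) h ?_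
    apply ContinuousLinearMap.coe_injective
    refine LinearMap.pi_ext' fun j => LinearMap.ext_ring ?_
    have h3 : fderiv ℝ g t (Pi.single j 1) = Complex.I * (k : ℂ) * (x.1 j : ℂ) * g t := h2 x t j
    have h4 : ∑ i, (x.1 i : ℂ) * (((Pi.single j 1 : Fin n → ℝ) i : ℝ) : ℂ) = (x.1 j : ℂ) := by
      rw [Finset.sum_eq_single j]
      · simp
      · intro i _ hi
        simp [Pi.single_eq_of_ne hi]
      · simp
    simp [h3, h4]
    ring
  have hconst := is_const_of_fderiv_eq_zero (𝕜 := ℝ) (fun t => (hprod t).differentiableAt)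
    (fun t => (hprod t).fderiv) t 0
  simp only [hg, tor_zero, Pi.zero_apply, Complex.ofReal_zero, mul_zero, Finset.sum_const_zero,
    Complex.exp_zero, mul_one] at hconst
  rw [← hconst, mul_assoc, ← Complex.exp_add]
  simp

theorem FiberSpace.val_continuous {n : ℕ} {k : ℕ+} {b : Base n} (s : FiberSpace n k b)
    (x : Lift b) : Continuous (s.val x) :=
  tor_isOpenQuotientMap.isQuotientMap.continuous_iff.2 (s.2.1 x).continuous

theorem FiberSpace.conj_val_mul {n : ℕ} {k : ℕ+} {b : Base n} (s t : FiberSpace n k b)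
    (x : Lift b) (θ : Torus n) :
    starRingEnd ℂ (s.val x θ) * t.val x θ = starRingEnd ℂ (s.val x 0) * t.val x 0 := by
  obtain ⟨τ, rfl⟩ := tor_isOpenQuotientMap.surjective θ
  rw [s.val_tor, t.val_tor, map_mul, ← Complex.exp_conj]
  have h : starRingEnd ℂ (Complex.I * (k : ℂ) * ∑ j, (x.1 j : ℂ) * (τ j : ℂ)) =
      -(Complex.I * (k : ℂ) * ∑ j, (x.1 j : ℂ) * (τ j : ℂ)) := by
    simp
  rw [h, mul_mul_mul_comm, ← Complex.exp_add]
  simp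

theorem FiberSpace.eq_zero_of_val {n : ℕ} {k : ℕ+} {b : Base n} {s : FiberSpace n k b}
    (x : Lift b) (h : s.val x 0 = 0) : s = 0 := by
  refine FiberSpace.ext_val fun y θ => ?_
  obtain ⟨m, hm⟩ := proj_eq_iff.1 (x.2.trans y.2.symm)
  obtain ⟨τ, hτ⟩ := tor_isOpenQuotientMap.surjective θ
  have h1 : s.val y θ = _ := s.2.2.2 x y m hm θ
  have h2 : s.val x θ = 0 := by rw [← hτ, s.val_tor, h, zero_mul]
  rw [h1, FiberSpace.val_zero]
  exact mul_eq_zero_of_right _ h2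

/-- A chosen lift of a point of the base. -/
def baseLift {n : ℕ} (b : Base n) : Lift b :=
  ⟨fun j => (b j).out, funext fun j => QuotientAddGroup.out_eq' (b j)⟩

/-- The normalized Haar measure `d'θ` on `Tⁿ`. -/
def haarTorus (n : ℕ) : MeasureTheory.Measure (Torus n) :=
  MeasureTheory.Measure.pi fun _ => AddCircle.haarAddCircle

instance (n : ℕ) : MeasureTheory.IsProbabilityMeasure (haarTorus n) :=
  inferInstanceAs (MeasureTheory.IsProbabilityMeasure
    (MeasureTheory.Measure.pi fun _ : Fin n => AddCircle.haarAddCircle))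

theorem fiber_inner_eq {n : ℕ} {k : ℕ+} {b : Base n} (s t : FiberSpace n k b) (x : Lift b) :
    ∫ θ, starRingEnd ℂ (s.val x θ) * t.val x θ ∂haarTorus n =
      starRingEnd ℂ (s.val x 0) * t.val x 0 := by
  simp_rw [fun θ => s.conj_val_mul t x θ]
  simp

/-- The Hilbert space structure of `H⁰(X_b; L^k ⊗ |Λ|^{1/2} X_b)`: the inner product is
`⟨s, t⟩ = ∫ conj(s) t d'θ`, where the integrand does not depend on the lift of `b`. -/
@[reducible] def fiberCore (n : ℕ) (k : ℕ+) (b : Base n) : InnerProductSpace.Core ℂ (FiberSpace n k b) where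
  inner s t := ∫ θ, starRingEnd ℂ (s.val (baseLift b) θ) * t.val (baseLift b) θ ∂haarTorus n
  conj_inner_symm s t := by simp only [fiber_inner_eq]; simp [mul_comm]
  re_inner_nonneg s := by
    simp only [fiber_inner_eq]
    simp only [← Complex.normSq_eq_conj_mul_self]
    exact Complex.normSq_nonneg _
  add_left r s t := by simp only [fiber_inner_eq]; simp [FiberSpace.val_add, add_mul]
  smul_left s t c := by simp only [fiber_inner_eq]; simp [FiberSpace.val_smul, mul_assoc]
  definite s h := by
    simp only [fiber_inner_eq] at h
    simp only [← Complex.normSq_eq_conj_mul_self] at h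
    exact FiberSpace.eq_zero_of_val (baseLift b) (Complex.normSq_eq_zero.1 (by exact_mod_cast h))

instance (n : ℕ) (k : ℕ+) (b : Base n) : NormedAddCommGroup (FiberSpace n k b) :=
  (fiberCore n k b).toNormedAddCommGroup

instance (n : ℕ) (k : ℕ+) (b : Base n) : InnerProductSpace ℂ (FiberSpace n k b) :=
  InnerProductSpace.ofCore (fiberCore n k b).toCore

instance (n : ℕ) (k : ℕ+) (b : Base n) : FiniteDimensional ℂ (FiberSpace n k b) :=
  FiniteDimensional.of_injective
    ({ toFun := fun s => s.val (baseLift b) 0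
       map_add' := fun _ _ => rfl
       map_smul' := fun _ _ => rfl } : FiberSpace n k b →ₗ[ℂ] ℂ)
    ((injective_iff_map_eq_zero _).2 fun _ h => FiberSpace.eq_zero_of_val _ h)

/-- The set `B_k` of `k`-Bohr–Sommerfeld points: the fibre carries a nontrivial parallel
section of `L^k`. -/
def bohrSommerfeld (n : ℕ) (k : ℕ+) : Set (Base n) := {b | ∃ s : FiberSpace n k b, s ≠ 0}

theorem bohrSommerfeld_integral {n : ℕ} {k : ℕ+} {b : Base n} (hb : b ∈ bohrSommerfeld n k)
    (x : Lift b) (j : Fin n) : ∃ m : ℤ, (k : ℝ) * x.1 j = m := by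
  obtain ⟨s, hs⟩ := hb
  have h0 : s.val x 0 ≠ 0 := fun h => hs (FiberSpace.eq_zero_of_val x h)
  have h1 : tor (Pi.single j (2 * Real.pi) : Fin n → ℝ) = 0 := by
    funext i
    by_cases hi : i = j
    · subst hi
      simp only [tor, Pi.single_eq_same, Pi.zero_apply]
      exact AddCircle.coe_period _
    · simp [tor, Pi.single_eq_of_ne hi]
  have h2 := s.val_tor x (Pi.single j (2 * Real.pi))
  have h4 : ∑ i, (x.1 i : ℂ) * (((Pi.single j (2 * Real.pi) : Fin n → ℝ) i : ℝ) : ℂ) =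
      (x.1 j : ℂ) * (2 * Real.pi) := by
    rw [Finset.sum_eq_single j]
    · simp
    · intro i _ hi
      simp [Pi.single_eq_of_ne hi]
    · simp
  rw [h1, h4, eq_comm, mul_eq_left₀ h0, Complex.exp_eq_one_iff] at h2
  obtain ⟨m, hm⟩ := h2
  refine ⟨m, ?_⟩
  have hpi : (Real.pi : ℂ) ≠ 0 := by exact_mod_cast Real.pi_ne_zero
  have h5 : ((k : ℂ) * (x.1 j : ℂ)) * (2 * Real.pi * Complex.I) =
      (m : ℂ) * (2 * Real.pi * Complex.I) := by linear_combination hm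
  have h6 := mul_right_cancel₀ (mul_ne_zero (mul_ne_zero two_ne_zero hpi) Complex.I_ne_zero) h5
  exact_mod_cast h6

theorem bohrSommerfeld_finite (n : ℕ) (k : ℕ+) : (bohrSommerfeld n k).Finite := by
  refine (Set.Finite.pi' (t := fun _ : Fin n => {u : UnitAddCircle | (k : ℕ) • u = 0})
    fun _ => AddCircle.finite_torsion (1 : ℝ) k.pos).subset fun b hb j => ?_
  obtain ⟨m, hm⟩ := bohrSommerfeld_integral hb (baseLift b) j
  have hbj : b j = (((baseLift b).1 j : ℝ) : UnitAddCircle) := (congrFun (baseLift b).2 j).symm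
  rw [Set.mem_ofPred_eq, hbj, ← AddCircle.coe_nsmul, AddCircle.coe_eq_zero_iff]
  exact ⟨m, by simp [← hm]⟩

instance (n : ℕ) (k : ℕ+) : Fintype (bohrSommerfeld n k) := (bohrSommerfeld_finite n k).fintype

instance (n : ℕ) (k : ℕ+) : DecidableEq (bohrSommerfeld n k) := Classical.decEq _

/-- The quantum Hilbert space `⊕_{b ∈ B_k} H⁰(X_b; L^k ⊗ |Λ|^{1/2} X_b)` (orthogonal sum). -/
abbrev QuantumSpace (n : ℕ) (k : ℕ+) : Type :=
  PiLp 2 fun b : bohrSommerfeld n k => FiberSpace n k b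

/-- The parallel section `ϑ_b = exp(ik⟨x, θ⟩) √(d'θ)` over the fibre of a Bohr–Sommerfeld point;
here `x` is a lift of `b`, so that `k x` is an integral vector. -/
def frame {n : ℕ} {k : ℕ+} (b : bohrSommerfeld n k) : FiberSpace n k b.1 :=
  ⟨fun x θ => char (fun j => round ((k : ℝ) * x.1 j)) θ, by
    have hr : ∀ (x : Lift b.1) j, ((round ((k : ℝ) * x.1 j) : ℤ) : ℝ) = (k : ℝ) * x.1 j := by
      intro x j
      obtain ⟨m, hm⟩ := bohrSommerfeld_integral b.2 x j
      rw [hm, round_intCast]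
    have hf : ∀ (x : Lift b.1) t, char (fun j => round ((k : ℝ) * x.1 j)) (tor t) =
        Complex.exp (Complex.I * (k : ℂ) * ∑ j, (x.1 j : ℂ) * (t j : ℂ)) := by
      intro x t
      rw [char_tor, mul_assoc, Finset.mul_sum (a := (k : ℂ))]
      congr 2
      refine Finset.sum_congr rfl fun j _ => ?_
      have h : ((round ((k : ℝ) * x.1 j) : ℤ) : ℂ) = (k : ℂ) * (x.1 j : ℂ) := by
        exact_mod_cast hr x j
      rw [h, mul_assoc]
    refine ⟨fun x => ?_, fun x t j => ?_, fun x y m hm θ => ?_⟩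
    · simp only [hf]
      refine ContDiff.cexp (contDiff_const.mul (ContDiff.sum fun j _ => contDiff_const.mul ?_))
      exact Complex.ofRealCLM.contDiff.comp (contDiff_apply ℝ ℝ j)
    · simp only [hf, (hasFDerivAt_phase (Complex.I * (k : ℂ)) x.1 t).fderiv]
      have h4 : ∑ i, (x.1 i : ℂ) * (((Pi.single j 1 : Fin n → ℝ) i : ℝ) : ℂ) = (x.1 j : ℂ) := by
        rw [Finset.sum_eq_single j]
        · simp
        · intro i _ hi
          simp [Pi.single_eq_of_ne hi]
        · simp
      simp [h4]
      ring
    · have h : (fun j => round ((k : ℝ) * y.1 j)) =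
          fun j => (k : ℤ) * m j + round ((k : ℝ) * x.1 j) := by
        funext j
        have : ((round ((k : ℝ) * y.1 j) : ℤ) : ℝ) =
            (((k : ℤ) * m j + round ((k : ℝ) * x.1 j) : ℤ) : ℝ) := by
          push_cast
          rw [hr, hr, hm, Pi.add_apply]
          ring
        exact_mod_cast this
      beta_reduce
      rw [h]
      simp only [char, ← Finset.prod_mul_distrib]
      exact Finset.prod_congr rfl fun j _ => fourier_add⟩

/-- `ϑ_b` is a unit vector. -/
theorem norm_frame {n : ℕ} {k : ℕ+} (b : bohrSommerfeld n k) : ‖frame b‖ = 1 := by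
  have h : inner ℂ (frame b) (frame b) = (1 : ℂ) := by
    change ∫ θ, starRingEnd ℂ ((frame b).val (baseLift b.1) θ) * (frame b).val (baseLift b.1) θ
      ∂haarTorus n = 1
    have h0 : (frame b).val (baseLift b.1) 0 = 1 := by simp [frame, FiberSpace.val, char]
    rw [fiber_inner_eq, h0]
    simp
  rw [inner_self_eq_norm_sq_to_K] at h
  have h1 : ‖frame b‖ ^ 2 = 1 := Complex.ofReal_injective (by simpa using h)
  exact (pow_eq_one_iff_of_nonneg (norm_nonneg _) two_ne_zero).1 h1

/-! ### The deformation quantization `φ_{H,𝒰}` -/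

/-- `U` admits an open affine embedding into `ℝⁿ` with convex image. Equivalently (take the
inverse of the embedding and lift it to `ℝⁿ`), `U` is the injective image of an open convex
subset of `ℝⁿ` under the projection. -/
def HasConvexChart {n : ℕ} (U : Set (Base n)) : Prop :=
  ∃ V : Set (Fin n → ℝ), IsOpen V ∧ Convex ℝ V ∧ Set.InjOn proj V ∧ proj '' V = U

/-- The open coverings `𝒰` of `(ℝ/ℤ)ⁿ` used in the construction: locally finite, each member and
each intersection of two members has a convex affine chart, and the closures are compact. -/
structure AdmissibleCover (n : ℕ) where
  sets : Set (Set (Base n))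
  isOpen : ∀ U ∈ sets, IsOpen U
  covers : ⋃₀ sets = Set.univ
  locallyFinite : LocallyFinite fun U : sets => (U : Set (Base n))
  chart : ∀ U ∈ sets, HasConvexChart U
  chart_inter : ∀ U ∈ sets, ∀ V ∈ sets, HasConvexChart (U ∩ V)
  isCompact_closure : ∀ U ∈ sets, IsCompact (closure U)

/-- An affine linear path `t ↦ proj (x + t v)` in `U`, `0 ≤ t ≤ 1`, from `c` to `b`, together
with a lift `x` of its starting point. -/
structure AffinePath {n : ℕ} (U : Set (Base n)) (c b : Base n) where
  start : Fin n → ℝ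
  dir : Fin n → ℝ
  start_eq : proj start = c
  end_eq : proj (start + dir) = b
  mem : ∀ t ∈ Set.Icc (0 : ℝ) 1, proj (start + t • dir) ∈ U

/-- Two points are close if they lie in a common member of the covering. -/
def Close {n : ℕ} (𝒰 : AdmissibleCover n) (b c : Base n) : Prop := ∃ U ∈ 𝒰.sets, b ∈ U ∧ c ∈ U

theorem exists_affinePath {n : ℕ} {U : Set (Base n)} (hU : HasConvexChart U) {b c : Base n}
    (hb : b ∈ U) (hc : c ∈ U) : Nonempty (AffinePath U c b) := by
  obtain ⟨V, -, hV, -, rfl⟩ := hU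
  obtain ⟨y, hy, rfl⟩ := hb
  obtain ⟨x, hx, rfl⟩ := hc
  exact ⟨⟨x, y - x, rfl, by simp, fun t ht => ⟨_, hV.add_smul_sub_mem hx hy ht, rfl⟩⟩⟩

/-- A member of the covering that contains two given close points. -/
def closeSet {n : ℕ} {𝒰 : AdmissibleCover n} {b c : Base n} (h : Close 𝒰 b c) : Set (Base n) :=
  h.choose

/-- The affine linear path from `c` to `b` in a member of the covering that contains both. -/
def closePath {n : ℕ} {𝒰 : AdmissibleCover n} {b c : Base n} (h : Close 𝒰 b c) :
    AffinePath (closeSet h) c b :=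
  (exists_affinePath (𝒰.chart _ h.choose_spec.1) h.choose_spec.2.1 h.choose_spec.2.2).some

/-- The starting point of the lifted path, as a lift of `c`. -/
def AffinePath.startLift {n : ℕ} {U : Set (Base n)} {c b : Base n} (γ : AffinePath U c b) :
    Lift c := ⟨γ.start, γ.start_eq⟩

/-- The end point of the lifted path, as a lift of `b`. -/
def AffinePath.endLift {n : ℕ} {U : Set (Base n)} {c b : Base n} (γ : AffinePath U c b) :
    Lift b := ⟨γ.start + γ.dir, γ.end_eq⟩

/-- The horizontal lift of `γ` through `(start, θ)`, for the horizontal distribution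
`H_P = Span {∂/∂x_i + ∑_j P_ij ∂/∂θ_j}`, is `t ↦ (start + t dir, θ + t η)` with
`η_j = ∑_i dir_i P_ij`; this is the vector `η`. -/
def AffinePath.drift {n : ℕ} {U : Set (Base n)} {c b : Base n} (γ : AffinePath U c b)
    (P : Matrix (Fin n) (Fin n) ℝ) : Fin n → ℝ := γ.dir ᵥ* P

/-- Parallel transport, along `γ`, of a section of `L^k ⊗ |Λ|^{1/2}` over `X_c` to one over `X_b`.
The connection `d - i k ᵗx dθ` has parallel transport `exp(ik ∫ ᵗx dθ)` along a horizontal curve;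
the map of fibres is `θ ↦ θ + η`, and half-densities are transported trivially. -/
def AffinePath.transport {n : ℕ} {U : Set (Base n)} {c b : Base n} (γ : AffinePath U c b)
    (P : Matrix (Fin n) (Fin n) ℝ) (k : ℕ+) (ξ : Torus n → ℂ) : Torus n → ℂ := fun θ =>
  Complex.exp (Complex.I * (k : ℂ) *
      ((∫ t in (0 : ℝ)..1, (γ.start + t • γ.dir) ⬝ᵥ γ.drift P : ℝ) : ℂ)) *
    ξ (θ - tor (γ.drift P))

/-- The restriction of `f` to the fibre over the midpoint of `γ`, as a function on `X_c` through
parallel transport. -/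
def AffinePath.midFun {n : ℕ} {U : Set (Base n)} {c b : Base n} (γ : AffinePath U c b)
    (P : Matrix (Fin n) (Fin n) ℝ) (f : C(Total n, ℂ)) : Torus n → ℂ := fun θ =>
  f (proj (γ.start + (1 / 2 : ℝ) • γ.dir), θ + tor ((1 / 2 : ℝ) • γ.drift P))

/-- The pairing `⟨ξ_b, f|_{mid} ξ_c⟩_γ` along `γ`. -/
def AffinePath.pairing {n : ℕ} {U : Set (Base n)} {c b : Base n} (γ : AffinePath U c b)
    (P : Matrix (Fin n) (Fin n) ℝ) (k : ℕ+) (f : C(Total n, ℂ))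
    (ξb : FiberSpace n k b) (ξc : FiberSpace n k c) : ℂ :=
  ∫ θ, starRingEnd ℂ (ξb.val γ.endLift θ) *
    γ.transport P k (fun τ => γ.midFun P f τ * ξc.val γ.startLift τ) θ ∂haarTorus n

open Classical in
/-- The matrix coefficient `⟨ξ_b, f|_{X_{(b+c)/2}} ξ_c⟩_𝒰`, which is zero unless `b` and `c` are
close. -/
def coeff {n : ℕ} (P : Matrix (Fin n) (Fin n) ℝ) (𝒰 : AdmissibleCover n) (k : ℕ+)
    (f : C(Total n, ℂ)) {b c : Base n} (ξb : FiberSpace n k b) (ξc : FiberSpace n k c) : ℂ :=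
  if h : Close 𝒰 b c then (closePath h).pairing P k f ξb ξc else 0

theorem AffinePath.pairing_integrable {n : ℕ} {U : Set (Base n)} {c b : Base n}
    (γ : AffinePath U c b) (P : Matrix (Fin n) (Fin n) ℝ) (k : ℕ+) (f : C(Total n, ℂ))
    (ξb : FiberSpace n k b) (ξc : FiberSpace n k c) :
    MeasureTheory.Integrable (fun θ => starRingEnd ℂ (ξb.val γ.endLift θ) *
      γ.transport P k (fun τ => γ.midFun P f τ * ξc.val γ.startLift τ) θ) (haarTorus n) := by
  have hc : Continuous fun θ => starRingEnd ℂ (ξb.val γ.endLift θ) *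
      γ.transport P k (fun τ => γ.midFun P f τ * ξc.val γ.startLift τ) θ := by
    have h1 := ξb.val_continuous γ.endLift
    have h2 := ξc.val_continuous γ.startLift
    have h3 := f.continuous
    have h4 : Continuous (γ.midFun P f) := by
      unfold AffinePath.midFun
      fun_prop
    unfold AffinePath.transport
    have h5 : Continuous fun τ => γ.midFun P f τ * ξc.val γ.startLift τ := h4.mul h2
    exact (Complex.continuous_conj.comp h1).mul
      (continuous_const.mul (h5.comp (continuous_id.sub continuous_const)))
  exact hc.integrable_of_hasCompactSupport (HasCompactSupport.of_compactSpace _)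

theorem coeff_add {n : ℕ} (P : Matrix (Fin n) (Fin n) ℝ) (𝒰 : AdmissibleCover n) (k : ℕ+)
    (f : C(Total n, ℂ)) {b c : Base n} (ξ : FiberSpace n k b) (s t : FiberSpace n k c) :
    coeff P 𝒰 k f ξ (s + t) = coeff P 𝒰 k f ξ s + coeff P 𝒰 k f ξ t := by
  unfold coeff
  split_ifs with h
  · unfold AffinePath.pairing
    rw [← MeasureTheory.integral_add ((closePath h).pairing_integrable P k f ξ s)
      ((closePath h).pairing_integrable P k f ξ t)]
    congr 1
    funext θ
    simp only [AffinePath.transport, FiberSpace.val_add]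
    ring
  · simp

theorem coeff_smul {n : ℕ} (P : Matrix (Fin n) (Fin n) ℝ) (𝒰 : AdmissibleCover n) (k : ℕ+)
    (f : C(Total n, ℂ)) {b c : Base n} (ξ : FiberSpace n k b) (a : ℂ) (s : FiberSpace n k c) :
    coeff P 𝒰 k f ξ (a • s) = a * coeff P 𝒰 k f ξ s := by
  unfold coeff
  split_ifs with h
  · unfold AffinePath.pairing
    rw [← MeasureTheory.integral_const_mul]
    congr 1
    funext θ
    simp only [AffinePath.transport, FiberSpace.val_smul]
    ring
  · simp

/-- The strict deformation quantization `φ_{H_P,𝒰}^k(f)`, with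
`φ(f) ψ_c = ∑_{b close to c} ⟨ϑ_b, f|_{X_{(b+c)/2}} ψ_c⟩_𝒰 ϑ_b` for `ψ_c` in the summand of `c`. -/
def deformationQuantization {n : ℕ} (P : Matrix (Fin n) (Fin n) ℝ) (𝒰 : AdmissibleCover n)
    (k : ℕ+) (f : C(Total n, ℂ)) : QuantumSpace n k →L[ℂ] QuantumSpace n k :=
  LinearMap.toContinuousLinearMap
    { toFun := fun ψ => WithLp.toLp 2 fun b =>
        (∑ c : bohrSommerfeld n k, coeff P 𝒰 k f (frame b) (ψ c)) • frame b
      map_add' := fun ψ χ => by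
        ext b
        simp [coeff_add, Finset.sum_add_distrib, add_smul]
      map_smul' := fun a ψ => by
        ext b
        simp [coeff_smul, ← Finset.mul_sum, mul_smul] }

end TorusQuant

end

noncomputable section

namespace TorusQuant

open MeasureTheory

/-! ## Characters of the torus -/

section Characters

variable {n : ℕ}

/-! Both quantizations become matrices indexed by Bohr–Sommerfeld points, and the entries of both
are read off from the Fourier coefficients of `f` along the fibres of the torus fibration.

Kähler side. For a holomorphic section, the Fourier coefficient in `θ` of index `l` satisfies a
linear ODE along rays issuing from `l/k`, hence is a Gaussian centred at `l/k`; equivariance gives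
the indices `l` and `l + km` the same amplitude. So the theta functions span `H⁰`
(`IsHolomorphicSection.exists_eq_sum_theta`), which is therefore finite-dimensional and closed. The
sum over lattice translates unfolds `⟨Θ_b, f Θ_c⟩` to a sum, over the `d` with `[d/k] = c - b`, of
integrals of `conj Ψ_l · f · Ψ_{l+d}` over all of `ℝⁿ × Tⁿ` (`hasSum_theta_pairing`). Completing the
square about the midpoint `(l + d/2)/k` makes each of these a Gaussian average, of width `k^{-1/2}`,
of the `(-d)`-th Fourier coefficient of `f` times a factor of modulus at most one that tends to one
(`gaussPairing_eq_average`). The case `f = 1` is the orthonormality of the theta functions. For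
general `f` the average converges, uniformly in `l`, to the Fourier coefficient over the midpoint
(`norm_gaussPairing_sub_le`).

Real side. The transport phase and the shift of the fibres by `H_P` cancel, and the matrix entry is
exactly the Fourier coefficient of `f` over the midpoint of the affine path, with `d/k` the reversed
direction of the path (`AffinePath.pairing_frame`). By a Lebesgue number argument, every `d` with
`‖d/k‖` small is the `d` of such a path (`exists_close_radius`).

Comparison. The difference of the entries at `(b, c)` is at most a sum of errors `e_k(d)` over the
class `c - b` (`norm_coeff_sub_le`), so every row sum and every column sum is at most `∑_d e_k(d)`,
and Schur's test bounds the operator norm by this number. Smoothness of `f` gives a summable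
majorant of `e_k(d)` independent of `k`, each `e_k(d)` tends to zero, and dominated convergence
finishes the proof. -/

theorem char_zero (θ : Torus n) : char 0 θ = 1 := by simp [char]

theorem char_add (l m : Fin n → ℤ) (θ : Torus n) : char (l + m) θ = char l θ * char m θ := by
  simp only [char, ← Finset.prod_mul_distrib, Pi.add_apply]
  exact Finset.prod_congr rfl fun j _ => fourier_add

theorem char_neg (l : Fin n → ℤ) (θ : Torus n) : char (-l) θ = starRingEnd ℂ (char l θ) := by
  simp only [char, map_prod, Pi.neg_apply]
  exact Finset.prod_congr rfl fun j _ => fourier_neg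

theorem norm_char (l : Fin n → ℤ) (θ : Torus n) : ‖char l θ‖ = 1 := by
  simp only [char, norm_prod, fourier_apply, Circle.norm_coe, Finset.prod_const_one]

theorem char_neg_mul_char (l : Fin n → ℤ) (θ : Torus n) : char (-l) θ * char l θ = 1 := by
  rw [← char_add, neg_add_cancel, char_zero]

theorem char_apply_add (l : Fin n → ℤ) (θ τ : Torus n) :
    char l (θ + τ) = char l θ * char l τ := by
  simp only [char, ← Finset.prod_mul_distrib, Pi.add_apply]
  refine Finset.prod_congr rfl fun j _ => ?_
  simp [fourier_apply, AddCircle.toCircle_add]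

theorem tor_add (s t : Fin n → ℝ) : tor (s + t) = tor s + tor t := by
  funext j
  simp [tor]

theorem tor_neg (t : Fin n → ℝ) : tor (-t) = -tor t := by
  funext j
  simp [tor]

theorem tor_sub (s t : Fin n → ℝ) : tor (s - t) = tor s - tor t := by
  funext j
  simp [tor]

theorem proj_add (x y : Fin n → ℝ) : proj (x + y) = proj x + proj y := by
  funext j
  simp [proj]

theorem proj_sub (x y : Fin n → ℝ) : proj (x - y) = proj x - proj y := by
  funext j
  simp [proj]

theorem proj_add_int (x : Fin n → ℝ) (m : Fin n → ℤ) :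
    proj (x + fun j => (m j : ℝ)) = proj x :=
  (proj_eq_iff.2 ⟨m, rfl⟩).symm

theorem tor_surjective : Function.Surjective (tor (n := n)) :=
  tor_isOpenQuotientMap.surjective

theorem proj_surjective : Function.Surjective (proj (n := n)) := fun b =>
  ⟨_, (baseLift b).2⟩

theorem tor_continuous : Continuous (tor (n := n)) := tor_isOpenQuotientMap.continuous

instance : (haarTorus n).IsAddHaarMeasure :=
  inferInstanceAs (Measure.pi fun _ : Fin n =>
    (AddCircle.haarAddCircle : Measure (AddCircle (2 * Real.pi)))).IsAddHaarMeasure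

theorem _root_.Continuous.integrable_haarTorus {g : Torus n → ℂ} (hg : Continuous g) :
    Integrable g (haarTorus n) :=
  hg.integrable_of_hasCompactSupport (HasCompactSupport.of_compactSpace _)

/-- The `L²` norm uses `dx dθ` while Fourier coefficients use normalized Haar measure. The factor
between them is what `(2π)^{-n/2}` in the theta functions compensates. -/
theorem volume_torus : (volume : Measure (Torus n)) =
    ENNReal.ofReal ((2 * Real.pi) ^ n) • haarTorus n := by
  refine (Measure.pi_eq fun s _ => ?_)
  rw [Measure.smul_apply, haarTorus, Measure.pi_pi, smul_eq_mul]
  simp_rw [AddCircle.volume_eq_smul_haarAddCircle, Measure.smul_apply, smul_eq_mul]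
  rw [Finset.prod_mul_distrib]
  simp [ENNReal.ofReal_pow Real.two_pi_pos.le]

/-- Translation by `π / m_j` in a coordinate with `m_j ≠ 0` changes the sign of the character but
not its integral. -/
theorem integral_char {m : Fin n → ℤ} (hm : m ≠ 0) : ∫ θ, char m θ ∂haarTorus n = 0 := by
  obtain ⟨j, hj⟩ := Function.ne_iff.1 hm
  have hj' : (m j : ℂ) ≠ 0 := by exact_mod_cast hj
  have h1 : char m (tor (Pi.single j (Real.pi / m j))) = -1 := by
    rw [char_tor, Finset.sum_eq_single j]
    · simp only [Pi.single_eq_same]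
      push_cast
      rw [mul_div_cancel₀ _ hj', mul_comm, Complex.exp_pi_mul_I]
    · intro i _ hi
      simp [Pi.single_eq_of_ne hi]
    · simp
  have h2 := integral_add_right_eq_self (μ := haarTorus n) (fun θ => char m θ)
    (tor (Pi.single j (Real.pi / m j)))
  simp only [char_apply_add, h1, mul_neg, mul_one, integral_neg] at h2
  exact self_eq_neg.1 h2.symm

/-- The Fourier coefficient of a function on the torus. -/
def fourierCoef (l : Fin n → ℤ) (g : Torus n → ℂ) : ℂ := ∫ θ, char (-l) θ * g θ ∂haarTorus n

theorem fourierCoef_char (l m : Fin n → ℤ) :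
    fourierCoef l (char m) = if l = m then 1 else 0 := by
  simp only [fourierCoef, ← char_add]
  split_ifs with h
  · subst h
    simp [char_zero]
  · exact integral_char fun h0 => h (neg_add_eq_zero.1 h0)

theorem norm_fourierCoef_le (l : Fin n → ℤ) {g : Torus n → ℂ} {C : ℝ} (hg : ∀ θ, ‖g θ‖ ≤ C) :
    ‖fourierCoef l g‖ ≤ C := by
  refine (norm_integral_le_of_norm_le_const (C := C) ?_).trans (by simp)
  filter_upwards with θ
  simpa [norm_char] using hg θ

theorem fourierCoef_sub (l : Fin n → ℤ) {g h : Torus n → ℂ} (hg : Continuous g)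
    (hh : Continuous h) :
    fourierCoef l (fun θ => g θ - h θ) = fourierCoef l g - fourierCoef l h := by
  simp only [fourierCoef, mul_sub]
  exact integral_sub ((char_continuous _).mul hg).integrable_haarTorus
    ((char_continuous _).mul hh).integrable_haarTorus

theorem fourierCoef_const_mul (l : Fin n → ℤ) (c : ℂ) (g : Torus n → ℂ) :
    fourierCoef l (fun θ => c * g θ) = c * fourierCoef l g := by
  simp only [fourierCoef, mul_left_comm _ c]
  exact integral_const_mul _ _

theorem fourierCoef_finsetSum {ι : Type*} (l : Fin n → ℤ) (s : Finset ι) {g : ι → Torus n → ℂ}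
    (hg : ∀ i ∈ s, Continuous (g i)) :
    fourierCoef l (fun θ => ∑ i ∈ s, g i θ) = ∑ i ∈ s, fourierCoef l (g i) := by
  simp only [fourierCoef, Finset.mul_sum]
  exact integral_finsetSum _ fun i hi => ((char_continuous _).mul (hg i hi)).integrable_haarTorus

theorem fourierCoef_char_mul (l m : Fin n → ℤ) (g : Torus n → ℂ) :
    fourierCoef l (fun θ => char m θ * g θ) = fourierCoef (l - m) g := by
  simp only [fourierCoef, ← mul_assoc, ← char_add]
  congr! 4
  abel

theorem fourierCoef_comp_add (l : Fin n → ℤ) (g : Torus n → ℂ) (τ : Torus n) :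
    fourierCoef l (fun θ => g (θ + τ)) = char l τ * fourierCoef l g := by
  have h := integral_add_right_eq_self (μ := haarTorus n) (fun θ => char (-l) (θ - τ) * g θ) τ
  simp only [add_sub_cancel_right] at h
  rw [fourierCoef, h, fourierCoef, ← integral_const_mul]
  congr 1
  funext θ
  have h1 := char_apply_add (-l) (θ - τ) τ
  have h2 := char_neg_mul_char l τ
  rw [sub_add_cancel] at h1
  rw [h1]
  linear_combination (-char (-l) (θ - τ) * g θ) * h2

/-- The characters as continuous functions. -/
def charMap (l : Fin n → ℤ) : C(Torus n, ℂ) := ⟨char l, char_continuous l⟩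

/-- The star subalgebra of trigonometric polynomials. -/
def charSubalgebra (n : ℕ) : StarSubalgebra ℂ C(Torus n, ℂ) where
  toSubalgebra := Algebra.adjoin ℂ (Set.range charMap)
  star_mem' := by
    change Algebra.adjoin ℂ (Set.range charMap) ≤ star (Algebra.adjoin ℂ (Set.range charMap))
    refine Algebra.adjoin_le ?_
    rintro _ ⟨l, rfl⟩
    refine Algebra.subset_adjoin ⟨-l, ?_⟩
    ext1 θ
    exact char_neg l θ

/-- Products of characters are characters, so the algebra they generate is their linear span;
density from Stone–Weierstrass then applies to linear functionals. -/
theorem charSubalgebra_coe : Subalgebra.toSubmodule (charSubalgebra n).toSubalgebra =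
    Submodule.span ℂ (Set.range charMap) := by
  apply Algebra.adjoin_eq_span_of_subset
  refine .trans (fun x ↦ Submonoid.closure_induction (fun _ ↦ id) ⟨0, ?_⟩ ?_)
    Submodule.subset_span
  · ext z
    exact char_zero z
  · rintro _ _ _ _ ⟨l, rfl⟩ ⟨m, rfl⟩
    refine ⟨l + m, ?_⟩
    ext z
    exact char_add l m z

theorem charSubalgebra_separatesPoints : (charSubalgebra n).SeparatesPoints := by
  intro x y hxy
  obtain ⟨i, hi⟩ := Function.ne_iff.1 hxy
  refine ⟨_, ⟨charMap (Pi.single i 1), Algebra.subset_adjoin ⟨Pi.single i 1, rfl⟩, rfl⟩, ?_⟩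
  have h : ∀ z : Torus n, charMap (Pi.single i 1) z = fourier 1 (z i) := by
    intro z
    change ∏ j, fourier ((Pi.single i 1 : Fin n → ℤ) j) (z j) = _
    rw [Finset.prod_eq_single i]
    · simp
    · intro j _ hj
      simp [Pi.single_eq_of_ne hj]
    · simp
  dsimp only
  rw [h, h, fourier_one, fourier_one]
  exact fun h1 => hi (AddCircle.injective_toCircle Real.two_pi_pos.ne' (Circle.ext h1))

theorem span_charMap_topologicalClosure :
    (Submodule.span ℂ (Set.range (charMap (n := n)))).topologicalClosure = ⊤ := by
  rw [← charSubalgebra_coe]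
  exact congr_arg (Subalgebra.toSubmodule <| StarSubalgebra.toSubalgebra ·)
    (ContinuousMap.starSubalgebra_topologicalClosure_eq_top_of_separatesPoints _
      charSubalgebra_separatesPoints)

/-- A continuous function on the torus whose Fourier coefficients vanish is zero. -/
theorem eq_zero_of_fourierCoef {g : Torus n → ℂ} (hg : Continuous g)
    (h : ∀ l, fourierCoef l g = 0) : g = 0 := by
  -- Integration against `g` is a sup-norm continuous functional that vanishes on the dense span of
  -- the characters. Evaluated at `conj g` it gives `∫ |g|² = 0`.
  let L : C(Torus n, ℂ) →L[ℂ] ℂ := LinearMap.mkContinuous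
    { toFun := fun u => ∫ θ, u θ * g θ ∂haarTorus n
      map_add' := fun u v => by
        simp only [ContinuousMap.add_apply, add_mul]
        exact integral_add (u.continuous.mul hg).integrable_haarTorus
          (v.continuous.mul hg).integrable_haarTorus
      map_smul' := fun c u => by
        rw [RingHom.id_apply, smul_eq_mul, ← integral_const_mul]
        simp [mul_assoc] }
    ‖(⟨g, hg⟩ : C(Torus n, ℂ))‖ (fun u => by
      refine (norm_integral_le_of_norm_le_const
        (C := ‖(⟨g, hg⟩ : C(Torus n, ℂ))‖ * ‖u‖) ?_).trans (by simp)
      filter_upwards with θ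
      rw [norm_mul, mul_comm]
      gcongr
      · exact (⟨g, hg⟩ : C(Torus n, ℂ)).norm_coe_le_norm θ
      · exact u.norm_coe_le_norm θ)
  have hL : L = 0 := by
    refine ContinuousLinearMap.ext_on
      (Submodule.dense_iff_topologicalClosure_eq_top.2 span_charMap_topologicalClosure) ?_
    rintro _ ⟨l, rfl⟩
    have := h (-l)
    rw [fourierCoef, neg_neg] at this
    exact this
  have h1 : ∫ θ, starRingEnd ℂ (g θ) * g θ ∂haarTorus n = 0 :=
    DFunLike.congr_fun hL ⟨fun θ => starRingEnd ℂ (g θ), Complex.continuous_conj.comp hg⟩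
  have h2 : ∫ θ, ‖g θ‖ ^ 2 ∂haarTorus n = 0 := by
    have : ∀ θ, starRingEnd ℂ (g θ) * g θ = ((‖g θ‖ ^ 2 : ℝ) : ℂ) := fun θ => by
      rw [Complex.conj_mul']
      push_cast
      rfl
    simp only [this] at h1
    rw [integral_complex_ofReal] at h1
    exact_mod_cast h1
  have hc : Continuous fun θ => ‖g θ‖ ^ 2 := hg.norm.pow 2
  have h3 := (integral_eq_zero_iff_of_nonneg (fun θ => by positivity)
    (hc.integrable_of_hasCompactSupport (HasCompactSupport.of_compactSpace _))).1 h2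
  have h4 := (hc.ae_eq_iff_eq (haarTorus n) continuous_const).1 h3
  funext θ
  have h5 : ‖g θ‖ ^ 2 = 0 := congrFun h4 θ
  simpa using h5

end Characters

/-! ## Sums over the lattice `ℤⁿ` -/

theorem summable_prod_fin {n : ℕ} {u : Fin n → ℤ → ℝ} (h0 : ∀ j m, 0 ≤ u j m)
    (hu : ∀ j, Summable (u j)) : Summable fun l : Fin n → ℤ => ∏ j, u j (l j) := by
  induction n with
  | zero => exact (hasSum_unique _).summable
  | succ n ih =>
    rw [← (Fin.consEquiv fun _ : Fin (n + 1) => ℤ).summable_iff]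
    have h := (hu 0).mul_of_nonneg (ih (fun j => h0 j.succ) fun j => hu j.succ) (h0 0)
      (fun l => Finset.prod_nonneg fun j _ => h0 _ _)
    refine h.congr fun p => ?_
    simp [Fin.prod_univ_succ, Fin.consEquiv]

theorem summable_lattice_decay (n : ℕ) :
    Summable fun l : Fin n → ℤ => (∏ j, (1 + (l j : ℝ) ^ 2))⁻¹ := by
  have h : Summable fun m : ℤ => (1 + (m : ℝ) ^ 2)⁻¹ := by
    have h2 : Summable fun m : ℤ => 1 / (m : ℝ) ^ 2 := Real.summable_one_div_int_pow.2 one_lt_two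
    refine Summable.of_norm_bounded_eventually h2 ?_
    -- The comparison with `1 / m²` fails at `m = 0`, where division by zero gives the value `0`.
    have h0 : ({0} : Set ℤ)ᶜ ∈ Filter.cofinite := (Set.finite_singleton 0).compl_mem_cofinite
    filter_upwards [h0] with m hm
    have hm' : (0 : ℝ) < (m : ℝ) ^ 2 := by
      have : (m : ℝ) ≠ 0 := by exact_mod_cast hm
      positivity
    rw [Real.norm_of_nonneg (by positivity), one_div]
    gcongr
    linarith
  simp_rw [← Finset.prod_inv_distrib]
  exact summable_prod_fin (u := fun _ m => (1 + (m : ℝ) ^ 2)⁻¹) (fun _ _ => by positivity)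
    fun _ => h

/-- Gaussians decay faster than exponentials, summed over the lattice. -/
theorem summable_lattice_gaussian (n : ℕ) {c : ℝ} (hc : 0 < c) (R : ℝ) :
    Summable fun l : Fin n → ℤ => Real.exp (∑ j, (R * |(l j : ℝ)| - c * (l j : ℝ) ^ 2)) := by
  simp_rw [Real.exp_sum]
  refine summable_prod_fin (u := fun _ m => Real.exp (R * |(m : ℝ)| - c * (m : ℝ) ^ 2))
    (fun _ _ => (Real.exp_pos _).le) fun _ => ?_
  have h2 : Summable fun m : ℤ => Real.exp (R ^ 2 / c) * (2 / c) * (1 / (m : ℝ) ^ 2) :=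
    (Real.summable_one_div_int_pow.2 one_lt_two).mul_left _
  refine Summable.of_norm_bounded_eventually h2 ?_
  have h0 : ({0} : Set ℤ)ᶜ ∈ Filter.cofinite := (Set.finite_singleton 0).compl_mem_cofinite
  filter_upwards [h0] with m hm
  have hm' : (0 : ℝ) < (m : ℝ) ^ 2 := by
    have : (m : ℝ) ≠ 0 := by exact_mod_cast hm
    positivity
  rw [Real.norm_of_nonneg (Real.exp_pos _).le]
  -- Half of the quadratic term absorbs the linear one; the other half is compared with `1 / m²`
  -- through `exp(-y) ≤ 1/y`.
  have h3 : R * |(m : ℝ)| - c * (m : ℝ) ^ 2 ≤ R ^ 2 / c + -(c / 2 * (m : ℝ) ^ 2) := by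
    have h4 : R * |(m : ℝ)| ≤ R ^ 2 / c + c / 2 * |(m : ℝ)| ^ 2 := by
      rw [div_add' _ _ _ hc.ne', le_div_iff₀ hc]
      nlinarith [sq_nonneg (R - c * |(m : ℝ)|), sq_nonneg (c * |(m : ℝ)|), sq_nonneg R]
    rw [sq_abs] at h4
    linarith
  refine (Real.exp_le_exp.2 h3).trans ?_
  rw [Real.exp_add, mul_assoc]
  gcongr
  rw [Real.exp_neg, ← one_div, div_mul_div_comm, mul_one,
    div_le_div_iff₀ (Real.exp_pos _) (by positivity)]
  have := Real.add_one_le_exp (c / 2 * (m : ℝ) ^ 2)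
  nlinarith

/-! ## Directional derivatives on `ℝⁿ × Tⁿ` and Fourier coefficients -/

section Derivatives

variable {n : ℕ}

/-- The derivative of a function on `ℝⁿ × Tⁿ` in a constant direction. -/
def dirDeriv (w : (Fin n → ℝ) × (Fin n → ℝ)) (s : Cover n → ℂ) : Cover n → ℂ := fun p =>
  fderiv ℝ (upstairs s) (p.1, (tor_surjective p.2).choose) w

/-- The lift of `θ` chosen in `dirDeriv` is immaterial: two lifts differ by a period of `upstairs
s`, hence of its derivative. -/
theorem upstairs_dirDeriv (w : (Fin n → ℝ) × (Fin n → ℝ)) (s : Cover n → ℂ)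
    (p : (Fin n → ℝ) × (Fin n → ℝ)) :
    upstairs (dirDeriv w s) p = fderiv ℝ (upstairs s) p w := by
  obtain ⟨x, t⟩ := p
  set t' := (tor_surjective (tor t)).choose with ht'
  have h1 : tor t' = tor t := (tor_surjective (tor t)).choose_spec
  have h2 : (fun q => upstairs s (q + (0, t' - t))) = upstairs s := by
    funext q
    simp only [upstairs, Prod.fst_add, Prod.snd_add, add_zero, tor_add, tor_sub, h1, sub_self]
  have h3 := fderiv_comp_add_right (𝕜 := ℝ) (f := upstairs s) (x := (x, t)) (0, t' - t)
  rw [h2] at h3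
  change fderiv ℝ (upstairs s) (x, t') w = _
  rw [h3]
  simp

theorem contDiff_dirDeriv (w : (Fin n → ℝ) × (Fin n → ℝ)) {s : Cover n → ℂ}
    (hs : ContDiff ℝ ∞ (upstairs s)) : ContDiff ℝ ∞ (upstairs (dirDeriv w s)) := by
  have h : upstairs (dirDeriv w s) = fun p => fderiv ℝ (upstairs s) p w :=
    funext fun p => upstairs_dirDeriv w s p
  rw [h]
  exact (hs.fderiv_right (m := ∞) (by simp)).clm_apply contDiff_const

theorem continuous_of_upstairs {s : Cover n → ℂ} (hs : Continuous (upstairs s)) :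
    Continuous s :=
  (IsOpenQuotientMap.prodMap (f := (id : (Fin n → ℝ) → (Fin n → ℝ))) IsOpenQuotientMap.id
    (tor_isOpenQuotientMap (n := n))).isQuotientMap.continuous_iff.2 hs

theorem hasDerivAt_along {s : Cover n → ℂ} (hs : ContDiff ℝ ∞ (upstairs s))
    (x u η : Fin n → ℝ) (θ : Torus n) (τ : ℝ) :
    HasDerivAt (fun τ : ℝ => s (x + τ • u, θ + tor (τ • η)))
      (dirDeriv (u, η) s (x + τ • u, θ + tor (τ • η))) τ := by
  obtain ⟨t, rfl⟩ := tor_surjective θ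
  simp only [← tor_add]
  have h1 : HasFDerivAt (upstairs s) (fderiv ℝ (upstairs s) ((x, t) + τ • (u, η)))
      ((x, t) + τ • (u, η)) := ((hs.differentiable (by simp)) _).hasFDerivAt
  have h2 : HasDerivAt (fun τ : ℝ => (x, t) + τ • (u, η)) (u, η) τ := by
    simpa using ((hasDerivAt_id τ).smul_const (u, η)).const_add (x, t)
  have h3 := h1.comp_hasDerivAt τ h2
  rw [← upstairs_dirDeriv] at h3
  exact h3

/-- Differentiation under the integral sign; the derivative is bounded on the compact set of
parameters within distance one of `τ` times the torus. -/
theorem hasDerivAt_fourierCoef_along {s : Cover n → ℂ} (hs : ContDiff ℝ ∞ (upstairs s))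
    (l : Fin n → ℤ) (x u η : Fin n → ℝ) (τ : ℝ) :
    HasDerivAt (fun τ : ℝ => fourierCoef l fun θ => s (x + τ • u, θ + tor (τ • η)))
      (fourierCoef l fun θ => dirDeriv (u, η) s (x + τ • u, θ + tor (τ • η))) τ := by
  have hc : Continuous s := continuous_of_upstairs hs.continuous
  have hd : Continuous (dirDeriv (u, η) s) :=
    continuous_of_upstairs (contDiff_dirDeriv (u, η) hs).continuous
  have htor := tor_continuous (n := n)
  have hD : Continuous fun p : ℝ × Torus n =>
      dirDeriv (u, η) s (x + p.1 • u, p.2 + tor (p.1 • η)) := by fun_prop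
  obtain ⟨C, hC⟩ := ((isCompact_closedBall τ 1).prod
    (isCompact_univ (X := Torus n))).exists_bound_of_continuousOn hD.continuousOn
  have hg : ∀ τ : ℝ, Continuous fun θ => char (-l) θ * s (x + τ • u, θ + tor (τ • η)) := by
    intro τ
    exact (char_continuous _).mul (by fun_prop)
  have hg' : ∀ τ : ℝ, Continuous fun θ =>
      char (-l) θ * dirDeriv (u, η) s (x + τ • u, θ + tor (τ • η)) := by
    intro τ
    exact (char_continuous _).mul (by fun_prop)
  refine (hasDerivAt_integral_of_dominated_loc_of_deriv_le (bound := fun _ => C)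
    (F' := fun τ θ => char (-l) θ * dirDeriv (u, η) s (x + τ • u, θ + tor (τ • η)))
    (Metric.closedBall_mem_nhds τ one_pos)
    (Filter.Eventually.of_forall fun τ => (hg τ).integrable_haarTorus.aestronglyMeasurable)
    (hg τ).integrable_haarTorus (hg' τ).integrable_haarTorus.aestronglyMeasurable
    ?_ (integrable_const C) ?_).2
  · filter_upwards with θ σ hσ
    rw [norm_mul, norm_char, one_mul]
    exact hC (σ, θ) ⟨hσ, Set.mem_univ _⟩
  · filter_upwards with θ σ _
    exact (hasDerivAt_along hs x u η θ σ).const_mul _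

theorem hasDerivAt_fourierCoef_base {s : Cover n → ℂ} (hs : ContDiff ℝ ∞ (upstairs s))
    (l : Fin n → ℤ) (x u : Fin n → ℝ) (τ : ℝ) :
    HasDerivAt (fun τ : ℝ => fourierCoef l fun θ => s (x + τ • u, θ))
      (fourierCoef l fun θ => dirDeriv (u, 0) s (x + τ • u, θ)) τ := by
  simpa [tor_zero] using hasDerivAt_fourierCoef_along hs l x u 0 τ

/-- Instead of integrating by parts, translate in `θ_j` and differentiate at zero: the coefficient
of a translate is the original one times a character value. -/
theorem fourierCoef_dirDeriv_fiber {s : Cover n → ℂ} (hs : ContDiff ℝ ∞ (upstairs s))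
    (l : Fin n → ℤ) (x : Fin n → ℝ) (j : Fin n) :
    (fourierCoef l fun θ => dirDeriv (0, Pi.single j 1) s (x, θ)) =
      Complex.I * l j * fourierCoef l fun θ => s (x, θ) := by
  have h1 := hasDerivAt_fourierCoef_along hs l x 0 (Pi.single j 1) 0
  simp only [smul_zero, add_zero, zero_smul, tor_zero] at h1
  have h2 : (fun τ : ℝ => fourierCoef l fun θ => s (x, θ + tor (τ • Pi.single j 1))) =
      fun τ : ℝ => Complex.exp (Complex.I * l j * τ) * fourierCoef l fun θ => s (x, θ) := by
    funext τ
    rw [fourierCoef_comp_add l (fun θ => s (x, θ)), char_tor, Finset.sum_eq_single j]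
    · simp [mul_assoc]
    · intro i _ hi
      simp [Pi.single_eq_of_ne hi]
    · simp
  rw [h2] at h1
  have h3 : HasDerivAt (fun τ : ℝ => Complex.exp (Complex.I * l j * τ) *
      fourierCoef l fun θ => s (x, θ)) (Complex.I * l j * fourierCoef l fun θ => s (x, θ)) 0 := by
    have h4 : HasDerivAt (fun τ : ℝ => Complex.I * l j * (τ : ℂ)) (Complex.I * l j) 0 := by
      simpa using (Complex.ofRealCLM.hasDerivAt (x := 0)).const_mul (Complex.I * (l j : ℂ))
    simpa using h4.cexp.mul_const (fourierCoef l fun θ => s (x, θ))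
  exact h1.unique h3

theorem dirDeriv_periodic (w : (Fin n → ℝ) × (Fin n → ℝ)) {s : Cover n → ℂ}
    (hp : ∀ (m : Fin n → ℤ) x θ, s (x + fun j => (m j : ℝ), θ) = s (x, θ)) (m : Fin n → ℤ)
    (x : Fin n → ℝ) (θ : Torus n) :
    dirDeriv w s (x + fun j => (m j : ℝ), θ) = dirDeriv w s (x, θ) := by
  have h2 : (fun q => upstairs s (q + ((fun j => (m j : ℝ)), 0))) = upstairs s := by
    funext q
    simp only [upstairs, Prod.fst_add, Prod.snd_add, add_zero, hp]
  have h3 := fderiv_comp_add_right (𝕜 := ℝ) (f := upstairs s)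
    (x := (x, (tor_surjective θ).choose)) ((fun j => (m j : ℝ)), 0)
  rw [h2] at h3
  simp only [dirDeriv, h3]
  simp

/-- The function `g` is obtained from `s` by the operators `1 - ∂²/∂θ_j²` for `j ∈ S`, each of which
multiplies the `q`-th coefficient by `1 + q_j²`. For `S` the full index set this yields the decay of
Fourier coefficients. -/
theorem exists_fourierCoef_eq_prod_mul (S : Finset (Fin n)) {s : Cover n → ℂ}
    (hs : ContDiff ℝ ∞ (upstairs s))
    (hp : ∀ (m : Fin n → ℤ) x θ, s (x + fun j => (m j : ℝ), θ) = s (x, θ)) :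
    ∃ g : Cover n → ℂ, ContDiff ℝ ∞ (upstairs g) ∧
      (∀ (m : Fin n → ℤ) x θ, g (x + fun j => (m j : ℝ), θ) = g (x, θ)) ∧
      ∀ (q : Fin n → ℤ) (x : Fin n → ℝ), (fourierCoef q fun θ => g (x, θ)) =
        (∏ j ∈ S, (1 + (q j : ℂ) ^ 2)) * fourierCoef q fun θ => s (x, θ) := by
  classical
  induction S using Finset.induction_on with
  | empty => exact ⟨s, hs, hp, fun q x => by simp⟩
  | insert j S hj ih =>
    obtain ⟨g, hg, hgp, hgq⟩ := ih
    have h1 := contDiff_dirDeriv (0, Pi.single j 1) hg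
    have h2 := contDiff_dirDeriv (0, Pi.single j 1) h1
    refine ⟨fun p => g p - dirDeriv (0, Pi.single j 1) (dirDeriv (0, Pi.single j 1) g) p,
      hg.sub h2, fun m x θ => ?_, fun q x => ?_⟩
    · simp only [hgp, dirDeriv_periodic _ (dirDeriv_periodic _ hgp)]
    · have c1 : Continuous g := continuous_of_upstairs hg.continuous
      have c2 := continuous_of_upstairs h2.continuous
      rw [fourierCoef_sub q (g := fun θ => g (x, θ)) (by fun_prop) (by fun_prop),
        fourierCoef_dirDeriv_fiber h1, fourierCoef_dirDeriv_fiber hg, hgq,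
        Finset.prod_insert hj]
      linear_combination (-(q j : ℂ) ^ 2 * ((∏ j ∈ S, (1 + (q j : ℂ) ^ 2)) *
        fourierCoef q fun θ => s (x, θ))) * Complex.I_sq

theorem exists_int_sub_mem_Ico (x : Fin n → ℝ) : ∃ m : Fin n → ℤ,
    (x + fun j => (m j : ℝ)) ∈ Set.univ.pi fun _ => Set.Ico (0 : ℝ) 1 := by
  refine ⟨fun j => -⌊x j⌋, fun j _ => ⟨?_, ?_⟩⟩
  · simpa using Int.floor_le (x j)
  · have := Int.lt_floor_add_one (x j)
    simp only [Pi.add_apply, Int.cast_neg]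
    linarith

theorem exists_bound_of_periodic {s : Cover n → ℂ} (hs : Continuous s)
    (hp : ∀ (m : Fin n → ℤ) x θ, s (x + fun j => (m j : ℝ), θ) = s (x, θ)) :
    ∃ C, ∀ p, ‖s p‖ ≤ C := by
  obtain ⟨C, hC⟩ := ((isCompact_univ_pi fun _ : Fin n => isCompact_Icc (a := (0 : ℝ))
    (b := 1)).prod (isCompact_univ (X := Torus n))).exists_bound_of_continuousOn hs.continuousOn
  refine ⟨C, fun ⟨x, θ⟩ => ?_⟩
  obtain ⟨m, hm⟩ := exists_int_sub_mem_Ico x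
  rw [← hp m]
  exact hC _ ⟨fun j hj => Set.Ico_subset_Icc_self (hm j hj), Set.mem_univ _⟩

/-- The Fourier coefficients of a smooth function along the fibres decay rapidly. -/
theorem IsSmooth.exists_decay {f : Total n → ℂ} (hf : IsSmooth f) :
    ∃ C, 0 ≤ C ∧ ∀ (q : Fin n → ℤ) (b : Base n),
      ‖fourierCoef q fun θ => f (b, θ)‖ ≤ C * (∏ j, (1 + (q j : ℝ) ^ 2))⁻¹ := by
  obtain ⟨g, hg, hgp, hgq⟩ := exists_fourierCoef_eq_prod_mul Finset.univ
    (s := fun p : Cover n => f (proj p.1, p.2)) hf fun m x θ => by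
      simp only [proj_add_int]
  obtain ⟨C, hC⟩ := exists_bound_of_periodic (continuous_of_upstairs hg.continuous) hgp
  refine ⟨C, (norm_nonneg _).trans (hC 0), fun q b => ?_⟩
  obtain ⟨x, rfl⟩ := proj_surjective b
  have h1 := norm_fourierCoef_le q (g := fun θ => g (x, θ)) fun θ => hC (x, θ)
  have hpos : 0 < ∏ j, (1 + (q j : ℝ) ^ 2) := Finset.prod_pos fun j _ => by positivity
  rw [hgq, norm_mul, norm_prod] at h1
  have h2 : ∏ j, ‖(1 + (q j : ℂ) ^ 2)‖ = ∏ j, (1 + (q j : ℝ) ^ 2) := by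
    refine Finset.prod_congr rfl fun j _ => ?_
    have : (1 + (q j : ℂ) ^ 2) = ((1 + (q j : ℝ) ^ 2 : ℝ) : ℂ) := by push_cast; rfl
    rw [this, Complex.norm_real, Real.norm_of_nonneg (by positivity)]
  rw [h2] at h1
  rwa [← div_eq_mul_inv, le_div_iff₀ hpos, mul_comm]

end Derivatives

/-! ## Exponential series -/

section ExpSeries

variable {E ι : Type*} [NormedAddCommGroup E] [NormedSpace ℝ E]

theorem hasFDerivAt_cexp_clm (lam : E →L[ℝ] ℂ) (c : ℂ) (w : E) :
    HasFDerivAt (fun w => c * Complex.exp (lam w)) ((c * Complex.exp (lam w)) • lam) w := by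
  have h := (lam.hasFDerivAt (x := w)).cexp.const_mul c
  rwa [smul_smul] at h

/-- Termwise differentiation on a ball containing `w`. Each derivative costs a factor `‖lam i‖ ≤ exp
‖lam i‖`, absorbed by raising `R` by one; this is why summability is required for every `R`. -/
theorem hasFDerivAt_tsum_exp (lam : ι → E →L[ℝ] ℂ) {c : ι → ℂ}
    (hc : ∀ R : ℝ, Summable fun i => ‖c i‖ * Real.exp (R * ‖lam i‖)) (w : E) :
    HasFDerivAt (fun w => ∑' i, c i * Complex.exp (lam i w))
      (∑' i, (c i * Complex.exp (lam i w)) • lam i) w ∧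
    Summable fun i => (c i * Complex.exp (lam i w)) • lam i := by
  set R := ‖w‖ + 1 with hR
  have hb : ∀ i, ∀ v ∈ Metric.ball (0 : E) R,
      ‖(c i * Complex.exp (lam i v)) • lam i‖ ≤ ‖c i‖ * Real.exp ((R + 1) * ‖lam i‖) := by
    intro i v hv
    rw [mem_ball_zero_iff] at hv
    rw [norm_smul, norm_mul, mul_assoc, Complex.norm_exp]
    gcongr
    have h1 : (lam i v).re ≤ R * ‖lam i‖ := by
      refine (Complex.re_le_norm _).trans (((lam i).le_opNorm v).trans ?_)
      rw [mul_comm]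
      gcongr
    have h2 : ‖lam i‖ ≤ Real.exp ‖lam i‖ := by linarith [Real.add_one_le_exp ‖lam i‖]
    calc Real.exp (lam i v).re * ‖lam i‖ ≤ Real.exp (R * ‖lam i‖) * Real.exp ‖lam i‖ := by gcongr
      _ = Real.exp ((R + 1) * ‖lam i‖) := by rw [← Real.exp_add]; ring_nf
  have hw : w ∈ Metric.ball (0 : E) R := by
    rw [mem_ball_zero_iff, hR]
    linarith
  refine ⟨hasFDerivAt_tsum_of_isPreconnected (hc (R + 1)) Metric.isOpen_ball
    (convex_ball (0 : E) R).isPreconnected (fun i v _ => hasFDerivAt_cexp_clm _ _ _) hb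
    (x₀ := 0) (Metric.mem_ball_self (by positivity)) ?_ hw,
    .of_norm_bounded (hc (R + 1)) fun i => hb i w hw⟩
  have h0 := hc 0
  simp only [zero_mul, Real.exp_zero, mul_one] at h0
  simpa using Summable.of_norm h0

/-- The derivative in a direction `v` is a series of the same kind, with coefficients `c i * lam i
v` satisfying the same hypothesis, so induction on the order applies. -/
theorem contDiff_tsum_exp [FiniteDimensional ℝ E] (lam : ι → E →L[ℝ] ℂ) (N : ℕ) {c : ι → ℂ}
    (hc : ∀ R : ℝ, Summable fun i => ‖c i‖ * Real.exp (R * ‖lam i‖)) :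
    ContDiff ℝ N (fun w => ∑' i, c i * Complex.exp (lam i w)) := by
  induction N generalizing c with
  | zero =>
    refine contDiff_zero.2 (Differentiable.continuous (𝕜 := ℝ) fun w => ?_)
    exact (hasFDerivAt_tsum_exp lam hc w).1.differentiableAt
  | succ N ih =>
    push_cast
    rw [contDiff_succ_iff_fderiv]
    refine ⟨fun w => (hasFDerivAt_tsum_exp lam hc w).1.differentiableAt, by simp, ?_⟩
    rw [contDiff_clm_apply_iff]
    intro v
    have h : (fun w => fderiv ℝ (fun w => ∑' i, c i * Complex.exp (lam i w)) w v) =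
        fun w => ∑' i, (c i * lam i v) * Complex.exp (lam i w) := by
      funext w
      obtain ⟨h1, h2⟩ := hasFDerivAt_tsum_exp lam hc w
      rw [h1.fderiv]
      have h3 := (ContinuousLinearMap.apply ℝ ℂ v).map_tsum h2
      rw [ContinuousLinearMap.apply_apply] at h3
      rw [h3]
      refine tsum_congr fun i => ?_
      simp
      ring
    rw [h]
    refine ih fun R => ?_
    refine Summable.of_nonneg_of_le (fun i => by positivity) (fun i => ?_)
      ((hc (R + 1)).mul_left ‖v‖)
    have h1 : ‖c i * lam i v‖ ≤ ‖c i‖ * (‖lam i‖ * ‖v‖) := by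
      rw [norm_mul]
      gcongr
      exact (lam i).le_opNorm v
    have h2 : ‖lam i‖ ≤ Real.exp ‖lam i‖ := by linarith [Real.add_one_le_exp ‖lam i‖]
    calc ‖c i * lam i v‖ * Real.exp (R * ‖lam i‖)
        ≤ (‖c i‖ * (Real.exp ‖lam i‖ * ‖v‖)) * Real.exp (R * ‖lam i‖) := by
          refine mul_le_mul_of_nonneg_right (h1.trans ?_) (Real.exp_pos _).le
          gcongr
      _ = ‖v‖ * (‖c i‖ * Real.exp ((R + 1) * ‖lam i‖)) := by
          rw [add_mul, Real.exp_add, one_mul]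
          ring

theorem tsum_smul_antiholomorphic {κ : Type*} [Fintype κ] (lam : ι → E →L[ℝ] ℂ) {c : ι → ℂ}
    (hc : Summable fun i => c i • lam i) {u : E} {a : κ → ℂ} {v : κ → E}
    (h : ∀ i, lam i u + ∑ j, a j * lam i (v j) = 0) :
    (∑' i, c i • lam i) u + ∑ j, a j * (∑' i, c i • lam i) (v j) = 0 := by
  have hv : ∀ v, HasSum (fun i => c i * lam i v) ((∑' i, c i • lam i) v) := by
    intro v
    have h1 := hc.hasSum.mapL (ContinuousLinearMap.apply ℝ ℂ v)
    rw [ContinuousLinearMap.apply_apply] at h1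
    refine h1.congr_fun ?_
    intro i
    simp
  have h1 := (hv u).add (hasSum_sum (s := Finset.univ) fun j _ => (hv (v j)).mul_left (a j))
  refine h1.unique ?_
  convert hasSum_zero using 2 with i
  rw [← mul_zero (c i), ← h i, mul_add, Finset.mul_sum]
  congr 1
  exact Finset.sum_congr rfl fun j _ => by ring

end ExpSeries

/-! ## Theta functions -/

section Theta

variable {n : ℕ}

/-- The real quadratic form of `Im Ω`. -/
def imQuad (Ω : Matrix (Fin n) (Fin n) ℂ) (x : Fin n → ℝ) : ℝ :=
  x ⬝ᵥ (Ω.map Complex.im) *ᵥ x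

/-- A real vector as a complex vector. -/
def toComplex (x : Fin n → ℝ) : Fin n → ℂ := fun j => (x j : ℂ)

/-- The bilinear form of `Ω` on real vectors. -/
def bilin (Ω : Matrix (Fin n) (Fin n) ℂ) (x y : Fin n → ℝ) : ℂ :=
  toComplex x ⬝ᵥ Ω *ᵥ toComplex y

/-- The point `l / k`. -/
def latticePoint (k : ℕ+) (l : Fin n → ℤ) : Fin n → ℝ := fun j => (l j : ℝ) / (k : ℝ)

/-- The normalization constant of the theta functions. -/
def thetaAmp (Ω : Matrix (Fin n) (Fin n) ℂ) (k : ℕ+) : ℝ :=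
  (2 * Real.pi) ^ (-(n : ℝ) / 2) * gaussConst Ω k

variable {Ω : Matrix (Fin n) (Fin n) ℂ}

theorem bilin_eq_sum (Ω : Matrix (Fin n) (Fin n) ℂ) (x y : Fin n → ℝ) :
    bilin Ω x y = ∑ i, ∑ j, (x i : ℂ) * Ω i j * (y j : ℂ) := by
  simp only [bilin, toComplex, dotProduct, Matrix.mulVec, Finset.mul_sum, mul_assoc]

theorem bilin_comm (hΩ : Ω ∈ siegelUpperHalfSpace n) (x y : Fin n → ℝ) :
    bilin Ω x y = bilin Ω y x := by
  rw [bilin_eq_sum, bilin_eq_sum, Finset.sum_comm]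
  refine Finset.sum_congr rfl fun i _ => Finset.sum_congr rfl fun j _ => ?_
  have h : Ω j i = Ω i j := congrFun (congrFun hΩ.1 i) j
  rw [h]
  ring

theorem bilin_add_left (Ω : Matrix (Fin n) (Fin n) ℂ) (x y z : Fin n → ℝ) :
    bilin Ω (x + y) z = bilin Ω x z + bilin Ω y z := by
  simp only [bilin_eq_sum, Pi.add_apply, Complex.ofReal_add, add_mul, Finset.sum_add_distrib]

theorem bilin_smul_left (Ω : Matrix (Fin n) (Fin n) ℂ) (c : ℝ) (x z : Fin n → ℝ) :
    bilin Ω (c • x) z = c * bilin Ω x z := by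
  simp only [bilin_eq_sum, Pi.smul_apply, smul_eq_mul, Complex.ofReal_mul, mul_assoc,
    Finset.mul_sum]

theorem bilin_add_right (Ω : Matrix (Fin n) (Fin n) ℂ) (x y z : Fin n → ℝ) :
    bilin Ω x (y + z) = bilin Ω x y + bilin Ω x z := by
  simp only [bilin_eq_sum, Pi.add_apply, Complex.ofReal_add, mul_add, Finset.sum_add_distrib]

theorem bilin_smul_right (Ω : Matrix (Fin n) (Fin n) ℂ) (c : ℝ) (x z : Fin n → ℝ) :
    bilin Ω x (c • z) = c * bilin Ω x z := by
  simp only [bilin_eq_sum, Pi.smul_apply, smul_eq_mul, Complex.ofReal_mul, Finset.mul_sum]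
  exact Finset.sum_congr rfl fun i _ => Finset.sum_congr rfl fun j _ => by ring

theorem bilin_sub_sub (hΩ : Ω ∈ siegelUpperHalfSpace n) (x y : Fin n → ℝ) :
    bilin Ω (x - y) (x - y) = bilin Ω x x - 2 * bilin Ω y x + bilin Ω y y := by
  have h : x - y = x + (-1 : ℝ) • y := by simp [sub_eq_add_neg]
  rw [h, bilin_add_left, bilin_add_right, bilin_add_right, bilin_smul_left, bilin_smul_left,
    bilin_smul_right, bilin_smul_right, bilin_comm hΩ x y]
  push_cast
  ring

theorem bilin_im (Ω : Matrix (Fin n) (Fin n) ℂ) (x : Fin n → ℝ) :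
    (bilin Ω x x).im = imQuad Ω x := by
  rw [bilin_eq_sum, imQuad]
  simp only [dotProduct, Matrix.mulVec, Finset.mul_sum, Complex.im_sum, Matrix.map_apply]
  refine Finset.sum_congr rfl fun i _ => Finset.sum_congr rfl fun j _ => ?_
  simp
  ring

theorem imQuad_smul (Ω : Matrix (Fin n) (Fin n) ℂ) (c : ℝ) (x : Fin n → ℝ) :
    imQuad Ω (c • x) = c ^ 2 * imQuad Ω x := by
  rw [imQuad, Matrix.mulVec_smul, smul_dotProduct, dotProduct_smul, imQuad, smul_eq_mul,
    smul_eq_mul]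
  ring

theorem imQuad_continuous (Ω : Matrix (Fin n) (Fin n) ℂ) : Continuous (imQuad Ω) := by
  unfold imQuad
  simp only [dotProduct, Matrix.mulVec]
  fun_prop

/-- Homogeneity reduces the bound to the minimum of the form on the compact unit sphere, which is
empty when `n = 0`. -/
theorem exists_imQuad_ge (hΩ : Ω ∈ siegelUpperHalfSpace n) :
    ∃ c, 0 < c ∧ ∀ x : Fin n → ℝ, c * ∑ j, x j ^ 2 ≤ imQuad Ω x := by
  have hpos : ∀ x : Fin n → ℝ, x ≠ 0 → 0 < imQuad Ω x := fun x hx => by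
    simpa [imQuad] using hΩ.2.dotProduct_mulVec_pos hx
  obtain ⟨c, hc, h⟩ : ∃ c, 0 < c ∧ ∀ x ∈ Metric.sphere (0 : Fin n → ℝ) 1, c ≤ imQuad Ω x := by
    rcases (Metric.sphere (0 : Fin n → ℝ) 1).eq_empty_or_nonempty with he | hne
    · exact ⟨1, one_pos, by simp [he]⟩
    · obtain ⟨x, hx, hmin⟩ := (isCompact_sphere (0 : Fin n → ℝ) 1).exists_isMinOn hne
        (imQuad_continuous Ω).continuousOn
      refine ⟨imQuad Ω x, hpos x ?_, hmin⟩
      rintro rfl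
      simp at hx
  -- The norm on `ℝⁿ` is the sup norm, so `∑ x_j² ≤ n ‖x‖²`; the denominator `n + 1` keeps `n = 0`
  -- harmless.
  refine ⟨c / (n + 1), by positivity, fun x => ?_⟩
  have h1 : c * ‖x‖ ^ 2 ≤ imQuad Ω x := by
    rcases eq_or_ne x 0 with rfl | hx
    · simp [imQuad]
    · have hx' : 0 < ‖x‖ := norm_pos_iff.2 hx
      have h2 := h (‖x‖⁻¹ • x) (by simp [norm_smul, hx'.ne'])
      rw [imQuad_smul, inv_pow, ← div_eq_inv_mul, le_div_iff₀ (by positivity)] at h2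
      exact h2
  refine le_trans ?_ h1
  have h3 : ∑ j, x j ^ 2 ≤ ∑ _j : Fin n, ‖x‖ ^ 2 := by
    refine Finset.sum_le_sum fun j _ => ?_
    rw [← sq_abs]
    gcongr
    exact norm_le_pi_norm x j
  rw [Finset.sum_const, Finset.card_univ, Fintype.card_fin, nsmul_eq_mul] at h3
  rw [div_mul_eq_mul_div, div_le_iff₀ (by positivity), mul_assoc]
  gcongr
  nlinarith [sq_nonneg ‖x‖]

theorem gaussSection_eq (Ω : Matrix (Fin n) (Fin n) ℂ) (k : ℕ+) (l : Fin n → ℤ) (p : Cover n) :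
    gaussSection Ω k l p = (thetaAmp Ω k : ℂ) * Complex.exp (Complex.I * (k : ℂ) / 2 *
      bilin Ω (p.1 - latticePoint k l) (p.1 - latticePoint k l)) * char l p.2 := rfl

theorem thetaAmp_nonneg (Ω : Matrix (Fin n) (Fin n) ℂ) (k : ℕ+) : 0 ≤ thetaAmp Ω k := by
  unfold thetaAmp gaussConst
  positivity

theorem norm_gaussSection (Ω : Matrix (Fin n) (Fin n) ℂ) (k : ℕ+) (l : Fin n → ℤ)
    (p : Cover n) : ‖gaussSection Ω k l p‖ =
      thetaAmp Ω k * Real.exp (-(k : ℝ) / 2 * imQuad Ω (p.1 - latticePoint k l)) := by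
  rw [gaussSection_eq, norm_mul, norm_mul, norm_char, mul_one, Complex.norm_real,
    Real.norm_of_nonneg (thetaAmp_nonneg Ω k), Complex.norm_exp, ← bilin_im]
  congr 2
  have h : Complex.I * (k : ℂ) / 2 = ((k / 2 : ℝ) : ℂ) * Complex.I := by push_cast; ring
  rw [h, mul_assoc, Complex.re_ofReal_mul, Complex.I_mul_re]
  ring

/-- A Weierstrass majorant for the theta series on `‖x‖ ≤ R`: expanding the square about `l/k`
leaves a Gaussian in `l` times an exponential of rate `R`. -/
theorem exists_gaussSection_bound (hΩ : Ω ∈ siegelUpperHalfSpace n) (k : ℕ+) (R : ℝ) :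
    ∃ M : (Fin n → ℤ) → ℝ, Summable M ∧
      ∀ l (p : Cover n), ‖p.1‖ ≤ R → ‖gaussSection Ω k l p‖ ≤ M l := by
  obtain ⟨c, hc, h⟩ := exists_imQuad_ge hΩ
  have hk : (0 : ℝ) < k := by exact_mod_cast k.pos
  refine ⟨fun l => thetaAmp Ω k * Real.exp (∑ j, (c * R * |(l j : ℝ)| -
      c / (2 * k) * (l j : ℝ) ^ 2)),
    (summable_lattice_gaussian n (by positivity) _).mul_left _, fun l p hp => ?_⟩
  rw [norm_gaussSection]
  refine mul_le_mul_of_nonneg_left (Real.exp_le_exp.2 ?_) (thetaAmp_nonneg Ω k)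
  have h1 := h (p.1 - latticePoint k l)
  have h2 : -(k : ℝ) / 2 * imQuad Ω (p.1 - latticePoint k l) ≤
      -(k : ℝ) / 2 * (c * ∑ j, (p.1 - latticePoint k l) j ^ 2) := by
    have : 0 ≤ (k : ℝ) / 2 := by positivity
    nlinarith
  refine h2.trans ?_
  rw [Finset.mul_sum, Finset.mul_sum]
  refine Finset.sum_le_sum fun j _ => ?_
  have h3 : |p.1 j| ≤ R := (norm_le_pi_norm p.1 j).trans hp
  have h4 : p.1 j * (l j : ℝ) ≤ R * |(l j : ℝ)| := by
    refine (le_abs_self _).trans ?_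
    rw [abs_mul]
    gcongr
  have h5 : -(k : ℝ) / 2 * (c * (p.1 - latticePoint k l) j ^ 2) =
      -(k * c / 2 * p.1 j ^ 2) + c * (p.1 j * (l j : ℝ)) - c / (2 * k) * (l j : ℝ) ^ 2 := by
    simp only [latticePoint, Pi.sub_apply]
    field_simp
    ring
  rw [h5, mul_assoc c R]
  have h6 : 0 ≤ k * c / 2 * p.1 j ^ 2 := by positivity
  have h7 : c * (p.1 j * (l j : ℝ)) ≤ c * (R * |(l j : ℝ)|) := by gcongr
  linarith

theorem summable_gaussSection (hΩ : Ω ∈ siegelUpperHalfSpace n) (k : ℕ+) (p : Cover n) :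
    Summable fun l => gaussSection Ω k l p := by
  obtain ⟨M, hM, h⟩ := exists_gaussSection_bound hΩ k ‖p.1‖
  exact .of_norm_bounded hM fun l => h l p le_rfl

/-- The exponent `(x, t) ↦ i ⟨l, t - Ω x⟩`. -/
def thetaExponent (Ω : Matrix (Fin n) (Fin n) ℂ) (l : Fin n → ℤ) :
    ((Fin n → ℝ) × (Fin n → ℝ)) →L[ℝ] ℂ :=
  ∑ j, (Complex.I * (l j : ℂ)) •
    (Complex.ofRealCLM.comp ((ContinuousLinearMap.proj j).comp (.snd ℝ _ _)) -
      ∑ i, Ω j i • Complex.ofRealCLM.comp ((ContinuousLinearMap.proj i).comp (.fst ℝ _ _)))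

theorem thetaExponent_apply (Ω : Matrix (Fin n) (Fin n) ℂ) (l : Fin n → ℤ)
    (p : (Fin n → ℝ) × (Fin n → ℝ)) : thetaExponent Ω l p =
      ∑ j, Complex.I * (l j : ℂ) * ((p.2 j : ℂ) - ∑ i, Ω j i * (p.1 i : ℂ)) := by
  simp [thetaExponent]

theorem exists_norm_thetaExponent_le (Ω : Matrix (Fin n) (Fin n) ℂ) :
    ∃ K, 0 ≤ K ∧ ∀ l, ‖thetaExponent Ω l‖ ≤ ∑ j, K * |(l j : ℝ)| := by
  set ρ : Fin n → (((Fin n → ℝ) × (Fin n → ℝ)) →L[ℝ] ℂ) := fun j =>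
    Complex.ofRealCLM.comp ((ContinuousLinearMap.proj j).comp (.snd ℝ _ _)) -
      ∑ i, Ω j i • Complex.ofRealCLM.comp ((ContinuousLinearMap.proj i).comp (.fst ℝ _ _))
  refine ⟨∑ j, ‖ρ j‖, Finset.sum_nonneg fun j _ => norm_nonneg _, fun l => ?_⟩
  refine (norm_sum_le _ _).trans (Finset.sum_le_sum fun j _ => ?_)
  change ‖(Complex.I * (l j : ℂ)) • ρ j‖ ≤ _
  rw [norm_smul, norm_mul, Complex.norm_I, one_mul, mul_comm, Complex.norm_intCast]
  gcongr
  exact Finset.single_le_sum (f := fun j => ‖ρ j‖) (fun j _ => norm_nonneg _) (Finset.mem_univ j)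

/-- The coefficients of the theta series. -/
def thetaCoef (Ω : Matrix (Fin n) (Fin n) ℂ) (k : ℕ+) (l : Fin n → ℤ) : ℂ :=
  (thetaAmp Ω k : ℂ) *
    Complex.exp (Complex.I * (k : ℂ) / 2 * bilin Ω (latticePoint k l) (latticePoint k l))

theorem summable_thetaCoef (hΩ : Ω ∈ siegelUpperHalfSpace n) (k : ℕ+) (R : ℝ) :
    Summable fun l => ‖thetaCoef Ω k l‖ * Real.exp (R * ‖thetaExponent Ω l‖) := by
  obtain ⟨c, hc, h⟩ := exists_imQuad_ge hΩ
  obtain ⟨K, hK, hexp⟩ := exists_norm_thetaExponent_le Ω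
  have hk : (0 : ℝ) < k := by exact_mod_cast k.pos
  have h1 := (summable_lattice_gaussian n (c := c / (2 * k)) (by positivity)
    (|R| * K)).mul_left (thetaAmp Ω k)
  refine Summable.of_nonneg_of_le (fun i => by positivity) (fun l => ?_) h1
  have h2 : ‖thetaCoef Ω k l‖ =
      thetaAmp Ω k * Real.exp (-(k : ℝ) / 2 * imQuad Ω (latticePoint k l)) := by
    have := norm_gaussSection Ω k l (0, 0)
    rw [gaussSection_eq, norm_mul, norm_char, mul_one] at this
    have hn : ∀ x : Fin n → ℝ, (0 : Fin n → ℝ) - x = (-1 : ℝ) • x := fun x => by simp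
    simp only [hn, imQuad_smul, bilin_smul_left, bilin_smul_right] at this
    simpa [thetaCoef] using this
  rw [h2, mul_assoc, ← Real.exp_add]
  refine mul_le_mul_of_nonneg_left (Real.exp_le_exp.2 ?_) (thetaAmp_nonneg Ω k)
  have h3 := h (latticePoint k l)
  have h4 : R * ‖thetaExponent Ω l‖ ≤ |R| * ∑ j, K * |(l j : ℝ)| :=
    mul_le_mul (le_abs_self R) (hexp l) (norm_nonneg _) (abs_nonneg R)
  have h5 : -(k : ℝ) / 2 * imQuad Ω (latticePoint k l) ≤
      -(k : ℝ) / 2 * (c * ∑ j, latticePoint k l j ^ 2) := by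
    have : 0 ≤ (k : ℝ) / 2 := by positivity
    nlinarith
  refine (add_le_add h5 h4).trans (le_of_eq ?_)
  rw [Finset.sum_sub_distrib, Finset.mul_sum, Finset.mul_sum, Finset.mul_sum, add_comm,
    sub_eq_add_neg, ← Finset.sum_neg_distrib]
  congr 1
  · exact Finset.sum_congr rfl fun j _ => by ring
  · refine Finset.sum_congr rfl fun j _ => ?_
    simp only [latticePoint]
    field_simp

/-- Expanding the square isolates a factor `exp((ik/2) ᵗxΩx)` independent of `l`. What remains is
the exponential of a real-linear form, so that theta functions fall under the results on exponential
series. -/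
theorem upstairs_gaussSection (hΩ : Ω ∈ siegelUpperHalfSpace n) (k : ℕ+) (l : Fin n → ℤ)
    (p : (Fin n → ℝ) × (Fin n → ℝ)) : upstairs (gaussSection Ω k l) p =
      Complex.exp (Complex.I * (k : ℂ) / 2 * bilin Ω p.1 p.1) *
        (thetaCoef Ω k l * Complex.exp (thetaExponent Ω l p)) := by
  have hk : (k : ℂ) ≠ 0 := by exact_mod_cast k.ne_zero
  rw [upstairs, gaussSection_eq, bilin_sub_sub hΩ, char_tor, thetaCoef, thetaExponent_apply]
  have h1 : (k : ℂ) * bilin Ω (latticePoint k l) p.1 =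
      ∑ j, (l j : ℂ) * ∑ i, Ω j i * (p.1 i : ℂ) := by
    rw [bilin_eq_sum, Finset.mul_sum]
    refine Finset.sum_congr rfl fun j _ => ?_
    rw [Finset.mul_sum, Finset.mul_sum]
    refine Finset.sum_congr rfl fun i _ => ?_
    simp only [latticePoint]
    push_cast
    field_simp
  have h2 : ∑ j, Complex.I * (l j : ℂ) * ((p.2 j : ℂ) - ∑ i, Ω j i * (p.1 i : ℂ)) =
      Complex.I * ∑ j, (l j : ℂ) * (p.2 j : ℂ) -
        Complex.I * ((k : ℂ) * bilin Ω (latticePoint k l) p.1) := by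
    rw [h1, Finset.mul_sum, Finset.mul_sum, ← Finset.sum_sub_distrib]
    exact Finset.sum_congr rfl fun j _ => by ring
  rw [h2, mul_assoc, ← Complex.exp_add, mul_left_comm, mul_assoc, ← Complex.exp_add,
    ← Complex.exp_add]
  congr 2
  ring

theorem upstairs_theta (hΩ : Ω ∈ siegelUpperHalfSpace n) (k : ℕ+) (b : Base n)
    (p : (Fin n → ℝ) × (Fin n → ℝ)) : upstairs (theta Ω k b) p =
      Complex.exp (Complex.I * (k : ℂ) / 2 * bilin Ω p.1 p.1) *
        ∑' l : {l : Fin n → ℤ // proj (fun j => (l j : ℝ) / (k : ℝ)) = b},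
          thetaCoef Ω k l * Complex.exp (thetaExponent Ω l p) := by
  rw [← tsum_mul_left]
  exact tsum_congr fun l => upstairs_gaussSection hΩ k l p

theorem contDiff_bilin (Ω : Matrix (Fin n) (Fin n) ℂ) :
    ContDiff ℝ ∞ fun p : (Fin n → ℝ) × (Fin n → ℝ) => bilin Ω p.1 p.1 := by
  simp only [bilin_eq_sum]
  have h : ∀ i, ContDiff ℝ ∞ fun p : (Fin n → ℝ) × (Fin n → ℝ) => (p.1 i : ℂ) := fun i =>
    Complex.ofRealCLM.contDiff.comp ((contDiff_apply ℝ ℝ i).comp contDiff_fst)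
  exact ContDiff.sum fun i _ => ContDiff.sum fun j _ => ((h i).mul contDiff_const).mul (h j)

/-- The derivative is the linear coefficient of the form restricted to the line `p + τ w`; symmetry
of `Ω` merges the two cross terms. -/
theorem fderiv_bilin (hΩ : Ω ∈ siegelUpperHalfSpace n)
    (p w : (Fin n → ℝ) × (Fin n → ℝ)) :
    fderiv ℝ (fun p : (Fin n → ℝ) × (Fin n → ℝ) => bilin Ω p.1 p.1) p w =
      2 * bilin Ω w.1 p.1 := by
  have hd := ((contDiff_bilin Ω).differentiable (by simp) p).hasFDerivAt
  have h1 : HasDerivAt (fun τ : ℝ => p + τ • w) w 0 := by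
    simpa using ((hasDerivAt_id (0 : ℝ)).smul_const w).const_add p
  have h2 : HasDerivAt (fun τ : ℝ => bilin Ω (p + τ • w).1 (p + τ • w).1)
      (fderiv ℝ (fun p : (Fin n → ℝ) × (Fin n → ℝ) => bilin Ω p.1 p.1) p w) 0 := by
    have hd' : HasFDerivAt (fun p : (Fin n → ℝ) × (Fin n → ℝ) => bilin Ω p.1 p.1)
        (fderiv ℝ (fun p : (Fin n → ℝ) × (Fin n → ℝ) => bilin Ω p.1 p.1) p)
        (p + (0 : ℝ) • w) := by simpa using hd
    exact hd'.comp_hasDerivAt 0 h1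
  have h3 : (fun τ : ℝ => bilin Ω (p + τ • w).1 (p + τ • w).1) = fun τ : ℝ =>
      bilin Ω p.1 p.1 + (2 * bilin Ω w.1 p.1) * (τ : ℂ) + bilin Ω w.1 w.1 * ((τ : ℂ) * τ) := by
    funext τ
    simp only [Prod.fst_add, Prod.smul_fst, bilin_add_left, bilin_add_right, bilin_smul_left,
      bilin_smul_right, bilin_comm hΩ p.1 w.1]
    ring
  rw [h3] at h2
  have h4 : HasDerivAt (fun τ : ℝ => (τ : ℂ)) 1 0 := Complex.ofRealCLM.hasDerivAt
  have h5 := ((h4.const_mul (2 * bilin Ω w.1 p.1)).const_add (bilin Ω p.1 p.1)).add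
    ((h4.mul h4).const_mul (bilin Ω w.1 w.1))
  simpa using h2.unique h5

theorem contDiff_upstairs_theta (hΩ : Ω ∈ siegelUpperHalfSpace n) (k : ℕ+) (b : Base n) :
    ContDiff ℝ ∞ (upstairs (theta Ω k b)) := by
  rw [funext (upstairs_theta hΩ k b)]
  refine ((contDiff_const.mul (contDiff_bilin Ω)).cexp).mul (contDiff_infty.2 fun N => ?_)
  exact contDiff_tsum_exp _ N fun R => (summable_thetaCoef hΩ k R).subtype _

/-- The components of `t - Ωx` are holomorphic coordinates for `J_Ω`, by the symmetry of `Ω`. -/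
theorem thetaExponent_antiholomorphic (hΩ : Ω ∈ siegelUpperHalfSpace n) (l : Fin n → ℤ)
    (i : Fin n) : thetaExponent Ω l (Pi.single i 1, 0) +
      ∑ j, Ω i j * thetaExponent Ω l (0, Pi.single j 1) = 0 := by
  have hsymm : ∀ i j, Ω i j = Ω j i := fun i j => congrFun (congrFun hΩ.1 j) i
  have h1 : ∀ j, (∑ i', Ω j i' * (((Pi.single i 1 : Fin n → ℝ) i' : ℝ) : ℂ)) = Ω j i := by
    intro j
    rw [Finset.sum_eq_single i]
    · simp
    · intro i' _ hi
      simp [Pi.single_eq_of_ne hi]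
    · simp
  have h2 : ∀ j, thetaExponent Ω l (0, Pi.single j 1) = Complex.I * (l j : ℂ) := by
    intro j
    rw [thetaExponent_apply, Finset.sum_eq_single j]
    · simp
    · intro i' _ hi
      simp [Pi.single_eq_of_ne hi]
    · simp
  simp only [h2]
  simp only [thetaExponent_apply, h1]
  rw [← Finset.sum_add_distrib]
  refine Finset.sum_eq_zero fun j _ => ?_
  rw [hsymm i j, Pi.zero_apply, Complex.ofReal_zero]
  ring

theorem fderiv_exp_bilin (hΩ : Ω ∈ siegelUpperHalfSpace n) (k : ℕ+)
    (p : (Fin n → ℝ) × (Fin n → ℝ)) :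
    HasFDerivAt (fun p : (Fin n → ℝ) × (Fin n → ℝ) =>
      Complex.exp (Complex.I * (k : ℂ) / 2 * bilin Ω p.1 p.1))
      (fderiv ℝ (fun p : (Fin n → ℝ) × (Fin n → ℝ) =>
        Complex.exp (Complex.I * (k : ℂ) / 2 * bilin Ω p.1 p.1)) p) p ∧
    ∀ w, fderiv ℝ (fun p : (Fin n → ℝ) × (Fin n → ℝ) =>
        Complex.exp (Complex.I * (k : ℂ) / 2 * bilin Ω p.1 p.1)) p w =
      Complex.exp (Complex.I * (k : ℂ) / 2 * bilin Ω p.1 p.1) *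
        (Complex.I * k * bilin Ω w.1 p.1) := by
  have h := ((((contDiff_bilin Ω).differentiable (by simp) p).hasFDerivAt).const_mul
    (Complex.I * (k : ℂ) / 2)).cexp
  refine ⟨h.differentiableAt.hasFDerivAt, fun w => ?_⟩
  rw [h.fderiv]
  simp only [smul_apply, smul_eq_mul, fderiv_bilin hΩ]
  ring

theorem covDeriv_theta (hΩ : Ω ∈ siegelUpperHalfSpace n) (k : ℕ+) (b : Base n)
    (p : (Fin n → ℝ) × (Fin n → ℝ)) : ∃ D : ((Fin n → ℝ) × (Fin n → ℝ)) →L[ℝ] ℂ,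
      (∀ i, D (Pi.single i 1, 0) + ∑ j, Ω i j * D (0, Pi.single j 1) = 0) ∧
      ∃ S : ℂ, ∀ w, covDeriv k (theta Ω k b) p w =
        Complex.exp (Complex.I * (k : ℂ) / 2 * bilin Ω p.1 p.1) *
          (D w + Complex.I * k * (bilin Ω w.1 p.1 - ((p.1 ⬝ᵥ w.2 : ℝ) : ℂ)) * S) := by
  obtain ⟨hS, hsum⟩ := hasFDerivAt_tsum_exp
    (fun l : {l : Fin n → ℤ // proj (fun j => (l j : ℝ) / (k : ℝ)) = b} => thetaExponent Ω l)
    (c := fun l => thetaCoef Ω k l) (fun R => (summable_thetaCoef hΩ k R).subtype _) p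
  refine ⟨_, fun i => tsum_smul_antiholomorphic _ hsum
    fun l => thetaExponent_antiholomorphic hΩ l i,
    ∑' l : {l : Fin n → ℤ // proj (fun j => (l j : ℝ) / (k : ℝ)) = b},
      thetaCoef Ω k l * Complex.exp (thetaExponent Ω l p), fun w => ?_⟩
  obtain ⟨hG, hG'⟩ := fderiv_exp_bilin hΩ k p
  have h1 := hG.fun_mul hS
  rw [covDeriv, upstairs_theta hΩ, funext (upstairs_theta hΩ k b), h1.fderiv]
  simp only [add_apply, smul_apply, smul_eq_mul, hG']
  ring

/-- The series part is annihilated term by term. The derivative of the prefactor along `∂/∂x_i`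
contributes `ik ∑ Ω_ij x_j`, and the connection form along `∑ Ω_ij ∂/∂θ_j` contributes its negative.
-/
theorem theta_holomorphic (hΩ : Ω ∈ siegelUpperHalfSpace n) (k : ℕ+) (b : Base n)
    (p : (Fin n → ℝ) × (Fin n → ℝ)) (i : Fin n) :
    covDeriv k (theta Ω k b) p (Pi.single i 1, 0) +
      ∑ j, Ω i j * covDeriv k (theta Ω k b) p (0, Pi.single j 1) = 0 := by
  obtain ⟨D, hD, S, hval⟩ := covDeriv_theta hΩ k b p
  have hb : bilin Ω (Pi.single i 1) p.1 = ∑ j, Ω i j * (p.1 j : ℂ) := by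
    rw [bilin_eq_sum, Finset.sum_eq_single i]
    · simp
    · intro i' _ hi
      simp [Pi.single_eq_of_ne hi]
    · simp
  have hb0 : bilin Ω 0 p.1 = 0 := by simp [bilin_eq_sum]
  simp only [hval, hb, hb0, dotProduct_zero, dotProduct_single, mul_one]
  have h6 : ∀ j, Ω i j * (Complex.exp (Complex.I * (k : ℂ) / 2 * bilin Ω p.1 p.1) *
      (D (0, Pi.single j 1) + Complex.I * k * (0 - ((p.1 j : ℝ) : ℂ)) * S)) =
      Complex.exp (Complex.I * (k : ℂ) / 2 * bilin Ω p.1 p.1) * (Ω i j * D (0, Pi.single j 1)) -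
      Complex.exp (Complex.I * (k : ℂ) / 2 * bilin Ω p.1 p.1) * (Complex.I * k * S) *
        (Ω i j * (p.1 j : ℂ)) := fun j => by ring
  simp only [h6, Finset.sum_sub_distrib, ← Finset.mul_sum]
  simp only [Complex.ofReal_zero, sub_zero]
  linear_combination Complex.exp (Complex.I * (k : ℂ) / 2 * bilin Ω p.1 p.1) * hD i

/-! ### Lattice points and the equivariance of theta functions. -/

theorem latticePoint_add (k : ℕ+) (l m : Fin n → ℤ) :
    latticePoint k (l + m) = latticePoint k l + latticePoint k m := by
  funext j
  simp [latticePoint, add_div]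

theorem latticePoint_mul (k : ℕ+) (m : Fin n → ℤ) :
    latticePoint k (fun j => (k : ℤ) * m j) = fun j => (m j : ℝ) := by
  funext j
  have hk : (k : ℝ) ≠ 0 := by exact_mod_cast k.ne_zero
  simp only [latticePoint]
  push_cast
  field_simp

theorem gaussSection_translate (Ω : Matrix (Fin n) (Fin n) ℂ) (k : ℕ+) (l m : Fin n → ℤ)
    (x : Fin n → ℝ) (θ : Torus n) :
    gaussSection Ω k (l + fun j => (k : ℤ) * m j) (x + fun j => (m j : ℝ), θ) =
      char (fun j => (k : ℤ) * m j) θ * gaussSection Ω k l (x, θ) := by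
  simp only [gaussSection_eq, latticePoint_add, latticePoint_mul, char_add, add_sub_add_right_eq_sub]
  ring

theorem proj_latticePoint_add_mul (k : ℕ+) (l m : Fin n → ℤ) :
    proj (latticePoint k (l + fun j => (k : ℤ) * m j)) = proj (latticePoint k l) := by
  rw [latticePoint_add, latticePoint_mul, proj_add_int]

theorem proj_latticePoint_eq_iff {k : ℕ+} {l l' : Fin n → ℤ} :
    proj (latticePoint k l) = proj (latticePoint k l') ↔
      ∃ m : Fin n → ℤ, l' = l + fun j => (k : ℤ) * m j := by
  constructor
  · intro h
    obtain ⟨m, hm⟩ := proj_eq_iff.1 h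
    refine ⟨m, funext fun j => ?_⟩
    have hk : (k : ℝ) ≠ 0 := by exact_mod_cast k.ne_zero
    have h1 := congrFun hm j
    simp only [latticePoint, Pi.add_apply] at h1
    field_simp at h1
    rw [Pi.add_apply]
    exact_mod_cast h1
  · rintro ⟨m, rfl⟩
    rw [proj_latticePoint_add_mul]

/-- Translation by `k m` on the lattice points over `b`. -/
def shiftLattice (k : ℕ+) (m : Fin n → ℤ) (b : Base n) :
    {l : Fin n → ℤ // proj (fun j => (l j : ℝ) / (k : ℝ)) = b} ≃
      {l : Fin n → ℤ // proj (fun j => (l j : ℝ) / (k : ℝ)) = b} :=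
  (Equiv.addRight fun j => (k : ℤ) * m j).subtypeEquiv fun l => by
    change proj (latticePoint k l) = b ↔
      proj (latticePoint k (l + fun j => (k : ℤ) * m j)) = b
    rw [proj_latticePoint_add_mul]

theorem theta_equivariant (Ω : Matrix (Fin n) (Fin n) ℂ) (k : ℕ+) (b : Base n) (m : Fin n → ℤ)
    (x : Fin n → ℝ) (θ : Torus n) :
    theta Ω k b (x + fun j => (m j : ℝ), θ) =
      char (fun j => (k : ℤ) * m j) θ * theta Ω k b (x, θ) := by
  simp only [theta]
  rw [← (shiftLattice k m b).tsum_eq, ← tsum_mul_left]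
  exact tsum_congr fun l => gaussSection_translate Ω k l m x θ

theorem isHolomorphicSection_theta (hΩ : Ω ∈ siegelUpperHalfSpace n) (k : ℕ+) (b : Base n) :
    IsHolomorphicSection Ω k (theta Ω k b) :=
  ⟨theta_equivariant Ω k b, contDiff_upstairs_theta hΩ k b, theta_holomorphic hΩ k b⟩

end Theta

/-! ## Holomorphic sections are combinations of theta functions -/

section HolomorphicSections

variable {n : ℕ} {Ω : Matrix (Fin n) (Fin n) ℂ}

/-! ### Gaussian integrals and the normalization constant. -/

theorem integrable_exp_imQuad (hΩ : Ω ∈ siegelUpperHalfSpace n) {r : ℝ} (hr : 0 < r) :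
    Integrable fun x : Fin n → ℝ => Real.exp (-r * imQuad Ω x) := by
  obtain ⟨c, hc, h⟩ := exists_imQuad_ge hΩ
  have h1 : Integrable fun x : Fin n → ℝ => ∏ j, Real.exp (-(r * c) * x j ^ 2) :=
    Integrable.fintype_prod (f := fun _ x => Real.exp (-(r * c) * x ^ 2))
      fun _ => integrable_exp_neg_mul_sq (by positivity)
  refine h1.mono' ?_ (Filter.Eventually.of_forall fun x => ?_)
  · have := imQuad_continuous Ω
    exact Continuous.aestronglyMeasurable (by fun_prop)
  · rw [Real.norm_of_nonneg (Real.exp_pos _).le, ← Real.exp_sum, ← Finset.mul_sum]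
    refine Real.exp_le_exp.2 ?_
    nlinarith [h x]

theorem integral_exp_imQuad_pos (hΩ : Ω ∈ siegelUpperHalfSpace n) {r : ℝ} (hr : 0 < r) :
    0 < ∫ x : Fin n → ℝ, Real.exp (-r * imQuad Ω x) :=
  integral_exp_pos (integrable_exp_imQuad hΩ hr)

theorem gaussConst_sq (hΩ : Ω ∈ siegelUpperHalfSpace n) (k : ℕ+) :
    gaussConst Ω k ^ 2 = (∫ x : Fin n → ℝ, Real.exp (-(k : ℝ) * imQuad Ω x))⁻¹ := by
  have hk : (0 : ℝ) < k := by exact_mod_cast k.pos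
  rw [gaussConst, inv_pow]
  exact congrArg Inv.inv (Real.sq_sqrt (integral_exp_imQuad_pos hΩ hk).le)

/-- With the volume `(2π)ⁿ` of the fibre included, the squared amplitude is what makes `exp(-k ᵗxQx)
dx` a probability measure. -/
theorem thetaAmp_sq (hΩ : Ω ∈ siegelUpperHalfSpace n) (k : ℕ+) :
    (2 * Real.pi) ^ n * thetaAmp Ω k ^ 2 =
      (∫ x : Fin n → ℝ, Real.exp (-(k : ℝ) * imQuad Ω x))⁻¹ := by
  rw [thetaAmp, mul_pow (_ ^ _) (gaussConst Ω k), gaussConst_sq hΩ, ← Real.rpow_natCast (_ ^ _) 2,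
    ← Real.rpow_mul Real.two_pi_pos.le, ← Real.rpow_natCast (2 * Real.pi) n, ← mul_assoc,
    ← Real.rpow_add Real.two_pi_pos]
  norm_num

theorem thetaAmp_pos (hΩ : Ω ∈ siegelUpperHalfSpace n) (k : ℕ+) : 0 < thetaAmp Ω k := by
  have hk : (0 : ℝ) < k := by exact_mod_cast k.pos
  refine (thetaAmp_nonneg Ω k).lt_of_ne fun h => ?_
  have h1 := thetaAmp_sq hΩ k
  rw [← h] at h1
  have h2 := inv_pos.2 (integral_exp_imQuad_pos hΩ hk)
  rw [← h1] at h2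
  simp at h2

/-- Trivial holonomy around the circles of the fibre forces `k x` to be integral; conversely the
character of index `k x` is a nonzero parallel section. -/
theorem mem_bohrSommerfeld_iff {k : ℕ+} {b : Base n} :
    b ∈ bohrSommerfeld n k ↔ ∃ l : Fin n → ℤ, proj (latticePoint k l) = b := by
  have hk : (k : ℝ) ≠ 0 := by exact_mod_cast k.ne_zero
  constructor
  · intro hb
    choose l hl using bohrSommerfeld_integral hb (baseLift b)
    refine ⟨l, ?_⟩
    rw [← (baseLift b).2]
    congr 1
    funext j
    rw [latticePoint, ← hl j, mul_div_cancel_left₀ _ hk]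
  · rintro ⟨l, rfl⟩
    have hr : ∀ (x : Lift (proj (latticePoint k l))) j,
        ((round ((k : ℝ) * x.1 j) : ℤ) : ℝ) = (k : ℝ) * x.1 j := by
      intro x j
      obtain ⟨m, hm⟩ := proj_eq_iff.1 x.2.symm
      have h1 : (k : ℝ) * x.1 j = ((l j + k * m j : ℤ) : ℝ) := by
        rw [hm]
        simp only [latticePoint, Pi.add_apply]
        push_cast
        field_simp
      rw [h1, round_intCast]
    have hf : ∀ (x : Lift (proj (latticePoint k l))) t,
        char (fun j => round ((k : ℝ) * x.1 j)) (tor t) =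
        Complex.exp (Complex.I * (k : ℂ) * ∑ j, (x.1 j : ℂ) * (t j : ℂ)) := by
      intro x t
      rw [char_tor, mul_assoc, Finset.mul_sum (a := (k : ℂ))]
      congr 2
      refine Finset.sum_congr rfl fun j _ => ?_
      have h : ((round ((k : ℝ) * x.1 j) : ℤ) : ℂ) = (k : ℂ) * (x.1 j : ℂ) := by
        exact_mod_cast hr x j
      rw [h, mul_assoc]
    have hmem : (fun (x : Lift (proj (latticePoint k l))) θ =>
        char (fun j => round ((k : ℝ) * x.1 j)) θ) ∈
        parallelSections n k (proj (latticePoint k l)) := by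
      refine ⟨fun x => ?_, fun x t j => ?_, fun x y m hm θ => ?_⟩
      · simp only [hf]
        refine ContDiff.cexp (contDiff_const.mul (ContDiff.sum fun j _ => contDiff_const.mul ?_))
        exact Complex.ofRealCLM.contDiff.comp (contDiff_apply ℝ ℝ j)
      · simp only [hf, (hasFDerivAt_phase (Complex.I * (k : ℂ)) x.1 t).fderiv]
        have h4 : ∑ i, (x.1 i : ℂ) * (((Pi.single j 1 : Fin n → ℝ) i : ℝ) : ℂ) =
            (x.1 j : ℂ) := by
          rw [Finset.sum_eq_single j]
          · simp
          · intro i _ hi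
            simp [Pi.single_eq_of_ne hi]
          · simp
        simp [h4]
        ring
      · have h : (fun j => round ((k : ℝ) * y.1 j)) =
            (fun j => (k : ℤ) * m j) + fun j => round ((k : ℝ) * x.1 j) := by
          funext j
          have : ((round ((k : ℝ) * y.1 j) : ℤ) : ℝ) =
              (((k : ℤ) * m j + round ((k : ℝ) * x.1 j) : ℤ) : ℝ) := by
            push_cast
            rw [hr, hr, hm, Pi.add_apply]
            ring
          exact_mod_cast this
        beta_reduce
        rw [h, char_add]
    refine ⟨⟨_, hmem⟩, fun h0 => ?_⟩
    have h1 : (1 : ℂ) = 0 := by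
      have h2 : char (fun j => round ((k : ℝ) * (baseLift (proj (latticePoint k l))).1 j)) 0 =
          0 := congrFun (congrFun (congrArg Subtype.val h0) (baseLift _)) 0
      simp [char] at h2
    exact one_ne_zero h1

/-- For fixed `x` the theta series is an absolutely convergent Fourier series, so its coefficients
can be read off termwise. -/
theorem fourierCoef_theta (hΩ : Ω ∈ siegelUpperHalfSpace n) (k : ℕ+) (b : Base n)
    (q : Fin n → ℤ) (x : Fin n → ℝ) [Decidable (proj (latticePoint k q) = b)] :
    (fourierCoef q fun θ => theta Ω k b (x, θ)) = if proj (latticePoint k q) = b then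
      (thetaAmp Ω k : ℂ) * Complex.exp (Complex.I * (k : ℂ) / 2 *
        bilin Ω (x - latticePoint k q) (x - latticePoint k q)) else 0 := by
  set A : (Fin n → ℤ) → ℂ := fun l => (thetaAmp Ω k : ℂ) * Complex.exp (Complex.I * (k : ℂ) / 2 *
        bilin Ω (x - latticePoint k l) (x - latticePoint k l))
  have hA : ∀ l θ, gaussSection Ω k l (x, θ) = A l * char l θ := fun l θ => rfl
  have hnorm : Summable fun l => ‖A l‖ := by
    refine (summable_gaussSection hΩ k (x, 0)).norm.congr fun l => ?_
    rw [hA, norm_mul, norm_char, mul_one]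
  have h1 := hasSum_integral_of_summable_integral_norm (μ := haarTorus n)
    (F := fun (l : {l : Fin n → ℤ // proj (fun j => (l j : ℝ) / (k : ℝ)) = b}) θ =>
      char (-q) θ * gaussSection Ω k l (x, θ))
    (fun l => by
      simp only [hA]
      exact ((char_continuous _).mul
        (continuous_const.mul (char_continuous _))).integrable_haarTorus)
    (by
      simp only [hA, norm_mul, norm_char, mul_one, one_mul, integral_const, probReal_univ,
        one_smul]
      exact hnorm.subtype _)
  simp only [tsum_mul_left] at h1
  have h2 : ∀ l, ∫ θ, char (-q) θ * gaussSection Ω k l (x, θ) ∂haarTorus n =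
      if q = l then A l else 0 := by
    intro l
    have h3 := fourierCoef_const_mul q (A l) (char l)
    rw [fourierCoef_char, mul_ite, mul_one, mul_zero] at h3
    exact h3
  simp only [h2] at h1
  refine h1.unique ?_
  split_ifs with hq
  · have h4 := hasSum_ite_eq (⟨q, hq⟩ : {l : Fin n → ℤ // proj (fun j => (l j : ℝ) / (k : ℝ)) = b})
      (A q)
    refine h4.congr_fun fun l => ?_
    by_cases hl : q = l
    · subst hl
      simp
    · rw [if_neg hl, if_neg fun h => hl (by rw [h])]
  · refine hasSum_zero.congr_fun fun l => ?_
    rw [if_neg]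
    rintro rfl
    exact hq l.2

/-- The Cauchy–Riemann equations solved for the base derivative. The right side involves only
covariant fibre derivatives, which act on Fourier coefficients by scalars. -/
theorem IsHolomorphicSection.dirDeriv_base {k : ℕ+} {s : Cover n → ℂ}
    (hs : IsHolomorphicSection Ω k s) (u x : Fin n → ℝ) (θ : Torus n) :
    dirDeriv (u, 0) s (x, θ) = -∑ i, (u i : ℂ) * ∑ j, Ω i j *
      (dirDeriv (0, Pi.single j 1) s (x, θ) - Complex.I * (k : ℂ) * (x j : ℂ) * s (x, θ)) := by
  obtain ⟨t, rfl⟩ := tor_surjective θ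
  have h1 : ∀ w, dirDeriv w s (x, tor t) = fderiv ℝ (upstairs s) (x, t) w := fun w =>
    upstairs_dirDeriv w s (x, t)
  have h2 : ((u, 0) : (Fin n → ℝ) × (Fin n → ℝ)) =
      ∑ i, u i • (Pi.single i 1, 0) := by
    rw [Prod.ext_iff]
    constructor
    · rw [Prod.fst_sum]
      funext j
      simp [Finset.sum_apply, Pi.single_apply]
    · simp [Prod.snd_sum]
  rw [h1, h2, map_sum, ← Finset.sum_neg_distrib]
  refine Finset.sum_congr rfl fun i _ => ?_
  have h3 := hs.holomorphic (x, t) i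
  simp only [covDeriv, dotProduct_zero, dotProduct_single, mul_one, Complex.ofReal_zero, mul_zero,
    zero_mul, sub_zero] at h3
  rw [map_smul, Complex.real_smul, eq_neg_of_add_eq_zero_left h3]
  simp only [h1, mul_neg]
  rfl

/-- The Fourier coefficients of a holomorphic section are Gaussians. -/
theorem IsHolomorphicSection.fourierCoef_eq {k : ℕ+} {s : Cover n → ℂ}
    (hs : IsHolomorphicSection Ω k s) (l : Fin n → ℤ) (x : Fin n → ℝ) :
    (fourierCoef l fun θ => s (x, θ)) = (fourierCoef l fun θ => s (latticePoint k l, θ)) *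
      Complex.exp (Complex.I * (k : ℂ) / 2 *
        bilin Ω (x - latticePoint k l) (x - latticePoint k l)) := by
  have hk : (k : ℂ) ≠ 0 := by exact_mod_cast k.ne_zero
  set y := latticePoint k l with hy
  set u := x - y with hu
  set φ : ℝ → ℂ := fun τ => fourierCoef l fun θ => s (y + τ • u, θ) with hφ
  have hc : Continuous s := continuous_of_upstairs hs.smooth.continuous
  have hcd : ∀ w, Continuous (dirDeriv w s) := fun w =>
    continuous_of_upstairs (contDiff_dirDeriv w hs.smooth).continuous
  -- On the `l`-th coefficient, the covariant derivative along `θ_j` acts as `i l_j - ik x_j`. As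
  -- the ray starts at `l/k`, this equals `-ik τ u_j`, and the ODE has no constant term.
  have hder : ∀ τ, HasDerivAt φ (Complex.I * (k : ℂ) * τ * bilin Ω u u * φ τ) τ := by
    intro τ
    have h1 := hasDerivAt_fourierCoef_base hs.smooth l y u τ
    convert h1 using 1
    simp only [hs.dirDeriv_base]
    have h2 : ∀ j, (fourierCoef l fun θ => dirDeriv (0, Pi.single j 1) s (y + τ • u, θ) -
        Complex.I * (k : ℂ) * ((y + τ • u) j : ℂ) * s (y + τ • u, θ)) =
        -(Complex.I * k * τ * u j) * φ τ := by
      intro j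
      have hcj := hcd (0, Pi.single j 1)
      rw [fourierCoef_sub l (g := fun θ => dirDeriv (0, Pi.single j 1) s (y + τ • u, θ))
        (h := fun θ => Complex.I * (k : ℂ) * ((y + τ • u) j : ℂ) * s (y + τ • u, θ))
        (by fun_prop) (by fun_prop), fourierCoef_dirDeriv_fiber hs.smooth, fourierCoef_const_mul]
      have h3 : (l j : ℂ) = k * y j := by
        rw [hy, latticePoint]
        push_cast
        field_simp
      simp only [hφ, h3, Pi.add_apply, Pi.smul_apply, smul_eq_mul]
      push_cast
      ring
    have h4 : (fun θ => -∑ i, (u i : ℂ) * ∑ j, Ω i j *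
        (dirDeriv (0, Pi.single j 1) s (y + τ • u, θ) -
          Complex.I * (k : ℂ) * ((y + τ • u) j : ℂ) * s (y + τ • u, θ))) =
        fun θ => (-1 : ℂ) * ∑ i, (u i : ℂ) * ∑ j, Ω i j *
        (dirDeriv (0, Pi.single j 1) s (y + τ • u, θ) -
          Complex.I * (k : ℂ) * ((y + τ • u) j : ℂ) * s (y + τ • u, θ)) := by
      funext θ
      ring
    rw [h4, fourierCoef_const_mul, fourierCoef_finsetSum]
    swap
    · intro i _
      fun_prop
    simp_rw [fourierCoef_const_mul]
    have h5 : ∀ i, (fourierCoef l fun θ => ∑ j, Ω i j *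
        (dirDeriv (0, Pi.single j 1) s (y + τ • u, θ) -
          Complex.I * (k : ℂ) * ((y + τ • u) j : ℂ) * s (y + τ • u, θ))) =
        ∑ j, Ω i j * (-(Complex.I * k * τ * u j) * φ τ) := by
      intro i
      rw [fourierCoef_finsetSum]
      · exact Finset.sum_congr rfl fun j _ => by rw [fourierCoef_const_mul, h2]
      · intro j _
        have hcj := hcd (0, Pi.single j 1)
        fun_prop
    simp_rw [h5]
    rw [bilin_eq_sum, neg_one_mul, ← Finset.sum_neg_distrib, Finset.mul_sum, Finset.sum_mul]
    refine Finset.sum_congr rfl fun i _ => ?_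
    rw [Finset.mul_sum, Finset.sum_mul, Finset.mul_sum, ← Finset.sum_neg_distrib]
    exact Finset.sum_congr rfl fun j _ => by ring
  -- The integrating factor; its product with `φ` is constant, and comparison at `τ = 0` and `τ = 1`
  -- gives the claim.
  have hE : ∀ τ : ℝ, HasDerivAt (fun τ : ℝ =>
      Complex.exp (-(Complex.I * (k : ℂ) / 2 * bilin Ω u u) * ((τ : ℂ) * τ)))
      (Complex.exp (-(Complex.I * (k : ℂ) / 2 * bilin Ω u u) * ((τ : ℂ) * τ)) *
        (-(Complex.I * (k : ℂ) / 2 * bilin Ω u u) * (1 * (τ : ℂ) + τ * 1))) τ := by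
    intro τ
    have h4 : HasDerivAt (fun τ : ℝ => (τ : ℂ)) 1 τ := Complex.ofRealCLM.hasDerivAt
    exact ((h4.mul h4).const_mul _).cexp
  have hconst := is_const_of_deriv_eq_zero (𝕜 := ℝ)
    (f := fun τ => φ τ * Complex.exp (-(Complex.I * (k : ℂ) / 2 * bilin Ω u u) * ((τ : ℂ) * τ)))
    (fun τ => ((hder τ).fun_mul (hE τ)).differentiableAt)
    (fun τ => by
      rw [((hder τ).fun_mul (hE τ)).deriv]
      ring) 1 0
  have hφ1 : φ 1 = fourierCoef l fun θ => s (x, θ) := by simp [hφ, hu]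
  have hφ0 : φ 0 = fourierCoef l fun θ => s (y, θ) := by simp [hφ]
  simp only [Complex.ofReal_one, Complex.ofReal_zero, mul_zero, mul_one, Complex.exp_zero, hφ1,
    hφ0] at hconst
  rw [← hconst, mul_assoc, ← Complex.exp_add]
  simp

/-- Moving the base point by `m` multiplies the section by the character of index `k m`, which
shifts the frequency back. The amplitude thus depends only on the class of `l/k` in `B_k`. -/
theorem IsHolomorphicSection.fourierCoef_shift {k : ℕ+} {s : Cover n → ℂ}
    (hs : IsHolomorphicSection Ω k s) (l m : Fin n → ℤ) :
    (fourierCoef (l + fun j => (k : ℤ) * m j) fun θ =>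
      s (latticePoint k (l + fun j => (k : ℤ) * m j), θ)) =
      fourierCoef l fun θ => s (latticePoint k l, θ) := by
  simp only [latticePoint_add, latticePoint_mul, hs.equivariant]
  rw [fourierCoef_char_mul, add_sub_cancel_right]

/-- With `a b` the normalized amplitude at one lattice point over `b`, both sides have equal Fourier
coefficients on every fibre, hence agree by continuity. -/
theorem IsHolomorphicSection.exists_eq_sum_theta (hΩ : Ω ∈ siegelUpperHalfSpace n) {k : ℕ+}
    {s : Cover n → ℂ} (hs : IsHolomorphicSection Ω k s) :
    ∃ a : bohrSommerfeld n k → ℂ, ∀ p, s p = ∑ b, a b * theta Ω k b p := by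
  classical
  have hamp : (thetaAmp Ω k : ℂ) ≠ 0 := by exact_mod_cast (thetaAmp_pos hΩ k).ne'
  choose l hl using fun b : bohrSommerfeld n k => mem_bohrSommerfeld_iff.1 b.2
  set a : bohrSommerfeld n k → ℂ := fun b =>
    (fourierCoef (l b) fun θ => s (latticePoint k (l b), θ)) / thetaAmp Ω k with ha
  refine ⟨a, fun ⟨x, θ⟩ => ?_⟩
  have hc : Continuous s := continuous_of_upstairs hs.smooth.continuous
  have hct : ∀ b : Base n, Continuous (theta Ω k b) := fun b =>
    continuous_of_upstairs (contDiff_upstairs_theta hΩ k b).continuous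
  have h0 := eq_zero_of_fourierCoef
    (g := fun θ => s (x, θ) - ∑ b : bohrSommerfeld n k, a b * theta Ω k b (x, θ))
    ((by fun_prop : Continuous fun θ => s (x, θ)).sub
      (continuous_finsetSum _ fun b _ => by have := hct b; fun_prop)) fun q => by
      rw [fourierCoef_sub q (g := fun θ => s (x, θ)) (by fun_prop)
        (continuous_finsetSum _ fun b _ => by have := hct b; fun_prop), fourierCoef_finsetSum]
      swap
      · intro b _
        have := hct b
        fun_prop
      simp_rw [fourierCoef_const_mul, fourierCoef_theta hΩ]
      rw [Finset.sum_eq_single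
        (⟨proj (latticePoint k q), mem_bohrSommerfeld_iff.2 ⟨q, rfl⟩⟩ : bohrSommerfeld n k)]
      · obtain ⟨m, hm⟩ := proj_latticePoint_eq_iff.1
          (hl ⟨proj (latticePoint k q), mem_bohrSommerfeld_iff.2 ⟨q, rfl⟩⟩)
        rw [if_pos rfl, ha, hs.fourierCoef_eq q x]
        have h1 := hs.fourierCoef_shift
          (l ⟨proj (latticePoint k q), mem_bohrSommerfeld_iff.2 ⟨q, rfl⟩⟩) m
        rw [← hm] at h1
        rw [h1]
        field_simp
        ring
      · intro b _ hb
        rw [if_neg fun h => hb (Subtype.ext h.symm), mul_zero]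
      · simp
  exact sub_eq_zero.1 (congrFun h0 θ)

end HolomorphicSections

/-! ## Unfolding the pairing of theta functions -/

section Unfolding

variable {n : ℕ} {Ω : Matrix (Fin n) (Fin n) ℂ}

/-- The integrand of the pairing of `Ψ_{l}` and `f Ψ_{l'}`. -/
def pairIntegrand (Ω : Matrix (Fin n) (Fin n) ℂ) (k : ℕ+) (f : C(Total n, ℂ))
    (l l' : Fin n → ℤ) (p : Cover n) : ℂ :=
  starRingEnd ℂ (gaussSection Ω k l p) * (f (proj p.1, p.2) * gaussSection Ω k l' p)

/-- The fundamental domain `[0,1)ⁿ × Tⁿ`. -/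
def fundDomain (n : ℕ) : Set (Cover n) := (Set.univ.pi fun _ => Set.Ico (0 : ℝ) 1) ×ˢ Set.univ

theorem measurableSet_fundDomain : MeasurableSet (fundDomain n) :=
  (MeasurableSet.univ_pi fun _ => measurableSet_Ico).prod MeasurableSet.univ

theorem volume_fundDomain_lt_top : volume (fundDomain n) < ⊤ := by
  rw [fundDomain, Measure.volume_eq_prod, Measure.prod_prod]
  refine ENNReal.mul_lt_top ?_ ?_
  · rw [volume_pi_pi]
    simp
  · rw [volume_torus, Measure.smul_apply, measure_univ]
    simp

instance : IsFiniteMeasure (fundMeasure n) :=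
  ⟨by rw [fundMeasure, Measure.restrict_apply_univ]; exact volume_fundDomain_lt_top⟩

instance : IsFiniteMeasure (volume : Measure (Torus n)) :=
  ⟨by rw [volume_torus, Measure.smul_apply, measure_univ]; simp⟩

theorem measurePreserving_cover_add (v : Cover n) :
    MeasurePreserving (fun p : Cover n => p + v) :=
  (measurePreserving_add_right (volume : Measure (Fin n → ℝ)) v.1).prod
    (measurePreserving_add_right (volume : Measure (Torus n)) v.2)

theorem norm_le_one_of_mem_fundDomain {p : Cover n} (hp : p ∈ fundDomain n) : ‖p.1‖ ≤ 1 := by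
  refine (pi_norm_le_iff_of_nonneg zero_le_one).2 fun j => ?_
  have h := hp.1 j (Set.mem_univ j)
  rw [Real.norm_of_nonneg h.1]
  exact h.2.le

theorem gaussSection_continuous (Ω : Matrix (Fin n) (Fin n) ℂ) (k : ℕ+) (l : Fin n → ℤ) :
    Continuous (gaussSection Ω k l) := by
  have h := char_continuous l
  have h2 : Continuous fun p : Cover n =>
      bilin Ω (p.1 - latticePoint k l) (p.1 - latticePoint k l) := by
    simp only [bilin_eq_sum, Pi.sub_apply]
    fun_prop
  rw [funext (gaussSection_eq Ω k l)]
  fun_prop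

theorem continuous_lift (f : C(Total n, ℂ)) : Continuous fun p : Cover n => f (proj p.1, p.2) :=
  f.continuous.comp ((proj_continuous.comp continuous_fst).prodMk continuous_snd)

theorem pairIntegrand_continuous (Ω : Matrix (Fin n) (Fin n) ℂ) (k : ℕ+) (f : C(Total n, ℂ))
    (l l' : Fin n → ℤ) : Continuous (pairIntegrand Ω k f l l') :=
  (Complex.continuous_conj.comp (gaussSection_continuous Ω k l)).mul
    ((continuous_lift f).mul (gaussSection_continuous Ω k l'))

theorem norm_pairIntegrand_le (Ω : Matrix (Fin n) (Fin n) ℂ) (k : ℕ+) (f : C(Total n, ℂ))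
    (l l' : Fin n → ℤ) (p : Cover n) : ‖pairIntegrand Ω k f l l' p‖ ≤
      ‖f‖ * (‖gaussSection Ω k l p‖ * ‖gaussSection Ω k l' p‖) := by
  rw [pairIntegrand, norm_mul, norm_mul, RCLike.norm_conj, mul_left_comm]
  gcongr
  exact f.norm_coe_le_norm _

/-- The two equivariance factors are conjugate unimodular numbers and cancel; this invariance makes
the unfolding possible. -/
theorem pairIntegrand_translate (Ω : Matrix (Fin n) (Fin n) ℂ) (k : ℕ+) (f : C(Total n, ℂ))
    (l l' m : Fin n → ℤ) (p : Cover n) :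
    pairIntegrand Ω k f (l + fun j => (k : ℤ) * m j) (l' + fun j => (k : ℤ) * m j)
      (p + ((fun j => (m j : ℝ)), 0)) = pairIntegrand Ω k f l l' p := by
  obtain ⟨x, θ⟩ := p
  have h1 : ((x, θ) : Cover n) + ((fun j => (m j : ℝ)), 0) = (x + fun j => (m j : ℝ), θ) := by
    simp
  simp only [pairIntegrand, h1, gaussSection_translate, proj_add_int, map_mul, ← char_neg]
  have h2 := char_neg_mul_char (fun j => (k : ℤ) * m j) θ
  linear_combination (starRingEnd ℂ (gaussSection Ω k l (x, θ)) *
    (f (proj x, θ) * gaussSection Ω k l' (x, θ))) * h2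

theorem imQuad_nonneg (hΩ : Ω ∈ siegelUpperHalfSpace n) (x : Fin n → ℝ) : 0 ≤ imQuad Ω x := by
  obtain ⟨c, hc, h⟩ := exists_imQuad_ge hΩ
  exact (mul_nonneg hc.le (Finset.sum_nonneg fun j _ => sq_nonneg _)).trans (h x)

theorem norm_gaussSection_le (hΩ : Ω ∈ siegelUpperHalfSpace n) (k : ℕ+) (l : Fin n → ℤ)
    (p : Cover n) : ‖gaussSection Ω k l p‖ ≤ thetaAmp Ω k := by
  rw [norm_gaussSection]
  refine mul_le_of_le_one_right (thetaAmp_nonneg Ω k) (Real.exp_le_one_iff.2 ?_)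
  have := imQuad_nonneg hΩ (p.1 - latticePoint k l)
  have hk : (0 : ℝ) < k := by exact_mod_cast k.pos
  have : 0 ≤ (k : ℝ) / 2 * imQuad Ω (p.1 - latticePoint k l) := by positivity
  linarith

theorem integrable_norm_gaussSection (hΩ : Ω ∈ siegelUpperHalfSpace n) (k : ℕ+)
    (l : Fin n → ℤ) : Integrable fun p : Cover n => ‖gaussSection Ω k l p‖ := by
  have hk : (0 : ℝ) < k := by exact_mod_cast k.pos
  have h1 := (integrable_exp_imQuad hΩ (r := k / 2) (by positivity)).comp_sub_right
    (latticePoint k l)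
  have h2 : Integrable (fun p : Cover n =>
      Real.exp (-(k / 2 : ℝ) * imQuad Ω (p.1 - latticePoint k l))) := h1.comp_fst volume
  refine (h2.const_mul (thetaAmp Ω k)).congr (Filter.Eventually.of_forall fun p => ?_)
  simp only [norm_gaussSection]
  rw [neg_div]

theorem integrable_pairIntegrand (hΩ : Ω ∈ siegelUpperHalfSpace n) (k : ℕ+) (f : C(Total n, ℂ))
    (l l' : Fin n → ℤ) : Integrable (pairIntegrand Ω k f l l') := by
  refine ((integrable_norm_gaussSection hΩ k l).const_mul (‖f‖ * thetaAmp Ω k)).mono'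
    (pairIntegrand_continuous Ω k f l l').aestronglyMeasurable
    (Filter.Eventually.of_forall fun p => ?_)
  refine (norm_pairIntegrand_le Ω k f l l' p).trans ?_
  rw [mul_assoc, mul_comm (thetaAmp Ω k)]
  gcongr
  exact norm_gaussSection_le hΩ k l' p

/-- The pairing of `Ψ_l` and `f Ψ_{l'}` over `ℝⁿ × Tⁿ`. -/
def gaussPairing (Ω : Matrix (Fin n) (Fin n) ℂ) (k : ℕ+) (f : C(Total n, ℂ))
    (l l' : Fin n → ℤ) : ℂ := ∫ p : Cover n, pairIntegrand Ω k f l l' p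

/-- A simultaneous shift of the two centres by `m` amounts to translating the domain of integration,
and the translates of the fundamental domain tile `ℝⁿ × Tⁿ`. -/
theorem hasSum_gaussPairing (hΩ : Ω ∈ siegelUpperHalfSpace n) (k : ℕ+) (f : C(Total n, ℂ))
    (l l' : Fin n → ℤ) : HasSum (fun m : Fin n → ℤ => ∫ p in fundDomain n,
      pairIntegrand Ω k f (l + fun j => (k : ℤ) * m j) (l' + fun j => (k : ℤ) * m j) p)
      (gaussPairing Ω k f l l') := by
  set v : (Fin n → ℤ) → Cover n := fun m => ((fun j => (m j : ℝ)), 0) with hv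
  have h1 : ∀ m : Fin n → ℤ, (∫ p in fundDomain n,
      pairIntegrand Ω k f (l + fun j => (k : ℤ) * m j) (l' + fun j => (k : ℤ) * m j) p) =
      ∫ p in (fun p => p + v m) ⁻¹' fundDomain n, pairIntegrand Ω k f l l' p := by
    intro m
    have h2 := (measurePreserving_cover_add (v m)).setIntegral_preimage_emb
      (measurableEmbedding_addRight (v m))
      (pairIntegrand Ω k f (l + fun j => (k : ℤ) * m j) (l' + fun j => (k : ℤ) * m j))
      (fundDomain n)
    rw [← h2]
    simp only [hv, pairIntegrand_translate]
  simp only [h1]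
  have hU : ⋃ m, (fun p => p + v m) ⁻¹' fundDomain n = Set.univ := by
    refine Set.eq_univ_of_forall fun p => ?_
    obtain ⟨m, hm⟩ := exists_int_sub_mem_Ico p.1
    exact Set.mem_iUnion.2 ⟨m, hm, Set.mem_univ _⟩
  have h3 := hasSum_integral_iUnion (μ := (volume : Measure (Cover n)))
    (s := fun m => (fun p => p + v m) ⁻¹' fundDomain n) (f := pairIntegrand Ω k f l l')
    (fun m => measurableSet_fundDomain.preimage (measurable_add_const (v m)))
    (fun m m' hm => Set.disjoint_left.2 fun p hp hp' => hm (funext fun j => ?_))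
    (integrable_pairIntegrand hΩ k f l l').integrableOn
  · rwa [hU, setIntegral_univ] at h3
  · have h4 := hp.1 j (Set.mem_univ j)
    have h5 := hp'.1 j (Set.mem_univ j)
    simp only [hv, Prod.fst_add, Pi.add_apply, Set.mem_Ico] at h4 h5
    have h6 : (m j : ℝ) < m' j + 1 := by linarith
    have h7 : (m' j : ℝ) < m j + 1 := by linarith
    have h8 : m j < m' j + 1 := by exact_mod_cast h6
    have h9 : m' j < m j + 1 := by exact_mod_cast h7
    omega

/-- The lattice points over `b`. -/
abbrev LatticeOver (k : ℕ+) (b : Base n) : Type :=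
  {l : Fin n → ℤ // proj (fun j => (l j : ℝ) / (k : ℝ)) = b}

/-- Pairs of lattice points over `b` and `c`, up to simultaneous translation. -/
def pairEquiv (k : ℕ+) {b c : Base n} {l₀ : Fin n → ℤ} (hl : proj (latticePoint k l₀) = b) :
    LatticeOver k (c - b) × (Fin n → ℤ) ≃ LatticeOver k b × LatticeOver k c where
  toFun p := (⟨l₀ + fun j => (k : ℤ) * p.2 j, (proj_latticePoint_add_mul k l₀ p.2).trans hl⟩,
    ⟨l₀ + p.1.1 + fun j => (k : ℤ) * p.2 j, (proj_latticePoint_add_mul k _ p.2).trans (by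
      rw [latticePoint_add, proj_add, hl]
      have h : proj (latticePoint k p.1.1) = c - b := p.1.2
      rw [h]
      abel)⟩)
  invFun q := (⟨q.2.1 - q.1.1, by
      have h1 : proj (latticePoint k q.1.1) = b := q.1.2
      have h2 : proj (latticePoint k q.2.1) = c := q.2.2
      have h3 : latticePoint k (q.2.1 - q.1.1) = latticePoint k q.2.1 - latticePoint k q.1.1 := by
        rw [eq_sub_iff_add_eq, ← latticePoint_add, sub_add_cancel]
      change proj (latticePoint k (q.2.1 - q.1.1)) = c - b
      rw [h3, proj_sub, h1, h2]⟩,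
    (proj_latticePoint_eq_iff.1 (hl.trans q.1.2.symm)).choose)
  left_inv p := by
    have h1 := (proj_latticePoint_eq_iff.1 (hl.trans
      ((proj_latticePoint_add_mul k l₀ p.2).trans hl).symm)).choose_spec
    refine Prod.ext (Subtype.ext ?_) ?_
    · simp only
      abel
    · funext j
      have h2 := congrFun h1 j
      simp only [Pi.add_apply, add_right_inj] at h2
      exact (mul_left_cancel₀ (by exact_mod_cast k.ne_zero) h2).symm
  right_inv q := by
    have h1 := (proj_latticePoint_eq_iff.1 (hl.trans q.1.2.symm)).choose_spec
    refine Prod.ext (Subtype.ext h1.symm) (Subtype.ext ?_)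
    simp only
    rw [add_right_comm, ← h1]
    abel

/-- The fundamental domain lies over the unit ball, where the Gaussians have a summable majorant;
the double series may be integrated termwise. -/
theorem hasSum_integral_theta (hΩ : Ω ∈ siegelUpperHalfSpace n) (k : ℕ+) (f : C(Total n, ℂ))
    (b c : Base n) : HasSum (fun q : LatticeOver k b × LatticeOver k c =>
      ∫ p in fundDomain n, pairIntegrand Ω k f q.1 q.2 p)
      (∫ p, starRingEnd ℂ (theta Ω k b p) * (f (proj p.1, p.2) * theta Ω k c p)
        ∂fundMeasure n) := by
  obtain ⟨M, hM, hbound⟩ := exists_gaussSection_bound hΩ k 1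
  have hbd : ∀ q : LatticeOver k b × LatticeOver k c, ∀ p ∈ fundDomain n,
      ‖pairIntegrand Ω k f q.1 q.2 p‖ ≤ ‖f‖ * (M q.1 * M q.2) := by
    intro q p hp
    have h1 := norm_le_one_of_mem_fundDomain hp
    refine (norm_pairIntegrand_le Ω k f q.1 q.2 p).trans ?_
    have h2 := hbound q.1 p h1
    have h3 := hbound q.2 p h1
    have h4 := (norm_nonneg _).trans h2
    gcongr
  have hM0 : ∀ l, 0 ≤ M l := fun l => (norm_nonneg _).trans (hbound l 0 (by simp))
  have hsum : Summable fun q : LatticeOver k b × LatticeOver k c => ‖f‖ * (M q.1 * M q.2) :=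
    ((hM.subtype _).mul_of_nonneg (hM.subtype _) (fun l => hM0 l.1) (fun l => hM0 l.1)).mul_left _
  have h1 := hasSum_integral_of_summable_integral_norm (μ := fundMeasure n)
    (F := fun (q : LatticeOver k b × LatticeOver k c) p => pairIntegrand Ω k f q.1 q.2 p)
    (fun q => (integrable_pairIntegrand hΩ k f q.1 q.2).mono_measure Measure.restrict_le_self)
    (by
      refine Summable.of_nonneg_of_le (fun q => integral_nonneg fun p => norm_nonneg _)
        (fun q => ?_) (hsum.mul_right ((fundMeasure n).real Set.univ))
      have h2 : ∀ᵐ p ∂fundMeasure n, ‖‖pairIntegrand Ω k f q.1 q.2 p‖‖ ≤ ‖f‖ * (M q.1 * M q.2) := by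
        refine (ae_restrict_iff' measurableSet_fundDomain).2 ?_
        filter_upwards with p hp
        rw [norm_norm]
        exact hbd q p hp
      exact (le_abs_self _).trans (norm_integral_le_of_norm_le_const h2))
  suffices h : ∀ p, starRingEnd ℂ (theta Ω k b p) * (f (proj p.1, p.2) * theta Ω k c p) =
      ∑' q : LatticeOver k b × LatticeOver k c, pairIntegrand Ω k f q.1 q.2 p by
    simp only [h]
    exact h1
  intro p
  have hg := (summable_gaussSection hΩ k p).norm
  have hb : Summable fun l : LatticeOver k b => ‖starRingEnd ℂ (gaussSection Ω k l p)‖ := by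
    simp only [RCLike.norm_conj]
    exact hg.comp_injective Subtype.val_injective
  have hc : Summable fun l : LatticeOver k c => ‖f (proj p.1, p.2) * gaussSection Ω k l p‖ := by
    simp only [norm_mul]
    exact (hg.comp_injective Subtype.val_injective).mul_left _
  simp only [theta, pairIntegrand]
  rw [Complex.conj_tsum, ← tsum_mul_left, tsum_mul_tsum_of_summable_norm hb hc]

open Classical in
/-- The matrix coefficients of multiplication by `f` in the basis of theta functions, unfolded. -/
theorem hasSum_theta_pairing (hΩ : Ω ∈ siegelUpperHalfSpace n) (k : ℕ+) (f : C(Total n, ℂ))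
    {b c : Base n} {l₀ : Fin n → ℤ} (hl : proj (latticePoint k l₀) = b) :
    HasSum (fun d : Fin n → ℤ =>
      if proj (latticePoint k d) = c - b then gaussPairing Ω k f l₀ (l₀ + d) else 0)
      (∫ p, starRingEnd ℂ (theta Ω k b p) * (f (proj p.1, p.2) * theta Ω k c p)
        ∂fundMeasure n) := by
  have h1 := (pairEquiv k (c := c) hl).hasSum_iff.2 (hasSum_integral_theta hΩ k f b c)
  -- Pairs `(l, l')` are grouped by their difference `d`; the inner sum over simultaneous
  -- translations completes the fundamental domain to the whole covering space.
  have h2 : HasSum (fun d : LatticeOver k (c - b) => gaussPairing Ω k f l₀ (l₀ + d.1))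
      (∫ p, starRingEnd ℂ (theta Ω k b p) * (f (proj p.1, p.2) * theta Ω k c p)
        ∂fundMeasure n) :=
    HasSum.prod_fiberwise h1 fun d => hasSum_gaussPairing hΩ k f l₀ (l₀ + d.1)
  have h3 := (hasSum_subtype_iff_indicator (f := fun d => gaussPairing Ω k f l₀ (l₀ + d))
    (s := {d : Fin n → ℤ | proj (latticePoint k d) = c - b})).1 h2
  refine h3.congr_fun fun d => ?_
  simp only [Set.indicator_apply, Set.mem_ofPred_eq]

end Unfolding

/-! ## Asymptotics of the Gaussian pairings -/

section Asymptotics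

variable {n : ℕ} {Ω : Matrix (Fin n) (Fin n) ℂ}

/-- An integral vector as a real vector. -/
def intVec (d : Fin n → ℤ) : Fin n → ℝ := fun j => (d j : ℝ)

theorem smul_latticePoint (k : ℕ+) (d : Fin n → ℤ) : (k : ℝ) • latticePoint k d = intVec d := by
  have hk : (k : ℝ) ≠ 0 := by exact_mod_cast k.ne_zero
  funext j
  simp only [Pi.smul_apply, latticePoint, intVec, smul_eq_mul]
  field_simp

/-- The factor multiplying the Fourier coefficients of `f` in the Gaussian pairing, where
`s² = 1/k` and `u` is the distance from the midpoint. -/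
def gaussFactor (Ω : Matrix (Fin n) (Fin n) ℂ) (d : Fin n → ℤ) (s : ℝ) (u : Fin n → ℝ) : ℂ :=
  Complex.exp (((-(s ^ 2 / 4 * imQuad Ω (intVec d)) : ℝ) : ℂ) -
    Complex.I * (((bilin Ω u (intVec d)).re : ℝ) : ℂ))

theorem norm_gaussFactor_le (hΩ : Ω ∈ siegelUpperHalfSpace n) (d : Fin n → ℤ) (s : ℝ)
    (u : Fin n → ℝ) : ‖gaussFactor Ω d s u‖ ≤ 1 := by
  rw [gaussFactor, Complex.norm_exp, Real.exp_le_one_iff, Complex.sub_re, Complex.ofReal_re,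
    Complex.I_mul_re, Complex.ofReal_im, neg_zero, sub_zero]
  have := imQuad_nonneg hΩ (intVec d)
  have : 0 ≤ s ^ 2 / 4 * imQuad Ω (intVec d) := by positivity
  linarith

theorem gaussFactor_continuous (Ω : Matrix (Fin n) (Fin n) ℂ) (d : Fin n → ℤ) :
    Continuous fun p : ℝ × (Fin n → ℝ) => gaussFactor Ω d p.1 p.2 := by
  have h : Continuous fun u : Fin n → ℝ => bilin Ω u (intVec d) := by
    simp only [bilin_eq_sum]
    fun_prop
  unfold gaussFactor
  have h2 : Continuous fun p : ℝ × (Fin n → ℝ) => (bilin Ω p.2 (intVec d)).re :=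
    Complex.continuous_re.comp (h.comp continuous_snd)
  fun_prop

theorem gaussFactor_zero (Ω : Matrix (Fin n) (Fin n) ℂ) (d : Fin n → ℤ) :
    gaussFactor Ω d 0 0 = 1 := by
  simp [gaussFactor, bilin_eq_sum]

/-- Measured from the midpoint of the two centres, the cross terms in `Im Ω` cancel. A centred real
Gaussian in `u`, a damping by the separation `δ`, and a phase containing `Re Ω` remain. -/
theorem gauss_exponent (hΩ : Ω ∈ siegelUpperHalfSpace n) (k : ℕ+) (u δ : Fin n → ℝ) :
    starRingEnd ℂ (Complex.I * (k : ℂ) / 2 *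
        bilin Ω (u + (1 / 2 : ℝ) • δ) (u + (1 / 2 : ℝ) • δ)) +
      Complex.I * (k : ℂ) / 2 * bilin Ω (u - (1 / 2 : ℝ) • δ) (u - (1 / 2 : ℝ) • δ) =
    ((-(k : ℝ) * imQuad Ω u : ℝ) : ℂ) + (((-((k : ℝ) / 4 * imQuad Ω δ) : ℝ) : ℂ) -
      Complex.I * (((k : ℝ) * (bilin Ω u δ).re : ℝ) : ℂ)) := by
  have h1 : bilin Ω (u + (1 / 2 : ℝ) • δ) (u + (1 / 2 : ℝ) • δ) =
      bilin Ω u u + bilin Ω u δ + ((1 / 4 : ℝ) : ℂ) * bilin Ω δ δ := by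
    rw [bilin_add_left, bilin_add_right, bilin_add_right, bilin_smul_left, bilin_smul_left,
      bilin_smul_right, bilin_smul_right, bilin_comm hΩ δ u]
    push_cast
    ring
  have h2 : bilin Ω (u - (1 / 2 : ℝ) • δ) (u - (1 / 2 : ℝ) • δ) =
      bilin Ω u u - bilin Ω u δ + ((1 / 4 : ℝ) : ℂ) * bilin Ω δ δ := by
    rw [bilin_sub_sub hΩ, bilin_smul_left, bilin_smul_left, bilin_smul_right, bilin_comm hΩ δ u]
    push_cast
    ring
  have h3 : Complex.I * (k : ℂ) / 2 = Complex.I * (((k : ℝ) / 2 : ℝ) : ℂ) := by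
    push_cast
    ring
  rw [h1, h2, h3, ← bilin_im, ← bilin_im, map_mul, map_mul, Complex.conj_ofReal, Complex.conj_I,
    map_add, map_add, map_mul, Complex.conj_ofReal]
  apply Complex.ext
  · simp
    ring
  · simp
    ring

/-- The characters combine to the one of index `d`, so the fibre integral is the Fourier coefficient
of index `-d`. Since `k` times the separation is `d`, damping and phase take the form of
`gaussFactor` with `s = k^{-1/2}`. -/
theorem integral_pairIntegrand_fiber (hΩ : Ω ∈ siegelUpperHalfSpace n) (k : ℕ+)
    (f : C(Total n, ℂ)) (l d : Fin n → ℤ) (u : Fin n → ℝ) :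
    ∫ θ, pairIntegrand Ω k f l (l + d)
      (latticePoint k l + (1 / 2 : ℝ) • latticePoint k d + u, θ) =
    (((∫ x : Fin n → ℝ, Real.exp (-(k : ℝ) * imQuad Ω x))⁻¹ : ℝ) : ℂ) *
      ((Real.exp (-(k : ℝ) * imQuad Ω u) : ℂ) * (gaussFactor Ω d (Real.sqrt k)⁻¹ u *
        fourierCoef (-d) fun θ =>
          f (proj (latticePoint k l + (1 / 2 : ℝ) • latticePoint k d + u), θ))) := by
  have hk : (0 : ℝ) < k := by exact_mod_cast k.pos
  set mid := latticePoint k l + (1 / 2 : ℝ) • latticePoint k d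
  have e1 : mid + u - latticePoint k l = u + (1 / 2 : ℝ) • latticePoint k d := by
    simp only [mid]
    abel
  have e2 : mid + u - latticePoint k (l + d) = u - (1 / 2 : ℝ) • latticePoint k d := by
    rw [latticePoint_add]
    simp only [mid]
    have : latticePoint k d = (1 / 2 : ℝ) • latticePoint k d + (1 / 2 : ℝ) • latticePoint k d := by
      rw [← add_smul]
      norm_num
    nth_rewrite 2 [this]
    abel
  have e3 : Complex.exp (starRingEnd ℂ (Complex.I * (k : ℂ) / 2 * bilin Ω
      (u + (1 / 2 : ℝ) • latticePoint k d) (u + (1 / 2 : ℝ) • latticePoint k d))) *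
      Complex.exp (Complex.I * (k : ℂ) / 2 * bilin Ω (u - (1 / 2 : ℝ) • latticePoint k d)
        (u - (1 / 2 : ℝ) • latticePoint k d)) =
      (Real.exp (-(k : ℝ) * imQuad Ω u) : ℂ) * gaussFactor Ω d (Real.sqrt k)⁻¹ u := by
    rw [← Complex.exp_add, gauss_exponent hΩ, Complex.exp_add, gaussFactor, Complex.ofReal_exp]
    congr 5
    · rw [← smul_latticePoint k d, imQuad_smul, inv_pow, Real.sq_sqrt hk.le]
      field_simp
    · rw [← smul_latticePoint k d, bilin_smul_right, Complex.re_ofReal_mul]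
  have h1 : ∀ θ, pairIntegrand Ω k f l (l + d) (mid + u, θ) = ((thetaAmp Ω k ^ 2 : ℝ) : ℂ) *
      ((Real.exp (-(k : ℝ) * imQuad Ω u) : ℂ) * gaussFactor Ω d (Real.sqrt k)⁻¹ u) *
        (char d θ * f (proj (mid + u), θ)) := by
    intro θ
    rw [pairIntegrand, gaussSection_eq, gaussSection_eq, map_mul, map_mul, ← char_neg,
      Complex.conj_ofReal, ← Complex.exp_conj, ← e3]
    simp only [e1, e2, char_add]
    have h2 := char_neg_mul_char l θ
    push_cast
    linear_combination ((thetaAmp Ω k : ℂ) ^ 2 * Complex.exp (starRingEnd ℂ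
      (Complex.I * (k : ℂ) / 2 * bilin Ω (u + (1 / 2 : ℝ) • latticePoint k d)
        (u + (1 / 2 : ℝ) • latticePoint k d))) * Complex.exp (Complex.I * (k : ℂ) / 2 *
          bilin Ω (u - (1 / 2 : ℝ) • latticePoint k d) (u - (1 / 2 : ℝ) • latticePoint k d)) *
        char d θ * f (proj (mid + u), θ)) * h2
  simp only [h1]
  rw [integral_const_mul, volume_torus, integral_smul_measure,
    ENNReal.toReal_ofReal (by positivity), ← thetaAmp_sq hΩ, Complex.real_smul, fourierCoef,
    neg_neg]
  push_cast
  ring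

theorem gaussPairing_eq (hΩ : Ω ∈ siegelUpperHalfSpace n) (k : ℕ+) (f : C(Total n, ℂ))
    (l d : Fin n → ℤ) : gaussPairing Ω k f l (l + d) =
    (((∫ x : Fin n → ℝ, Real.exp (-(k : ℝ) * imQuad Ω x))⁻¹ : ℝ) : ℂ) * ∫ u : Fin n → ℝ,
      (Real.exp (-(k : ℝ) * imQuad Ω u) : ℂ) * (gaussFactor Ω d (Real.sqrt k)⁻¹ u *
        fourierCoef (-d) fun θ =>
          f (proj (latticePoint k l + (1 / 2 : ℝ) • latticePoint k d + u), θ)) := by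
  have h1 := integral_prod (μ := (volume : Measure (Fin n → ℝ)))
    (ν := (volume : Measure (Torus n))) _ (integrable_pairIntegrand hΩ k f l (l + d))
  have h2 := integral_add_left_eq_self (μ := (volume : Measure (Fin n → ℝ)))
    (fun x => ∫ θ, pairIntegrand Ω k f l (l + d) (x, θ))
    (latticePoint k l + (1 / 2 : ℝ) • latticePoint k d)
  rw [gaussPairing, Measure.volume_eq_prod, h1, ← h2, ← integral_const_mul]
  exact integral_congr_ae (Filter.Eventually.of_forall fun u =>
    integral_pairIntegrand_fiber hΩ k f l d u)

/-- Rescaling of a Gaussian average. -/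
theorem gaussian_average_rescale (Ω : Matrix (Fin n) (Fin n) ℂ) (k : ℕ+)
    (G : (Fin n → ℝ) → ℂ) :
    (((∫ x : Fin n → ℝ, Real.exp (-(k : ℝ) * imQuad Ω x))⁻¹ : ℝ) : ℂ) *
      (∫ u : Fin n → ℝ, (Real.exp (-(k : ℝ) * imQuad Ω u) : ℂ) * G u) =
    (((∫ x : Fin n → ℝ, Real.exp (-imQuad Ω x))⁻¹ : ℝ) : ℂ) *
      ∫ v : Fin n → ℝ, (Real.exp (-imQuad Ω v) : ℂ) * G ((Real.sqrt k)⁻¹ • v) := by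
  have hk : (0 : ℝ) < k := by exact_mod_cast k.pos
  set s := (Real.sqrt k)⁻¹ with hs
  have hs0 : 0 < s := by positivity
  have hsq : ∀ v : Fin n → ℝ, -(k : ℝ) * imQuad Ω (s • v) = -imQuad Ω v := by
    intro v
    rw [imQuad_smul, hs, inv_pow, Real.sq_sqrt hk.le]
    field_simp
  have h1 := Measure.integral_comp_smul (volume : Measure (Fin n → ℝ))
    (fun x => Real.exp (-(k : ℝ) * imQuad Ω x)) s
  have h2 := Measure.integral_comp_smul (volume : Measure (Fin n → ℝ))
    (fun u => (Real.exp (-(k : ℝ) * imQuad Ω u) : ℂ) * G u) s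
  simp only [hsq] at h1 h2
  rw [h1, h2, smul_eq_mul, Complex.real_smul]
  -- Both integrals acquire the same Jacobian, which drops out of the quotient.
  have hc : ((|(s ^ Module.finrank ℝ (Fin n → ℝ))⁻¹| : ℝ) : ℂ) ≠ 0 := by
    have : (s ^ Module.finrank ℝ (Fin n → ℝ))⁻¹ ≠ 0 := by positivity
    exact_mod_cast abs_ne_zero.2 this
  generalize |(s ^ Module.finrank ℝ (Fin n → ℝ))⁻¹| = c at hc
  push_cast
  field_simp

theorem gaussPairing_eq_average (hΩ : Ω ∈ siegelUpperHalfSpace n) (k : ℕ+) (f : C(Total n, ℂ))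
    (l d : Fin n → ℤ) : gaussPairing Ω k f l (l + d) =
    (((∫ x : Fin n → ℝ, Real.exp (-imQuad Ω x))⁻¹ : ℝ) : ℂ) * ∫ v : Fin n → ℝ,
      (Real.exp (-imQuad Ω v) : ℂ) *
        (gaussFactor Ω d (Real.sqrt k)⁻¹ ((Real.sqrt k)⁻¹ • v) * fourierCoef (-d) fun θ =>
          f (proj (latticePoint k l + (1 / 2 : ℝ) • latticePoint k d +
            (Real.sqrt k)⁻¹ • v), θ)) := by
  rw [gaussPairing_eq hΩ, gaussian_average_rescale]

theorem integrable_exp_neg_imQuad (hΩ : Ω ∈ siegelUpperHalfSpace n) :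
    Integrable fun x : Fin n → ℝ => Real.exp (-imQuad Ω x) := by
  simpa using integrable_exp_imQuad hΩ one_pos

theorem integral_exp_neg_imQuad_pos (hΩ : Ω ∈ siegelUpperHalfSpace n) :
    0 < ∫ x : Fin n → ℝ, Real.exp (-imQuad Ω x) := integral_exp_pos (integrable_exp_neg_imQuad hΩ)

/-- An average over a probability measure, with a factor of modulus at most one. The bound is
independent of `k` and `l`, as dominated convergence requires. -/
theorem norm_gaussPairing_le (hΩ : Ω ∈ siegelUpperHalfSpace n) (k : ℕ+) (f : C(Total n, ℂ))
    (l d : Fin n → ℤ) {C : ℝ} (hC : ∀ b : Base n, ‖fourierCoef (-d) fun θ => f (b, θ)‖ ≤ C) :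
    ‖gaussPairing Ω k f l (l + d)‖ ≤ C := by
  have hZ := integral_exp_neg_imQuad_pos hΩ
  have hC0 : 0 ≤ C := (norm_nonneg _).trans (hC 0)
  rw [gaussPairing_eq_average hΩ, norm_mul, Complex.norm_real, norm_inv,
    Real.norm_of_nonneg hZ.le, inv_mul_le_iff₀ hZ, ← integral_mul_const]
  refine norm_integral_le_of_norm_le ((integrable_exp_neg_imQuad hΩ).mul_const C)
    (Filter.Eventually.of_forall fun v => ?_)
  rw [norm_mul, norm_mul, Complex.norm_real, Real.norm_of_nonneg (Real.exp_pos _).le]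
  gcongr
  exact (mul_le_mul (norm_gaussFactor_le hΩ _ _ _) (hC _) (norm_nonneg _) zero_le_one).trans
    (one_mul C).le

/-- The translate of a function on `X` in the base direction. -/
def translate (f : C(Total n, ℂ)) : C(Fin n → ℝ, C(Total n, ℂ)) :=
  ContinuousMap.curry
    ⟨fun p : (Fin n → ℝ) × Total n => f (p.2.1 + proj p.1, p.2.2), by
      have := proj_continuous (n := n)
      fun_prop⟩

theorem translate_apply (f : C(Total n, ℂ)) (u : Fin n → ℝ) (b : Base n) (θ : Torus n) :
    translate f u (b, θ) = f (b + proj u, θ) := rfl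

theorem translate_zero (f : C(Total n, ℂ)) : translate f 0 = f := by
  ext ⟨b, θ⟩
  rw [translate_apply]
  have : proj (0 : Fin n → ℝ) = 0 := by
    funext j
    simp [proj]
  rw [this, add_zero]

theorem norm_translate_le (f : C(Total n, ℂ)) (u : Fin n → ℝ) : ‖translate f u‖ ≤ ‖f‖ :=
  (ContinuousMap.norm_le _ (norm_nonneg f)).2 fun ⟨_, _⟩ => f.norm_coe_le_norm _

/-- The error of replacing `f`, translated by `u`, by its value at the midpoint. -/
def gaussDefect (Ω : Matrix (Fin n) (Fin n) ℂ) (f : C(Total n, ℂ)) (d : Fin n → ℤ) (s : ℝ)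
    (u : Fin n → ℝ) : ℝ := ‖gaussFactor Ω d s u • translate f u - f‖

theorem gaussDefect_nonneg (Ω : Matrix (Fin n) (Fin n) ℂ) (f : C(Total n, ℂ)) (d : Fin n → ℤ)
    (s : ℝ) (u : Fin n → ℝ) : 0 ≤ gaussDefect Ω f d s u := norm_nonneg _

theorem gaussDefect_continuous (Ω : Matrix (Fin n) (Fin n) ℂ) (f : C(Total n, ℂ))
    (d : Fin n → ℤ) : Continuous fun p : ℝ × (Fin n → ℝ) => gaussDefect Ω f d p.1 p.2 :=
  (((gaussFactor_continuous Ω d).smul ((translate f).continuous.comp continuous_snd)).sub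
    continuous_const).norm

theorem gaussDefect_le (hΩ : Ω ∈ siegelUpperHalfSpace n) (f : C(Total n, ℂ)) (d : Fin n → ℤ)
    (s : ℝ) (u : Fin n → ℝ) : gaussDefect Ω f d s u ≤ 2 * ‖f‖ := by
  have h : 2 * ‖f‖ = ‖f‖ + ‖f‖ := two_mul _
  refine (norm_sub_le _ _).trans ?_
  rw [norm_smul, h]
  gcongr
  exact (mul_le_mul (norm_gaussFactor_le hΩ _ _ _) (norm_translate_le f u) (norm_nonneg _)
    zero_le_one).trans (one_mul _).le

/-- The average of `gaussDefect`. -/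
def gaussError (Ω : Matrix (Fin n) (Fin n) ℂ) (f : C(Total n, ℂ)) (d : Fin n → ℤ) (s : ℝ) : ℝ :=
  (∫ x : Fin n → ℝ, Real.exp (-imQuad Ω x))⁻¹ *
    ∫ v : Fin n → ℝ, Real.exp (-imQuad Ω v) * gaussDefect Ω f d s (s • v)

theorem gaussError_nonneg (Ω : Matrix (Fin n) (Fin n) ℂ) (f : C(Total n, ℂ)) (d : Fin n → ℤ)
    (s : ℝ) : 0 ≤ gaussError Ω f d s :=
  mul_nonneg (inv_nonneg.2 (integral_nonneg fun _ => (Real.exp_pos _).le))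
    (integral_nonneg fun _ => mul_nonneg (Real.exp_pos _).le (norm_nonneg _))

theorem continuous_gaussIntegrand (Ω : Matrix (Fin n) (Fin n) ℂ) (f : C(Total n, ℂ))
    (d : Fin n → ℤ) : Continuous fun p : ℝ × (Fin n → ℝ) =>
      Real.exp (-imQuad Ω p.2) * gaussDefect Ω f d p.1 (p.1 • p.2) := by
  have h1 := imQuad_continuous Ω
  have h2 : Continuous fun p : ℝ × (Fin n → ℝ) => gaussDefect Ω f d p.1 (p.1 • p.2) :=
    (gaussDefect_continuous Ω f d).comp (f := fun p : ℝ × (Fin n → ℝ) => (p.1, p.1 • p.2))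
      (by fun_prop)
  fun_prop

theorem norm_gaussIntegrand_le (hΩ : Ω ∈ siegelUpperHalfSpace n) (f : C(Total n, ℂ))
    (d : Fin n → ℤ) (s : ℝ) (v : Fin n → ℝ) :
    ‖Real.exp (-imQuad Ω v) * gaussDefect Ω f d s (s • v)‖ ≤
      Real.exp (-imQuad Ω v) * (2 * ‖f‖) := by
  rw [norm_mul, Real.norm_of_nonneg (Real.exp_pos _).le, Real.norm_of_nonneg (gaussDefect_nonneg _ _ _ _ _)]
  gcongr
  exact gaussDefect_le hΩ f d s _

/-- Translation of `f` is continuous for the sup norm, so the defect is jointly continuous and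
dominated by `2‖f‖`. Continuity at `s = 0`, where the error vanishes, is the semiclassical limit. -/
theorem gaussError_continuous (hΩ : Ω ∈ siegelUpperHalfSpace n) (f : C(Total n, ℂ))
    (d : Fin n → ℤ) : Continuous (gaussError Ω f d) := by
  have hc := continuous_gaussIntegrand Ω f d
  refine continuous_const.mul (continuous_of_dominated
    (bound := fun v => Real.exp (-imQuad Ω v) * (2 * ‖f‖)) (fun s => ?_)
    (fun s => Filter.Eventually.of_forall fun v => norm_gaussIntegrand_le hΩ f d s v)
    ((integrable_exp_neg_imQuad hΩ).mul_const _) (Filter.Eventually.of_forall fun v => ?_))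
  · exact (hc.comp (Continuous.prodMk_right s)).aestronglyMeasurable
  · exact hc.comp (Continuous.prodMk_left v)

theorem gaussError_zero (Ω : Matrix (Fin n) (Fin n) ℂ) (f : C(Total n, ℂ)) (d : Fin n → ℤ) :
    gaussError Ω f d 0 = 0 := by
  simp [gaussError, gaussDefect, gaussFactor_zero, translate_zero]

theorem tendsto_gaussError (hΩ : Ω ∈ siegelUpperHalfSpace n) (f : C(Total n, ℂ))
    (d : Fin n → ℤ) : Filter.Tendsto (fun k : ℕ+ => gaussError Ω f d (Real.sqrt k)⁻¹)
      Filter.atTop (nhds 0) := by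
  have h1 := (gaussError_continuous hΩ f d).tendsto 0
  rw [gaussError_zero] at h1
  have h3 : Filter.Tendsto (fun k : ℕ+ => ((k : ℕ) : ℝ)) Filter.atTop Filter.atTop :=
    tendsto_natCast_atTop_atTop.comp tendsto_PNat_val_atTop_atTop
  exact h1.comp (tendsto_inv_atTop_zero.comp (Real.tendsto_sqrt_atTop.comp h3))

/-- The pairing of `Ψ_l` and `f Ψ_{l+d}` is approximated by a Fourier coefficient of `f` at the
midpoint. -/
theorem norm_gaussPairing_sub_le (hΩ : Ω ∈ siegelUpperHalfSpace n) (k : ℕ+) (f : C(Total n, ℂ))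
    (l d : Fin n → ℤ) : ‖gaussPairing Ω k f l (l + d) - fourierCoef (-d) fun θ =>
      f (proj (latticePoint k l + (1 / 2 : ℝ) • latticePoint k d), θ)‖ ≤
      gaussError Ω f d (Real.sqrt k)⁻¹ := by
  have hZ := integral_exp_neg_imQuad_pos hΩ
  have hI := integrable_exp_neg_imQuad hΩ
  have hZ' : ((∫ x : Fin n → ℝ, Real.exp (-imQuad Ω x) : ℝ) : ℂ) ≠ 0 := by
    exact_mod_cast hZ.ne'
  set s := (Real.sqrt k)⁻¹
  set mid := latticePoint k l + (1 / 2 : ℝ) • latticePoint k d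
  set A := fourierCoef (-d) fun θ => f (proj mid, θ)
  set G : (Fin n → ℝ) → ℂ := fun v => gaussFactor Ω d s (s • v) *
    fourierCoef (-d) fun θ => f (proj (mid + s • v), θ)
  have hfc : ∀ b : Base n, Continuous fun θ : Torus n => f (b, θ) := fun b => by fun_prop
  -- `G v - A` is one Fourier coefficient of the function whose sup norm is the defect; the estimate
  -- is therefore uniform in the midpoint.
  have hpt : ∀ v, ‖G v - A‖ ≤ gaussDefect Ω f d s (s • v) := by
    intro v
    have h1 : G v - A = fourierCoef (-d) fun θ =>
        gaussFactor Ω d s (s • v) * f (proj (mid + s • v), θ) - f (proj mid, θ) := by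
      rw [fourierCoef_sub (-d)
        (g := fun θ => gaussFactor Ω d s (s • v) * f (proj (mid + s • v), θ))
        (continuous_const.mul (hfc _)) (hfc _), fourierCoef_const_mul]
    rw [h1]
    refine norm_fourierCoef_le _ fun θ => ?_
    have h2 : ‖(gaussFactor Ω d s (s • v) • translate f (s • v) - f) (proj mid, θ)‖ ≤
      gaussDefect Ω f d s (s • v) := ContinuousMap.norm_coe_le_norm _ _
    simpa only [ContinuousMap.sub_apply, ContinuousMap.smul_apply, smul_eq_mul, translate_apply,
      ← proj_add] using h2
  have hGc : Continuous G := by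
    have h1 : Continuous fun v : Fin n → ℝ => gaussFactor Ω d s (s • v) :=
      (gaussFactor_continuous Ω d).comp (f := fun v => (s, s • v)) (by fun_prop)
    refine h1.mul ?_
    refine continuous_of_dominated (bound := fun _ => ‖f‖) (fun v => ?_)
      (fun v => Filter.Eventually.of_forall fun θ => ?_) (integrable_const _)
      (Filter.Eventually.of_forall fun θ => ?_)
    · exact ((char_continuous _).mul (hfc _)).aestronglyMeasurable
    · rw [norm_mul, norm_char, one_mul]
      exact f.norm_coe_le_norm _
    · have := proj_continuous (n := n)
      fun_prop
  have hGi : Integrable fun v => (Real.exp (-imQuad Ω v) : ℂ) * (G v - A) := by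
    refine (hI.mul_const (2 * ‖f‖)).mono' ?_ (Filter.Eventually.of_forall fun v => ?_)
    · have := imQuad_continuous Ω
      exact Continuous.aestronglyMeasurable (by fun_prop)
    · rw [norm_mul, Complex.norm_real, Real.norm_of_nonneg (Real.exp_pos _).le]
      gcongr
      exact (hpt v).trans (gaussDefect_le hΩ f d s _)
  have hI' : Integrable fun v => (Real.exp (-imQuad Ω v) : ℂ) * A := hI.ofReal.mul_const A
  have h3 : gaussPairing Ω k f l (l + d) - A =
      (((∫ x : Fin n → ℝ, Real.exp (-imQuad Ω x))⁻¹ : ℝ) : ℂ) *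
        ∫ v : Fin n → ℝ, (Real.exp (-imQuad Ω v) : ℂ) * (G v - A) := by
    have h4 : ∫ v : Fin n → ℝ, (Real.exp (-imQuad Ω v) : ℂ) * G v =
        (∫ v : Fin n → ℝ, (Real.exp (-imQuad Ω v) : ℂ) * (G v - A)) +
          ∫ v : Fin n → ℝ, (Real.exp (-imQuad Ω v) : ℂ) * A := by
      rw [← integral_add hGi hI']
      congr 1
      funext v
      ring
    rw [gaussPairing_eq_average hΩ]
    change _ * (∫ v : Fin n → ℝ, (Real.exp (-imQuad Ω v) : ℂ) * G v) - A = _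
    rw [h4, integral_mul_const, integral_complex_ofReal]
    push_cast
    field_simp
    ring
  rw [h3, norm_mul, gaussError, Complex.norm_real, norm_inv, Real.norm_of_nonneg hZ.le]
  refine mul_le_mul_of_nonneg_left ?_ (inv_nonneg.2 hZ.le)
  refine norm_integral_le_of_norm_le ?_ (Filter.Eventually.of_forall fun v => ?_)
  · refine (hI.mul_const (2 * ‖f‖)).mono' ?_ (Filter.Eventually.of_forall fun v =>
      norm_gaussIntegrand_le hΩ f d s v)
    exact ((continuous_gaussIntegrand Ω f d).comp
      (Continuous.prodMk_right s)).aestronglyMeasurable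
  · rw [norm_mul, Complex.norm_real, Real.norm_of_nonneg (Real.exp_pos _).le]
    gcongr
    exact hpt v

end Asymptotics

/-! ## The deformation quantization in terms of Fourier coefficients -/

section Pairing

variable {n : ℕ}

/-- The matrix coefficients of `φ(f)` are Fourier coefficients of `f` over the midpoint; they do
not depend on the horizontal distribution. -/
theorem AffinePath.pairing_frame {U : Set (Base n)} {k : ℕ+} {b c : bohrSommerfeld n k}
    (γ : AffinePath U c.1 b.1) (P : Matrix (Fin n) (Fin n) ℝ) (f : C(Total n, ℂ)) :
    ∃ d : Fin n → ℤ, latticePoint k d = -γ.dir ∧ γ.pairing P k f (frame b) (frame c) =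
      fourierCoef (-d) fun θ => f (proj (γ.start + (1 / 2 : ℝ) • γ.dir), θ) := by
  have hk : (k : ℝ) ≠ 0 := by exact_mod_cast k.ne_zero
  set l : Fin n → ℤ := fun j => round ((k : ℝ) * (γ.start + γ.dir) j) with hl
  set l' : Fin n → ℤ := fun j => round ((k : ℝ) * γ.start j) with hl'
  have e : ∀ j, (l j : ℝ) = k * (γ.start j + γ.dir j) := by
    intro j
    obtain ⟨m, hm⟩ := bohrSommerfeld_integral b.2 γ.endLift j
    change (k : ℝ) * (γ.start + γ.dir) j = m at hm
    rw [hl]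
    simp only [hm, round_intCast]
    rw [← hm, Pi.add_apply]
  have e' : ∀ j, (l' j : ℝ) = k * γ.start j := by
    intro j
    obtain ⟨m, hm⟩ := bohrSommerfeld_integral c.2 γ.startLift j
    change (k : ℝ) * γ.start j = m at hm
    rw [hl']
    simp only [hm, round_intCast]
  refine ⟨l' - l, ?_, ?_⟩
  · funext j
    simp only [latticePoint, Pi.sub_apply, Pi.neg_apply]
    push_cast
    rw [e, e']
    field_simp
    ring
  set η := γ.drift P
  set mid := γ.start + (1 / 2 : ℝ) • γ.dir with hmid
  -- The mean of an affine function on `[0,1]` is its value at `1/2`.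
  have hint : ∫ t in (0 : ℝ)..1, (γ.start + t • γ.dir) ⬝ᵥ η = mid ⬝ᵥ η := by
    simp only [hmid, add_dotProduct, smul_dotProduct, smul_eq_mul]
    rw [intervalIntegral.integral_add (by simp) (by
      exact Continuous.intervalIntegrable (by fun_prop) _ _)]
    simp
  -- After recentring at the midpoint, the two frames contribute `exp(-i⟨l + l', η/2⟩)`, and `l + l'
  -- = 2k · mid`. This cancels the transport phase, hence all dependence on `P`.
  have hphase : Complex.exp (Complex.I * (k : ℂ) * ((mid ⬝ᵥ η : ℝ) : ℂ)) *
      (char (-l) (tor ((1 / 2 : ℝ) • η)) * char l' (tor (-((1 / 2 : ℝ) • η)))) = 1 := by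
    rw [char_tor, char_tor, ← Complex.exp_add, ← Complex.exp_add, Complex.exp_eq_one_iff]
    refine ⟨0, ?_⟩
    have h1 : (k : ℂ) * ((mid ⬝ᵥ η : ℝ) : ℂ) =
        ∑ j, ((l j : ℂ) + l' j) * ((1 / 2 : ℝ) * η j : ℝ) := by
      have h2 : (k : ℝ) * (mid ⬝ᵥ η) = ∑ j, ((l j : ℝ) + l' j) * ((1 / 2 : ℝ) * η j) := by
        simp only [dotProduct, Finset.mul_sum]
        refine Finset.sum_congr rfl fun j _ => ?_
        rw [e, e', hmid, Pi.add_apply, Pi.smul_apply, smul_eq_mul]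
        ring
      exact_mod_cast congrArg (fun r : ℝ => (r : ℂ)) h2
    rw [mul_assoc, h1, ← mul_add, ← mul_add, ← Finset.sum_add_distrib, ← Finset.sum_add_distrib]
    simp only [Int.cast_zero, zero_mul, mul_eq_zero, Complex.I_ne_zero, false_or]
    refine Finset.sum_eq_zero fun j _ => ?_
    simp only [Pi.neg_apply, Pi.smul_apply, smul_eq_mul]
    push_cast
    ring
  have hfun : ∀ θ, starRingEnd ℂ ((frame b).val γ.endLift θ) *
      γ.transport P k (fun τ => γ.midFun P f τ * (frame c).val γ.startLift τ) θ =
      char (-l) θ * (Complex.exp (Complex.I * (k : ℂ) * ((mid ⬝ᵥ η : ℝ) : ℂ)) *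
        (f (proj mid, θ - tor η + tor ((1 / 2 : ℝ) • η)) * char l' (θ - tor η))) := by
    intro θ
    rw [char_neg, ← hint]
    rfl
  rw [AffinePath.pairing]
  simp only [hfun]
  rw [← integral_add_right_eq_self (μ := haarTorus n) _ (tor ((1 / 2 : ℝ) • η)), fourierCoef]
  congr 1
  funext θ
  have hη : tor η = tor ((1 / 2 : ℝ) • η) + tor ((1 / 2 : ℝ) • η) := by
    rw [← tor_add, ← add_smul]
    norm_num
  have h1 : θ + tor ((1 / 2 : ℝ) • η) - tor η = θ + tor (-((1 / 2 : ℝ) • η)) := by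
    rw [hη, tor_neg]
    abel
  have h2 : θ + tor (-((1 / 2 : ℝ) • η)) + tor ((1 / 2 : ℝ) • η) = θ := by
    rw [tor_neg]
    abel
  have h3 : - -(l' - l) = -l + l' := by abel
  rw [h1, h2, h3, char_add, char_apply_add, char_apply_add]
  linear_combination (char (-l) θ * f (proj mid, θ) * char l' θ) * hphase

/-- The lifted path may start in another sheet over `U`. The times at which its translate by `m`
lies in `V` form open sets, disjoint by injectivity and covering `[0,1]`; connectedness leaves a
single `m`. -/
theorem AffinePath.exists_translate {V : Set (Fin n → ℝ)} (hV : IsOpen V)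
    (hinj : Set.InjOn proj V) {c b : Base n} (γ : AffinePath (proj '' V) c b) :
    ∃ m : Fin n → ℤ, (γ.start + fun j => (m j : ℝ)) ∈ V ∧
      (γ.start + γ.dir + fun j => (m j : ℝ)) ∈ V := by
  set T : (Fin n → ℤ) → Set ℝ := fun m =>
    {t | γ.start + t • γ.dir + (fun j => (m j : ℝ)) ∈ V} with hT
  have hopen : ∀ m, IsOpen (T m) := fun m => hV.preimage (by fun_prop)
  have hcov : ∀ t ∈ Set.Icc (0 : ℝ) 1, ∃ m, t ∈ T m := by
    intro t ht
    obtain ⟨y, hy, hyt⟩ := γ.mem t ht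
    obtain ⟨m, hm⟩ := proj_eq_iff.1 hyt.symm
    exact ⟨m, show _ ∈ V by rwa [← hm]⟩
  have huniq : ∀ t m m', t ∈ T m → t ∈ T m' → m = m' := by
    intro t m m' h h'
    have h1 := hinj h h' (by rw [proj_add_int, proj_add_int])
    funext j
    have h2 := congrFun h1 j
    simp only [Pi.add_apply, add_right_inj] at h2
    exact_mod_cast h2
  obtain ⟨m, hm⟩ := hcov 0 (by simp)
  have hsub : Set.Icc (0 : ℝ) 1 ⊆ T m := by
    refine isPreconnected_Icc.subset_left_of_subset_union (hopen m)
      (isOpen_iUnion fun m' : {m' // m' ≠ m} => hopen m') ?_ ?_ ⟨0, by simp, hm⟩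
    · refine Set.disjoint_left.2 fun t h h' => ?_
      obtain ⟨m', hm'⟩ := Set.mem_iUnion.1 h'
      exact m'.2 (huniq t _ _ hm' h)
    · intro t ht
      obtain ⟨m', hm'⟩ := hcov t ht
      by_cases h : m' = m
      · exact Or.inl (h ▸ hm')
      · exact Or.inr (Set.mem_iUnion.2 ⟨⟨m', h⟩, hm'⟩)
  refine ⟨m, ?_, ?_⟩
  · simpa [hT] using hm
  · simpa [hT] using hsub (show (1 : ℝ) ∈ Set.Icc (0 : ℝ) 1 by simp)

/-- Affine paths in a set with a convex chart are determined by their end points. -/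
theorem AffinePath.dir_eq {U : Set (Base n)} (hU : HasConvexChart U) {c b : Base n}
    (γ γ' : AffinePath U c b) : γ.dir = γ'.dir := by
  obtain ⟨V, hV, -, hinj, rfl⟩ := hU
  obtain ⟨m, h1, h2⟩ := γ.exists_translate hV hinj
  obtain ⟨m', h1', h2'⟩ := γ'.exists_translate hV hinj
  have e1 := hinj h1 h1' (by rw [proj_add_int, proj_add_int, γ.start_eq, γ'.start_eq])
  have e2 := hinj h2 h2' (by rw [proj_add_int, proj_add_int, γ.end_eq, γ'.end_eq])
  calc γ.dir = (γ.start + γ.dir + fun j => (m j : ℝ)) - (γ.start + fun j => (m j : ℝ)) := by abel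
    _ = (γ'.start + γ'.dir + fun j => (m' j : ℝ)) - (γ'.start + fun j => (m' j : ℝ)) := by
      rw [e1, e2]
    _ = γ'.dir := by abel

theorem dist_proj_le (x y : Fin n → ℝ) : dist (proj x) (proj y) ≤ ‖x - y‖ := by
  refine (dist_pi_le_iff (norm_nonneg _)).2 fun j => ?_
  rw [dist_eq_norm, proj, proj, ← AddCircle.coe_sub]
  exact (QuotientAddGroup.norm_mk_le_norm (S := AddSubgroup.zmultiples (1 : ℝ))).trans (norm_le_pi_norm (x - y) j)

/-- Points with sufficiently close lifts are close, and the affine path between them is the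
projection of the segment between the lifts. -/
theorem exists_close_radius (𝒰 : AdmissibleCover n) : ∃ ε > 0, ∀ x y : Fin n → ℝ, ‖y - x‖ < ε →
    ∃ h : Close 𝒰 (proj y) (proj x), (closePath h).dir = y - x := by
  obtain ⟨ε, hε, h⟩ := lebesgue_number_lemma_of_metric_sUnion (isCompact_univ (X := Base n))
    𝒰.isOpen 𝒰.covers.ge
  refine ⟨ε, hε, fun x y hxy => ?_⟩
  obtain ⟨U, hU, hball⟩ := h (proj x) (Set.mem_univ _)
  let γ : AffinePath U (proj x) (proj y) := ⟨x, y - x, rfl, by simp, fun t ht => by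
    refine hball (Metric.mem_ball.2 ((dist_proj_le _ _).trans_lt ?_))
    rw [add_sub_cancel_left, norm_smul, Real.norm_of_nonneg ht.1]
    exact (mul_le_of_le_one_left (norm_nonneg _) ht.2).trans_lt hxy⟩
  have hx : proj x ∈ U := by simpa [γ] using γ.mem 0 (by simp)
  have hy : proj y ∈ U := by simpa [γ] using γ.mem 1 (by simp)
  have hc : Close 𝒰 (proj y) (proj x) := ⟨U, hU, hy, hx⟩
  refine ⟨hc, ?_⟩
  have hW : closeSet hc ∈ 𝒰.sets := hc.choose_spec.1
  -- The member chosen by `closeSet` need not be `U`. A path inside the intersection has the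
  -- direction of both paths, by uniqueness in either set.
  obtain ⟨δ⟩ := exists_affinePath (𝒰.chart_inter _ hW _ hU)
    (b := proj y) (c := proj x) ⟨hc.choose_spec.2.1, hy⟩ ⟨hc.choose_spec.2.2, hx⟩
  have h1 := AffinePath.dir_eq (𝒰.chart _ hW) (closePath hc)
    ⟨δ.start, δ.dir, δ.start_eq, δ.end_eq, fun t ht => (δ.mem t ht).1⟩
  have h2 := AffinePath.dir_eq (𝒰.chart _ hU) γ
    ⟨δ.start, δ.dir, δ.start_eq, δ.end_eq, fun t ht => (δ.mem t ht).2⟩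
  exact h1.trans h2.symm

end Pairing

/-! ## Schur's test -/

/-- Schur's test in an orthonormal basis. -/
theorem opNorm_le_of_row_col_sums {ι H : Type*} [Fintype ι] [NormedAddCommGroup H]
    [InnerProductSpace ℂ H] (e : OrthonormalBasis ι ℂ H) (A : H →L[ℂ] H) {E : ι → ι → ℝ} {S : ℝ}
    (hS : 0 ≤ S) (hA : ∀ b c, ‖inner ℂ (e b) (A (e c))‖ ≤ E b c)
    (hrow : ∀ b, ∑ c, E b c ≤ S) (hcol : ∀ c, ∑ b, E b c ≤ S) : ‖A‖ ≤ S := by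
  have hE : ∀ b c, 0 ≤ E b c := fun b c => (norm_nonneg _).trans (hA b c)
  refine A.opNorm_le_bound hS fun x => ?_
  set y : ι → ℝ := fun c => ‖inner ℂ (e c) x‖
  have hy : ∑ c, y c ^ 2 = ‖x‖ ^ 2 := e.sum_sq_norm_inner_right x
  have h1 : ∀ b, ‖inner ℂ (e b) (A x)‖ ≤ ∑ c, E b c * y c := by
    intro b
    have h2 : inner ℂ (e b) (A x) = ∑ c, inner ℂ (e c) x * inner ℂ (e b) (A (e c)) := by
      conv_lhs => rw [← e.sum_repr' x]
      simp only [map_sum, map_smul, inner_sum, inner_smul_right]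
    rw [h2]
    refine (norm_sum_le _ _).trans (Finset.sum_le_sum fun c _ => ?_)
    rw [norm_mul, mul_comm]
    gcongr
    exact hA b c
  -- Cauchy–Schwarz with the weight split as `√E · (√E y)`; row sums are used here, column sums
  -- after summing over `b`.
  have h3 : ∀ b, ‖inner ℂ (e b) (A x)‖ ^ 2 ≤ S * ∑ c, E b c * y c ^ 2 := by
    intro b
    have h4 := Finset.sum_mul_sq_le_sq_mul_sq Finset.univ (fun c => Real.sqrt (E b c))
      fun c => Real.sqrt (E b c) * y c
    simp only [← mul_assoc, Real.mul_self_sqrt (hE b _), Real.sq_sqrt (hE b _), mul_pow] at h4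
    refine (pow_le_pow_left₀ (norm_nonneg _) (h1 b) 2).trans (h4.trans ?_)
    refine mul_le_mul_of_nonneg_right (hrow b) (Finset.sum_nonneg fun c _ => ?_)
    exact mul_nonneg (hE b c) (sq_nonneg _)
  have h5 : ‖A x‖ ^ 2 ≤ (S * ‖x‖) ^ 2 := by
    rw [← e.sum_sq_norm_inner_right (A x)]
    calc ∑ b, ‖inner ℂ (e b) (A x)‖ ^ 2 ≤ ∑ b, S * ∑ c, E b c * y c ^ 2 :=
          Finset.sum_le_sum fun b _ => h3 b
      _ = S * ∑ c, (∑ b, E b c) * y c ^ 2 := by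
          rw [← Finset.mul_sum, Finset.sum_comm]
          simp only [Finset.sum_mul]
      _ ≤ S * ∑ c, S * y c ^ 2 := by
          gcongr with c
          exact hcol c
      _ = (S * ‖x‖) ^ 2 := by
          rw [← Finset.mul_sum, hy]
          ring
  exact (pow_le_pow_iff_left₀ (norm_nonneg _) (by positivity) two_ne_zero).1 h5

/-! ## The orthonormal bases -/

section Bases

variable {n : ℕ} {Ω : Matrix (Fin n) (Fin n) ℂ}

theorem theta_memLp (hΩ : Ω ∈ siegelUpperHalfSpace n) (k : ℕ+) (b : Base n) :
    MemLp (theta Ω k b) 2 (fundMeasure n) := by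
  have hc : Continuous (theta Ω k b) :=
    continuous_of_upstairs (contDiff_upstairs_theta hΩ k b).continuous
  obtain ⟨C, hC⟩ := ((isCompact_closedBall (0 : Fin n → ℝ) 1).prod
    (isCompact_univ (X := Torus n))).exists_bound_of_continuousOn hc.continuousOn
  refine MemLp.of_bound hc.aestronglyMeasurable C
    ((ae_restrict_iff' measurableSet_fundDomain).2 (Filter.Eventually.of_forall fun p hp => ?_))
  exact hC p ⟨mem_closedBall_zero_iff.2 (norm_le_one_of_mem_fundDomain hp), Set.mem_univ _⟩

/-- The theta function as an element of `H⁰(X; L^k)`. -/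
def thetaVec (hΩ : Ω ∈ siegelUpperHalfSpace n) (k : ℕ+) (b : bohrSommerfeld n k) :
    holSpace Ω k :=
  ⟨(theta_memLp hΩ k b.1).toLp _, theta Ω k b.1, isHolomorphicSection_theta hΩ k b.1,
    MemLp.coeFn_toLp (theta_memLp hΩ k b.1)⟩

theorem thetaVec_ae (hΩ : Ω ∈ siegelUpperHalfSpace n) (k : ℕ+) (b : bohrSommerfeld n k) :
    ((thetaVec hΩ k b : L2 n) : Cover n → ℂ) =ᵐ[fundMeasure n] theta Ω k b :=
  MemLp.coeFn_toLp (theta_memLp hΩ k b.1)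

theorem inner_thetaVec_mulOp (hΩ : Ω ∈ siegelUpperHalfSpace n) (k : ℕ+) (f : C(Total n, ℂ))
    (b c : bohrSommerfeld n k) :
    inner ℂ (thetaVec hΩ k b : L2 n) (mulOp f (thetaVec hΩ k c : L2 n)) =
      ∫ p, starRingEnd ℂ (theta Ω k b p) * (f (proj p.1, p.2) * theta Ω k c p)
        ∂fundMeasure n := by
  rw [L2.inner_def]
  refine integral_congr_ae ?_
  have h1 : (mulOp f (thetaVec hΩ k c : L2 n) : Cover n → ℂ) =ᵐ[fundMeasure n]
      fun p => f (proj p.1, p.2) * (thetaVec hΩ k c : L2 n) p :=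
    (mul_memLp f (thetaVec hΩ k c : L2 n)).coeFn_toLp
  filter_upwards [h1, thetaVec_ae hΩ k b, thetaVec_ae hΩ k c] with p h1 h2 h3
  rw [h1, h2, h3, RCLike.inner_apply, mul_comm]

theorem mulOp_one (u : L2 n) : mulOp 1 u = u := by
  refine Lp.ext ?_
  have h1 : (mulOp 1 u : Cover n → ℂ) =ᵐ[fundMeasure n]
      fun p => (1 : C(Total n, ℂ)) (proj p.1, p.2) * u p := (mul_memLp 1 u).coeFn_toLp
  filter_upwards [h1] with p h
  rw [h, ContinuousMap.one_apply, one_mul]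

/-- The constant function has only the zeroth Fourier coefficient, and for `d = 0` the Gaussian
factor is identically one. This gives orthonormality of the theta functions without error term. -/
theorem gaussPairing_one (hΩ : Ω ∈ siegelUpperHalfSpace n) (k : ℕ+) (l d : Fin n → ℤ) :
    gaussPairing Ω k 1 l (l + d) = if d = 0 then 1 else 0 := by
  have h1 : ∀ b : Base n, (fourierCoef (-d) fun θ => (1 : C(Total n, ℂ)) (b, θ)) =
      if d = 0 then 1 else 0 := by
    intro b
    have h2 : (fun θ => (1 : C(Total n, ℂ)) (b, θ)) = char (0 : Fin n → ℤ) := by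
      funext θ
      rw [char_zero, ContinuousMap.one_apply]
    rw [h2, fourierCoef_char]
    simp only [neg_eq_zero]
  have hZ := integral_exp_neg_imQuad_pos hΩ
  have hZ' : ((∫ x : Fin n → ℝ, Real.exp (-imQuad Ω x) : ℝ) : ℂ) ≠ 0 := by
    exact_mod_cast hZ.ne'
  rw [gaussPairing_eq_average hΩ]
  simp only [h1]
  split_ifs with hd
  · have h3 : ∀ s u, gaussFactor Ω 0 s u = 1 := by
      intro s u
      have h4 : intVec (0 : Fin n → ℤ) = 0 := by
        funext j
        simp [intVec]
      simp [gaussFactor, h4, imQuad, bilin_eq_sum]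
    simp only [hd, h3, mul_one]
    rw [integral_complex_ofReal]
    push_cast
    exact inv_mul_cancel₀ hZ'
  · simp

theorem orthonormal_thetaVec (hΩ : Ω ∈ siegelUpperHalfSpace n) (k : ℕ+) :
    Orthonormal ℂ (thetaVec hΩ k) := by
  classical
  rw [orthonormal_iff_ite]
  intro b c
  obtain ⟨l, hl⟩ := mem_bohrSommerfeld_iff.1 b.2
  have h1 := hasSum_theta_pairing hΩ k 1 (c := c.1) hl
  rw [← inner_thetaVec_mulOp hΩ, mulOp_one] at h1
  refine h1.unique ?_
  have h0 : proj (latticePoint k (0 : Fin n → ℤ)) = 0 := by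
    funext j
    simp [proj, latticePoint]
  refine (hasSum_ite_eq (0 : Fin n → ℤ) (if b = c then (1 : ℂ) else 0)).congr_fun fun d => ?_
  rw [gaussPairing_one hΩ]
  by_cases hd : d = 0
  · subst hd
    simp only [h0, if_true, eq_comm (a := (0 : Base n)), sub_eq_zero, Subtype.ext_iff,
      eq_comm (a := c.1)]
  · simp [hd]

theorem span_thetaVec (hΩ : Ω ∈ siegelUpperHalfSpace n) (k : ℕ+) :
    ⊤ ≤ Submodule.span ℂ (Set.range (thetaVec hΩ k)) := by
  rintro ⟨u, s, hs, hu⟩ -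
  obtain ⟨a, ha⟩ := hs.exists_eq_sum_theta hΩ
  have h : (⟨u, s, hs, hu⟩ : holSpace Ω k) = ∑ b, a b • thetaVec hΩ k b := by
    refine Subtype.ext (Lp.ext ?_)
    rw [Submodule.coe_sum]
    have h1 := Lp.coeFn_finsetSum (μ := fundMeasure n) (p := 2) (s := Finset.univ)
      (f := fun b => ((a b • thetaVec hΩ k b : holSpace Ω k) : L2 n))
    have h2 : ∀ᵐ p ∂fundMeasure n, ∀ b,
        ((a b • thetaVec hΩ k b : holSpace Ω k) : L2 n) p = a b * theta Ω k b p := by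
      rw [ae_all_iff]
      intro b
      filter_upwards [thetaVec_ae hΩ k b, Lp.coeFn_smul (a b) (thetaVec hΩ k b : L2 n)]
        with p h3 h4
      rw [Submodule.coe_smul, h4, Pi.smul_apply, h3, smul_eq_mul]
    filter_upwards [hu, h1, h2] with p h3 h4 h5
    rw [h4, Finset.sum_apply]
    simp only [h5]
    exact h3.trans (ha p)
  rw [h]
  exact Submodule.sum_mem _ fun b _ => Submodule.smul_mem _ _ (Submodule.subset_span ⟨b, rfl⟩)

/-- The orthonormal basis of theta functions. -/
def thetaBasis (hΩ : Ω ∈ siegelUpperHalfSpace n) (k : ℕ+) :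
    OrthonormalBasis (bohrSommerfeld n k) ℂ (holSpace Ω k) :=
  OrthonormalBasis.mk (orthonormal_thetaVec hΩ k) (span_thetaVec hΩ k)

theorem thetaBasis_apply (hΩ : Ω ∈ siegelUpperHalfSpace n) (k : ℕ+) (b : bohrSommerfeld n k) :
    thetaBasis hΩ k b = thetaVec hΩ k b := by
  rw [thetaBasis, OrthonormalBasis.coe_mk]

/-- Closedness of `H⁰` comes from finite dimension, through the finite basis of theta functions. -/
theorem holSpace_hasOrthogonalProjection (hΩ : Ω ∈ siegelUpperHalfSpace n) (k : ℕ+) :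
    (holSpace Ω k).HasOrthogonalProjection := by
  have : FiniteDimensional ℂ (holSpace Ω k) := (thetaBasis hΩ k).toBasis.finiteDimensional_of_finite
  infer_instance

/-! ### The basis of the real side, the isomorphism, and the matrix coefficients of both operators.
-/

theorem FiberSpace.eq_smul_frame {k : ℕ+} {b : bohrSommerfeld n k} (s : FiberSpace n k b.1) :
    s = s.val (baseLift b.1) 0 • frame b := by
  rw [← sub_eq_zero]
  refine FiberSpace.eq_zero_of_val (baseLift b.1) ?_
  have h1 : (frame b).val (baseLift b.1) 0 = 1 := by simp [frame, FiberSpace.val, char]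
  have h2 : (s - s.val (baseLift b.1) 0 • frame b).val (baseLift b.1) 0 =
      s.val (baseLift b.1) 0 - s.val (baseLift b.1) 0 * (frame b).val (baseLift b.1) 0 := rfl
  rw [h2, h1]
  ring

theorem orthonormal_frame (n : ℕ) (k : ℕ+) : Orthonormal ℂ fun b : bohrSommerfeld n k =>
    (PiLp.single 2 b (frame b) : QuantumSpace n k) := by
  rw [orthonormal_iff_ite]
  intro b c
  rw [PiLp.inner_apply, Finset.sum_eq_single b]
  · split_ifs with h
    · subst h
      rw [PiLp.single_eq_same, inner_self_eq_norm_sq_to_K, norm_frame]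
      simp
    · rw [PiLp.single_eq_of_ne 2 h, inner_zero_right]
  · intro d _ hd
    rw [PiLp.single_eq_of_ne 2 hd, inner_zero_left]
  · simp

theorem span_frame (n : ℕ) (k : ℕ+) : ⊤ ≤ Submodule.span ℂ (Set.range
    fun b : bohrSommerfeld n k => (PiLp.single 2 b (frame b) : QuantumSpace n k)) := by
  rintro ψ -
  have h : ψ = ∑ b, (ψ b).val (baseLift b.1) 0 •
      (PiLp.single 2 b (frame b) : QuantumSpace n k) := by
    ext c
    rw [WithLp.ofLp_sum, Finset.sum_apply, Finset.sum_eq_single c]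
    · rw [PiLp.smul_apply, PiLp.single_eq_same]
      exact (ψ c).eq_smul_frame
    · intro d _ hd
      rw [PiLp.smul_apply, PiLp.single_eq_of_ne' 2 hd, smul_zero]
    · simp
  rw [h]
  exact Submodule.sum_mem _ fun b _ => Submodule.smul_mem _ _ (Submodule.subset_span ⟨b, rfl⟩)

/-- The orthonormal basis `ϑ_b`. -/
def frameBasis (n : ℕ) (k : ℕ+) : OrthonormalBasis (bohrSommerfeld n k) ℂ (QuantumSpace n k) :=
  OrthonormalBasis.mk (orthonormal_frame n k) (span_frame n k)

theorem frameBasis_apply (n : ℕ) (k : ℕ+) (b : bohrSommerfeld n k) :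
    frameBasis n k b = PiLp.single 2 b (frame b) := by
  rw [frameBasis, OrthonormalBasis.coe_mk]

/-- The unitary isomorphism with `Φ(ϑ_b) = Θ_b`. -/
def thetaIso (hΩ : Ω ∈ siegelUpperHalfSpace n) (k : ℕ+) :
    QuantumSpace n k ≃ₗᵢ[ℂ] holSpace Ω k :=
  (frameBasis n k).equiv (thetaBasis hΩ k) (Equiv.refl _)

theorem thetaIso_frame (hΩ : Ω ∈ siegelUpperHalfSpace n) (k : ℕ+) (b : bohrSommerfeld n k) :
    thetaIso hΩ k (frameBasis n k b) = thetaVec hΩ k b := by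
  rw [thetaIso, OrthonormalBasis.equiv_apply_basis, thetaBasis_apply, Equiv.refl_apply]

theorem coeff_zero (P : Matrix (Fin n) (Fin n) ℝ) (𝒰 : AdmissibleCover n) (k : ℕ+)
    (f : C(Total n, ℂ)) {b c : Base n} (ξ : FiberSpace n k b) :
    coeff P 𝒰 k f ξ (0 : FiberSpace n k c) = 0 := by
  have h := coeff_smul P 𝒰 k f ξ 0 (0 : FiberSpace n k c)
  rwa [zero_smul, zero_mul] at h

theorem inner_deformationQuantization (P : Matrix (Fin n) (Fin n) ℝ) (𝒰 : AdmissibleCover n)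
    (k : ℕ+) (f : C(Total n, ℂ)) (b c : bohrSommerfeld n k) :
    inner ℂ (frameBasis n k b) (deformationQuantization P 𝒰 k f (frameBasis n k c)) =
      coeff P 𝒰 k f (frame b) (frame c) := by
  rw [frameBasis_apply, frameBasis_apply, PiLp.inner_apply, Finset.sum_eq_single b]
  · have h1 : (deformationQuantization P 𝒰 k f (PiLp.single 2 c (frame c))) b =
        (∑ c' : bohrSommerfeld n k, coeff P 𝒰 k f (frame b)
          ((PiLp.single 2 c (frame c) : QuantumSpace n k) c')) • frame b := rfl
    rw [h1, Finset.sum_eq_single c]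
    · rw [PiLp.single_eq_same, PiLp.single_eq_same, inner_smul_right, inner_self_eq_norm_sq_to_K,
        norm_frame]
      simp
    · intro d _ hd
      rw [PiLp.single_eq_of_ne 2 hd, coeff_zero]
    · simp
  · intro d _ hd
    rw [PiLp.single_eq_of_ne 2 hd, inner_zero_left]
  · simp

/-- Paired with a vector of `H⁰` the projection `Π_k` is invisible, so the entry is the plain `L²`
pairing of theta functions with `f` inserted. -/
theorem inner_toeplitz (hΩ : Ω ∈ siegelUpperHalfSpace n) (k : ℕ+)
    [(holSpace Ω k).HasOrthogonalProjection] (f : C(Total n, ℂ)) (b c : bohrSommerfeld n k) :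
    inner ℂ (frameBasis n k b)
      ((((thetaIso hΩ k).symm : holSpace Ω k →L[ℂ] QuantumSpace n k) ∘L toeplitz Ω k f ∘L
        (thetaIso hΩ k : QuantumSpace n k →L[ℂ] holSpace Ω k)) (frameBasis n k c)) =
      ∫ p, starRingEnd ℂ (theta Ω k b p) * (f (proj p.1, p.2) * theta Ω k c p)
        ∂fundMeasure n := by
  change inner ℂ (frameBasis n k b)
    ((thetaIso hΩ k).symm (toeplitz Ω k f (thetaIso hΩ k (frameBasis n k c)))) = _
  rw [← (thetaIso hΩ k).inner_map_map, LinearIsometryEquiv.apply_symm_apply, thetaIso_frame,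
    thetaIso_frame, ← inner_thetaVec_mulOp hΩ]
  exact Submodule.inner_orthogonalProjectionOnto_eq_of_mem_left _ _

end Bases

/-! ## Comparison of the matrix coefficients -/

section Comparison

variable {n : ℕ} {Ω : Matrix (Fin n) (Fin n) ℂ}

open Classical in
/-- The sum of `h` over the lattice points over `g`. -/
def fiberSum (k : ℕ+) (h : (Fin n → ℤ) → ℝ) (g : Base n) : ℝ :=
  ∑' d : Fin n → ℤ, if proj (latticePoint k d) = g then h d else 0

open Classical in
theorem summable_fiber (k : ℕ+) {h : (Fin n → ℤ) → ℝ} (h0 : ∀ d, 0 ≤ h d) (hs : Summable h)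
    (g : Base n) :
    Summable fun d : Fin n → ℤ => if proj (latticePoint k d) = g then h d else 0 := by
  refine Summable.of_nonneg_of_le (fun d => ?_) (fun d => ?_) hs
  · split_ifs
    exacts [h0 d, le_rfl]
  · split_ifs
    exacts [le_rfl, h0 d]

/-- Each lattice vector lies over one point of the base, so distinct points count it at most once.
Taken along a row or a column, this supplies the hypotheses of Schur's test. -/
theorem sum_fiberSum_le {ι : Type*} [Fintype ι] (k : ℕ+) {h : (Fin n → ℤ) → ℝ}
    (h0 : ∀ d, 0 ≤ h d) (hs : Summable h) {g : ι → Base n} (hg : Function.Injective g) :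
    ∑ i, fiberSum k h (g i) ≤ ∑' d, h d := by
  classical
  simp only [fiberSum]
  rw [← Summable.tsum_finsetSum fun i _ => summable_fiber k h0 hs (g i)]
  refine Summable.tsum_le_tsum (fun d => ?_)
    (summable_sum fun i _ => summable_fiber k h0 hs (g i)) hs
  by_cases hd : ∃ i, proj (latticePoint k d) = g i
  · obtain ⟨i, hi⟩ := hd
    rw [Finset.sum_eq_single i, if_pos hi]
    · intro j _ hj
      exact if_neg fun h => hj (hg (h.symm.trans hi))
    · simp
  · rw [Finset.sum_eq_zero fun i _ => if_neg fun h => hd ⟨i, h⟩]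
    exact h0 d

/-- The bound for the contribution of a lattice point to the difference of the two
quantizations. -/
def latticeError (Ω : Matrix (Fin n) (Fin n) ℂ) (f : C(Total n, ℂ)) (F : (Fin n → ℤ) → ℝ)
    (ε : ℝ) (k : ℕ+) (d : Fin n → ℤ) : ℝ :=
  if ‖latticePoint k d‖ < ε then min (2 * F d) (gaussError Ω f d (Real.sqrt k)⁻¹) else 2 * F d

theorem latticeError_nonneg (Ω : Matrix (Fin n) (Fin n) ℂ) (f : C(Total n, ℂ))
    {F : (Fin n → ℤ) → ℝ} (hF : ∀ d, 0 ≤ F d) (ε : ℝ) (k : ℕ+) (d : Fin n → ℤ) :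
    0 ≤ latticeError Ω f F ε k d := by
  have := hF d
  unfold latticeError
  split_ifs
  · exact le_min (by positivity) (gaussError_nonneg _ _ _ _)
  · positivity

theorem latticeError_le (Ω : Matrix (Fin n) (Fin n) ℂ) (f : C(Total n, ℂ))
    (F : (Fin n → ℤ) → ℝ) (ε : ℝ) (k : ℕ+) (d : Fin n → ℤ) :
    latticeError Ω f F ε k d ≤ 2 * F d := by
  unfold latticeError
  split_ifs
  exacts [min_le_left _ _, le_rfl]

theorem tendsto_latticePoint (d : Fin n → ℤ) :
    Filter.Tendsto (fun k : ℕ+ => latticePoint k d) Filter.atTop (nhds 0) := by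
  rw [tendsto_pi_nhds]
  intro j
  exact tendsto_const_nhds.div_atTop
    (tendsto_natCast_atTop_atTop.comp tendsto_PNat_val_atTop_atTop)

/-- Dominated convergence with majorant `2F`: for fixed `d`, eventually `‖d/k‖ < ε`, and then the
error is at most the vanishing Gaussian error. -/
theorem tendsto_tsum_latticeError (hΩ : Ω ∈ siegelUpperHalfSpace n) (f : C(Total n, ℂ))
    {F : (Fin n → ℤ) → ℝ} (hF : ∀ d, 0 ≤ F d) (hs : Summable F) {ε : ℝ} (hε : 0 < ε) :
    Filter.Tendsto (fun k : ℕ+ => ∑' d, latticeError Ω f F ε k d) Filter.atTop (nhds 0) := by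
  rw [← tsum_zero (α := ℝ) (β := Fin n → ℤ)]
  refine tendsto_tsum_of_dominated_convergence (hs.mul_left 2) (fun d => ?_)
    (Filter.Eventually.of_forall fun k d => ?_)
  · refine squeeze_zero' (Filter.Eventually.of_forall fun k =>
      latticeError_nonneg Ω f hF ε k d) ?_ (tendsto_gaussError hΩ f d)
    filter_upwards [(tendsto_latticePoint d).norm.eventually_lt_const (by simpa using hε)]
      with k hk
    rw [latticeError, if_pos hk]
    exact min_le_right _ _
  · rw [Real.norm_of_nonneg (latticeError_nonneg Ω f hF ε k d)]
    exact latticeError_le Ω f F ε k d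

theorem latticePoint_injective (k : ℕ+) : Function.Injective (latticePoint (n := n) k) := by
  intro d d' h
  have hk : (k : ℝ) ≠ 0 := by exact_mod_cast k.ne_zero
  funext j
  have h1 := congrFun h j
  simp only [latticePoint] at h1
  field_simp at h1
  exact_mod_cast h1

/-- Points with close lifts are close in the covering, with the expected affine path. -/
theorem close_of_latticePoint {𝒰 : AdmissibleCover n} {ε : ℝ}
    (hε : ∀ x y : Fin n → ℝ, ‖y - x‖ < ε →
      ∃ h : Close 𝒰 (proj y) (proj x), (closePath h).dir = y - x)
    {k : ℕ+} {b c : Base n} {l d : Fin n → ℤ} (hl : proj (latticePoint k l) = b)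
    (hd : proj (latticePoint k d) = c - b) (hlt : ‖latticePoint k d‖ < ε) :
    ∃ h : Close 𝒰 b c, (closePath h).dir = -latticePoint k d := by
  have hc : proj (latticePoint k l + latticePoint k d) = c := by
    rw [proj_add, hl, hd]
    abel
  subst hl
  subst hc
  have e : latticePoint k l - (latticePoint k l + latticePoint k d) = -latticePoint k d := by abel
  obtain ⟨h, h1⟩ := hε (latticePoint k l + latticePoint k d) (latticePoint k l)
    (by rwa [e, norm_neg])
  exact ⟨h, h1.trans e⟩

/-- The Kähler entry is a series over the class `c - b`; the real entry is a single term `d₁` when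
`b` and `c` are close, and zero otherwise. A short `d` in this class must be `d₁`, and the Gaussian
approximation applies; for the others the decay of Fourier coefficients suffices. -/
theorem norm_coeff_sub_le (hΩ : Ω ∈ siegelUpperHalfSpace n) {𝒰 : AdmissibleCover n}
    (P : Matrix (Fin n) (Fin n) ℝ) (f : C(Total n, ℂ)) {F : (Fin n → ℤ) → ℝ}
    (hF : ∀ d b, ‖fourierCoef (-d) fun θ => f (b, θ)‖ ≤ F d) (hs : Summable F) {ε : ℝ}
    (hε : ∀ x y : Fin n → ℝ, ‖y - x‖ < ε →
      ∃ h : Close 𝒰 (proj y) (proj x), (closePath h).dir = y - x)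
    {k : ℕ+} (b c : bohrSommerfeld n k) :
    ‖coeff P 𝒰 k f (frame b) (frame c) -
      ∫ p, starRingEnd ℂ (theta Ω k b p) * (f (proj p.1, p.2) * theta Ω k c p)
        ∂fundMeasure n‖ ≤ fiberSum k (latticeError Ω f F ε k) (c.1 - b.1) := by
  classical
  have hF0 : ∀ d, 0 ≤ F d := fun d => (norm_nonneg _).trans (hF d 0)
  have hsum : HasSum (fun d => if proj (latticePoint k d) = c.1 - b.1 then
      latticeError Ω f F ε k d else 0) (fiberSum k (latticeError Ω f F ε k) (c.1 - b.1)) :=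
    (summable_fiber k (latticeError_nonneg Ω f hF0 ε k)
      (.of_nonneg_of_le (latticeError_nonneg Ω f hF0 ε k) (latticeError_le Ω f F ε k)
        (hs.mul_left 2)) _).hasSum
  obtain ⟨l, hl⟩ := mem_bohrSommerfeld_iff.1 b.2
  have hA := hasSum_theta_pairing hΩ k f (c := c.1) hl
  set X : (Fin n → ℤ) → ℂ := fun d => fourierCoef (-d) fun θ =>
    f (proj (latticePoint k l + (1 / 2 : ℝ) • latticePoint k d), θ) with hX
  have hJ : ∀ d, ‖gaussPairing Ω k f l (l + d)‖ ≤ F d := fun d =>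
    norm_gaussPairing_le hΩ k f l d (hF d)
  by_cases hclose : Close 𝒰 b.1 c.1
  · obtain ⟨d₁, hd₁, hpair⟩ := (closePath hclose).pairing_frame P f
    set γ := closePath hclose
    have hproj : proj (latticePoint k d₁) = c.1 - b.1 := by
      have h1 : latticePoint k d₁ = γ.start - (γ.start + γ.dir) := by
        rw [hd₁]
        abel
      rw [h1, proj_sub, γ.start_eq, γ.end_eq]
    -- The lift of `b` on the path and `l/k` differ by an integral vector. Only the displacement is
    -- halved, so both midpoints project to the same point.
    have hmid : proj (latticePoint k l + (1 / 2 : ℝ) • latticePoint k d₁) =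
        proj (γ.start + (1 / 2 : ℝ) • γ.dir) := by
      have h1 : γ.start + (1 / 2 : ℝ) • γ.dir =
          (γ.start + γ.dir) + (1 / 2 : ℝ) • latticePoint k d₁ := by
        rw [hd₁]
        module
      rw [h1, proj_add, proj_add, hl, γ.end_eq]
    have hcoeff : coeff P 𝒰 k f (frame b) (frame c) = X d₁ := by
      rw [coeff, dif_pos hclose, hpair]
      simp only [hX, hmid]
    rw [hcoeff]
    -- The real entry is written as a one-term series, and the two series are compared term by term.
    refine ((hasSum_ite_eq d₁ (X d₁)).sub hA).norm_le_of_bounded hsum fun d => ?_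
    by_cases hd : proj (latticePoint k d) = c.1 - b.1
    · rw [if_pos hd, if_pos hd, latticeError]
      have h2F : ‖(if d = d₁ then X d₁ else 0) - gaussPairing Ω k f l (l + d)‖ ≤ 2 * F d := by
        refine (norm_sub_le _ _).trans ?_
        rw [two_mul]
        refine add_le_add ?_ (hJ d)
        split_ifs with h
        · rw [← h]
          exact hF d _
        · rw [norm_zero]
          exact hF0 d
      by_cases h1 : ‖latticePoint k d‖ < ε
      · obtain ⟨h', hdir⟩ := close_of_latticePoint hε hl hd h1
        have h2 : d = d₁ := latticePoint_injective k (by rw [hd₁, hdir, neg_neg])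
        rw [if_pos h2] at h2F ⊢
        rw [if_pos h1]
        refine le_min h2F ?_
        rw [norm_sub_rev, ← h2]
        exact norm_gaussPairing_sub_le hΩ k f l d
      · rw [if_neg h1]
        exact h2F
    · rw [if_neg hd, if_neg hd, if_neg (by rintro rfl; exact hd hproj), sub_zero, norm_zero]
  · rw [coeff, dif_neg hclose, zero_sub, norm_neg]
    refine hA.norm_le_of_bounded hsum fun d => ?_
    by_cases hd : proj (latticePoint k d) = c.1 - b.1
    · rw [if_pos hd, if_pos hd, latticeError, if_neg]
      · linarith [hJ d, hF0 d]
      · intro h1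
        exact hclose (close_of_latticePoint hε hl hd h1).1
    · rw [if_neg hd, if_neg hd, norm_zero]

end Comparison

end TorusQuant

end

/-! ### Convergence of the two quantizations in operator norm. -/

theorem mainTheorem8 (n : ℕ) (Ω : Matrix (Fin n) (Fin n) ℂ)
    (hΩ : Ω ∈ TorusQuant.siegelUpperHalfSpace n) (𝒰 : TorusQuant.AdmissibleCover n) :
    ∃ (_ : ∀ k : ℕ+, (TorusQuant.holSpace Ω k).HasOrthogonalProjection)
      (Φ : ∀ k : ℕ+, TorusQuant.QuantumSpace n k ≃ₗᵢ[ℂ] TorusQuant.holSpace Ω k),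
      (∀ (k : ℕ+) (b : TorusQuant.bohrSommerfeld n k),
        ((Φ k (PiLp.single 2 b (TorusQuant.frame b)) : TorusQuant.L2 n) :
          TorusQuant.Cover n → ℂ) =ᵐ[TorusQuant.fundMeasure n] TorusQuant.theta Ω k b) ∧
      ∀ f : C(TorusQuant.Total n, ℂ), TorusQuant.IsSmooth f →
        Filter.Tendsto
          (fun k : ℕ+ =>
            ‖TorusQuant.deformationQuantization (Ω.map Complex.re) 𝒰 k f -
              ((Φ k).symm : TorusQuant.holSpace Ω k →L[ℂ] TorusQuant.QuantumSpace n k) ∘L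
                TorusQuant.toeplitz Ω k f ∘L
                  (Φ k : TorusQuant.QuantumSpace n k →L[ℂ] TorusQuant.holSpace Ω k)‖)
          Filter.atTop (nhds 0) := by
  refine ⟨fun k => TorusQuant.holSpace_hasOrthogonalProjection hΩ k,
    fun k => TorusQuant.thetaIso hΩ k, fun k b => ?_, fun f hf => ?_⟩
  · rw [← TorusQuant.frameBasis_apply, TorusQuant.thetaIso_frame]
    exact TorusQuant.thetaVec_ae hΩ k b
  · obtain ⟨C, hC, hdecay⟩ := hf.exists_decay
    obtain ⟨ε, hε, hclose⟩ := TorusQuant.exists_close_radius 𝒰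
    -- The majorant is even in `d`, so it also bounds the coefficients of index `-d`.
    set F : (Fin n → ℤ) → ℝ := fun d => C * (∏ j, (1 + (d j : ℝ) ^ 2))⁻¹ with hFdef
    have hF : ∀ d b, ‖TorusQuant.fourierCoef (-d) fun θ => f (b, θ)‖ ≤ F d := fun d b => by
      simpa [hFdef] using hdecay (-d) b
    have hF0 : ∀ d, 0 ≤ F d := fun d => (norm_nonneg _).trans (hF d 0)
    have hs : Summable F := (TorusQuant.summable_lattice_decay n).mul_left C
    refine squeeze_zero (fun k => norm_nonneg _) (fun k => ?_)
      (TorusQuant.tendsto_tsum_latticeError hΩ f hF0 hs hε)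
    have h0 := TorusQuant.latticeError_nonneg Ω f hF0 ε k
    have hsum : Summable (TorusQuant.latticeError Ω f F ε k) :=
      .of_nonneg_of_le h0 (TorusQuant.latticeError_le Ω f F ε k) (hs.mul_left 2)
    have := TorusQuant.holSpace_hasOrthogonalProjection hΩ k
    -- The bounding matrix depends only on `c - b`, which is injective in either variable; rows and
    -- columns obey the same bound.
    refine TorusQuant.opNorm_le_of_row_col_sums (TorusQuant.frameBasis n k) _
      (E := fun b c => TorusQuant.fiberSum k (TorusQuant.latticeError Ω f F ε k) (c.1 - b.1))
      (tsum_nonneg h0) (fun b c => ?_) (fun b => ?_) (fun c => ?_)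
    · rw [sub_apply, inner_sub_right,
        TorusQuant.inner_deformationQuantization, TorusQuant.inner_toeplitz]
      exact TorusQuant.norm_coeff_sub_le hΩ _ f hF hs hclose b c
    · exact TorusQuant.sum_fiberSum_le k h0 hsum
        (sub_left_injective.comp Subtype.val_injective)
    · exact TorusQuant.sum_fiberSum_le k h0 hsum
        (sub_right_injective.comp Subtype.val_injective)
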